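/- A circuit over a finite set of Boolean variables is a finite directed acyclic graph whose vertices are one input vertex (without predecessors) for each variable, and gates, each gate having exactly two distinct predecessors. Given an associative symmetric operator $\circ\colon\{0,1\}^2\to\{0,1\}$, the input vertex of $x_i$ computes $x_i$, and a gate computes the $\circ$-combination of the functions computed by its two predecessors. An instance of Binary Symmetric Tree Size Optimization (BSTSO) consists of such an operator $\circ$ and a finite family $\mathcal T$ of nonempty finite sets of variable indices, called trees; its variables are the $x_i$ with $i\in\bigcup_{T\in\mathcal T}T$. A solution is a circuit over these variables such that for each $T\in\mathcal T$ there is a vertex $v$ computing $\bigcirc_{i\in T}x_i$ for which the undirected graph underlying the subcircuit of $v$ (the vertices from which $v$ can be reached) contains no cycle. The size of a solution is its number of gates, and $\operatorname{opt}$ is the minimum size of a solution. Let $k=\max\{|T| : T\in\mathcal T\}$ (and $k=0$ if $\mathcal T=\emptyset$). Then: (i) There is an algorithm that, for every BSTSO instance with $k\le 3$, computes, in time polynomial in the encoding length of the instance, a solution of size at most $\frac43\operatorname{opt}$. (ii) There is an algorithm that, for every BSTSO instance with $k\le 4$, computes, in time polynomial in the encoding length of the instance, a solution of size at most $1.9\operatorname{opt}$.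 (iii) There is an algorithm that, for every BSTSO instance, computes, in time polynomial in the encoding length of the instance, a solution of size at most $\frac23 k\operatorname{opt}$. -/

import Mathlib

namespace BSTSO

/-! ### Circuits -/

/-- Vertices of circuits: the input vertex of the variable `x_i`, and the gate number `j`. -/
inductive Vertex where
  | input (i : ℕ) : Vertex
  | gate (j : ℕ) : Vertex
  deriving DecidableEq

/-- A circuit is given by its gates in topological order, **newest gate first**; each gate is given
by its two predecessors.  The gates are numbered `0, 1, 2, …` in the order in which they are added,
so that in `g :: C` the gate `g` has number `C.length`. -/
abbrev Circuit : Type := List (Vertex × Vertex)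

namespace Circuit

/-- `v` is a vertex of a circuit with gates `C` and set of variables `X`. -/
def IsVertex (X : Finset ℕ) (C : Circuit) : Vertex → Prop
  | .input i => i ∈ X
  | .gate j => j < C.length

/-- Well-formed circuits over the set of variables `X`: every gate has exactly two (hence distinct)
predecessors, each of which is an input vertex or an earlier gate. -/
def WellFormed (X : Finset ℕ) : Circuit → Prop
  | [] => True
  | g :: C => g.1 ≠ g.2 ∧ IsVertex X C g.1 ∧ IsVertex X C g.2 ∧ WellFormed X C

/-- The size of a circuit: its number of gates. -/
def size (C : Circuit) : ℕ := C.length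

/-- `C.Arc u v`: the directed graph of the circuit has an edge from `u` to `v`. -/
def Arc : Circuit → Vertex → Vertex → Prop
  | [], _, _ => False
  | g :: C, u, v => (v = .gate C.length ∧ (u = g.1 ∨ u = g.2)) ∨ Arc C u v

/-- The value computed at a vertex, for the operator `op` and the assignment `x` of the variables.
(Gates that do not exist get the value `false`; they are never used.) -/
def value (op : Bool → Bool → Bool) (x : ℕ → Bool) : Circuit → Vertex → Bool
  | _, .input i => x i
  | [], .gate _ => false
  | g :: C, .gate j =>
      if j = C.length then op (value op x C g.1) (value op x C g.2) else value op x C (.gate j)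

/-- The undirected graph underlying the subcircuit of `v`, i.e. the part of the circuit formed by
the vertices from which `v` can be reached. -/
def subcircuitGraph (C : Circuit) (v : Vertex) : SimpleGraph Vertex :=
  SimpleGraph.fromRel fun a b => C.Arc a b ∧ Relation.ReflTransGen C.Arc b v

end Circuit

/-! ### The problem -/

/-- `x_{i₁} ∘ x_{i₂} ∘ ⋯ ∘ x_{iₗ}` for a nonempty list of indices (`false` for the empty list). -/
def listOp (op : Bool → Bool → Bool) (x : ℕ → Bool) : List ℕ → Bool
  | [] => false
  | i :: l => l.foldl (fun b j => op b (x j)) (x i)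

/-- The Boolean function `◯_{i ∈ T} x_i` of a (nonempty) tree `T`. -/
def treeFun (op : Bool → Bool → Bool) (T : Finset ℕ) (x : ℕ → Bool) : Bool :=
  listOp op x (T.sort (· ≤ ·))

/-- The variables of an instance: the union of its trees. -/
def varSet (𝒯 : Finset (Finset ℕ)) : Finset ℕ := 𝒯.biUnion id

/-- The maximum number `k` of variables of a tree (`0` if there are no trees). -/
def maxTreeSize (𝒯 : Finset (Finset ℕ)) : ℕ := 𝒯.sup Finset.card

/-- The circuit `C` over the variables of `𝒯` computes `◯_{i ∈ T} x_i` for each tree `T ∈ 𝒯`, at a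
vertex whose subcircuit has no undirected cycle. -/
def IsSolution (op : Bool → Bool → Bool) (𝒯 : Finset (Finset ℕ)) (C : Circuit) : Prop :=
  C.WellFormed (varSet 𝒯) ∧
    ∀ T ∈ 𝒯, ∃ v : Vertex, C.IsVertex (varSet 𝒯) v ∧ (C.subcircuitGraph v).IsAcyclic ∧
      ∀ x : ℕ → Bool, C.value op x v = treeFun op T x

/-! ### Algorithms and their running time

Algorithms are programs of a small `while` language working on binary trees (the data type of
Lisp).  Each instruction is charged the full size of the data it is applied to, so polynomial time
for these programs is the same as polynomial time for Turing machines. -/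

/-- Data of programs: binary trees. -/
inductive Data where
  | nil : Data
  | cons (a b : Data) : Data

namespace Data

/-- Number of nodes. -/
def size : Data → ℕ
  | nil => 1
  | cons a b => a.size + b.size + 1

def head : Data → Data
  | nil => nil
  | cons a _ => a

def tail : Data → Data
  | nil => nil
  | cons _ b => b

end Data

/-- Programs.  `test P Q R` is "if `P` then `Q` else `R`" and `loop P Q` is "while `P` do `Q`"; the
value `nil` is read as "false", all other values as "true".  `eq` tests whether the two halves of its
data are equal, `pair P Q` pairs the results of `P` and `Q`, and `comp P Q` is "first `P`, then
`Q`". -/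
inductive Prog where
  | id : Prog
  | nil : Prog
  | head : Prog
  | tail : Prog
  | eq : Prog
  | pair (P Q : Prog) : Prog
  | comp (P Q : Prog) : Prog
  | test (P Q R : Prog) : Prog
  | loop (P Q : Prog) : Prog

/-- `Runs P d r t`: started on the data `d`, the program `P` halts with result `r` after time `t`.
Executing an instruction on `d` costs `d.size` plus the cost of the instructions it calls. -/
inductive Runs : Prog → Data → Data → ℕ → Prop where
  | id (d : Data) : Runs .id d d d.size
  | nil (d : Data) : Runs .nil d .nil d.size
  | head (d : Data) : Runs .head d d.head d.size
  | tail (d : Data) : Runs .tail d d.tail d.size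
  | eq_true (d : Data) (h : d.head = d.tail) : Runs .eq d (.cons .nil .nil) (d.size + 2)
  | eq_false (d : Data) (h : d.head ≠ d.tail) : Runs .eq d .nil d.size
  | pair {P Q : Prog} {d r₁ r₂ : Data} {t₁ t₂ : ℕ} (h₁ : Runs P d r₁ t₁) (h₂ : Runs Q d r₂ t₂) :
      Runs (.pair P Q) d (.cons r₁ r₂) (d.size + t₁ + t₂)
  | comp {P Q : Prog} {d e r : Data} {t₁ t₂ : ℕ} (h₁ : Runs P d e t₁) (h₂ : Runs Q e r t₂) :
      Runs (.comp P Q) d r (d.size + t₁ + t₂)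
  | test_true {P Q R : Prog} {d c r : Data} {t₁ t₂ : ℕ} (h₁ : Runs P d c t₁) (hc : c ≠ .nil)
      (h₂ : Runs Q d r t₂) : Runs (.test P Q R) d r (d.size + t₁ + t₂)
  | test_false {P Q R : Prog} {d r : Data} {t₁ t₂ : ℕ} (h₁ : Runs P d .nil t₁)
      (h₂ : Runs R d r t₂) : Runs (.test P Q R) d r (d.size + t₁ + t₂)
  | loop_done {P Q : Prog} {d : Data} {t : ℕ} (h : Runs P d .nil t) :
      Runs (.loop P Q) d d (d.size + t)
  | loop_step {P Q : Prog} {d c e r : Data} {t₁ t₂ t₃ : ℕ} (h₁ : Runs P d c t₁) (hc : c ≠ .nil)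
      (h₂ : Runs Q d e t₂) (h₃ : Runs (.loop P Q) e r t₃) :
      Runs (.loop P Q) d r (d.size + t₁ + t₂ + t₃)

/-! ### Encodings -/

def encodeList {α : Type} (f : α → Data) : List α → Data
  | [] => .nil
  | a :: l => .cons (f a) (encodeList f l)

def encodeBool : Bool → Data
  | false => .nil
  | true => .cons .nil .nil

/-- Indices of variables are written in binary. -/
def encodeIndex (i : ℕ) : Data := encodeList encodeBool i.bits

/-- Gate numbers of the output are written in unary. -/
def encodeVertex : Vertex → Data
  | .input i => .cons .nil (encodeIndex i)
  | .gate j => .cons (.cons .nil .nil) (encodeList (fun _ : Unit => Data.nil) (List.replicate j ()))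

def encodeCircuit (C : Circuit) : Data :=
  encodeList (fun g : Vertex × Vertex => .cons (encodeVertex g.1) (encodeVertex g.2)) C

/-- `w` lists the trees of `𝒯`, each as the list of its elements, in any order but without
repetitions. -/
def Lists (w : List (List ℕ)) (𝒯 : Finset (Finset ℕ)) : Prop :=
  (∀ l ∈ w, l.Nodup) ∧ (w.map List.toFinset).Nodup ∧ (w.map List.toFinset).toFinset = 𝒯

/-- The input: the truth table of the operator, and the list of the trees. -/
def encodeInstance (op : Bool → Bool → Bool) (w : List (List ℕ)) : Data :=
  .cons
    (encodeList encodeBool [op false false, op false true, op true false, op true true])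
    (encodeList (encodeList encodeIndex) w)

/-- There is a polynomial-time algorithm that finds, for every associative symmetric operator and
every family `𝒯` of nonempty trees with `Adm 𝒯`, a solution whose size is at most `α 𝒯` times the
size of every solution (equivalently, of an optimum one). -/
def HasEfficientApprox (Adm : Finset (Finset ℕ) → Prop) (α : Finset (Finset ℕ) → ℚ) : Prop :=
  ∃ (P : Prog) (p : Polynomial ℕ),
    ∀ op : Bool → Bool → Bool, (∀ a b c, op (op a b) c = op a (op b c)) →
      (∀ a b, op a b = op b a) →
    ∀ 𝒯 : Finset (Finset ℕ), (∀ T ∈ 𝒯, T.Nonempty) → Adm 𝒯 →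
    ∀ w : List (List ℕ), Lists w 𝒯 →
      ∃ (C : Circuit) (t : ℕ), Runs P (encodeInstance op w) (encodeCircuit C) t ∧
        t ≤ p.eval (encodeInstance op w).size ∧
        IsSolution op 𝒯 C ∧
        ∀ C' : Circuit, IsSolution op 𝒯 C' → (C.size : ℚ) ≤ α 𝒯 * (C'.size : ℚ)

end BSTSO

/-! For a non-constant operator, `◯_{i ∈ T} x_i` depends on exactly the variables of `T`, so it
determines `T` (`treeFun_injOn`). A subcircuit is acyclic exactly when the two predecessors of each
of its gates have disjoint leaf sets (`exists_isTree`, `Circuit.IsTree.isAcyclic`). Hence a solution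
yields a decomposable family `F`, with at most one set per gate, that contains every tree with at
least two elements (`IsSolution.exists_family`). Conversely, a plan, in which each set splits into
two disjoint earlier sets or singletons, is a circuit with one gate per set (`IsPlan.toCircuit`).
For constant operators one gate is enough.

The algorithms differ only in the auxiliary sets placed before the trees. The trees follow by
increasing size, and each is obtained greedily from what is available. `length_plan_sortLen_le`
bounds the plan by the cost of the auxiliary sets plus any realisable costs of the trees. The lower
bound is `|F|`, counted as trees with at least two elements plus members of `F` that are not trees.
Each guarantee is a charging argument that gives every member of `F` a fixed budget.

Arbitrary `k` (`preHalf_spec`), budget `2k/3`: a tree that contains a smaller tree of at least half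
its size needs at most `k/2` gates. If three or more of the other trees strictly contain a common
set of at least half their size, building that set and extending it costs at most `2k/3` per tree. A
tree left over may cost up to `k - 1`. If this exceeds its budget, the larger part of its
decomposition in `F` is not a tree, and at most two left-over trees share that part, since three
would have formed a cluster. So the part can afford to pay `k/3` to each of them.

`k ≤ 4` (`preSmall_spec`), budget `38/20`, improved to `40/30` if `k ≤ 3`: a four-element tree
containing a three-element tree costs one gate, and trees clustered around a triple cost at most
`5/3` on average. For the others, pairs are bought in two rounds: first pairs inside at least five
trees that still need more than one gate, then pairs that save a gate in at least two trees. The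
trees that pass the test share the price. A tree whose costs exceed its budget contains pairs or a
triple of `F` that are not trees and were not bought. These contribute: an unbought pair serves at
most four trees for the first round and one for the second, and a triple serves at most two. The
budgets suffice because `4·7 + 7 ≤ 38`, `2·19 = 38` and `4·5 + 15 ≤ 40`; the accounts of single
trees are settled in `balance_of_length_three` and `balance_of_length_four`.

For the running time, functions computed in polynomial time (`PT`) are closed under composition,
case distinction and folds whose state grows additively (`PT.foldlT`). The algorithms are assembled
from these operations. -/

namespace BSTSO

/-! ### Encoded types and polynomial bounds -/

/-- Types whose elements are encoded as data of programs. -/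
class Enc (α : Type) where
  enc : α → Data

open Enc (enc)

instance : Enc Unit := ⟨fun _ => .nil⟩
instance : Enc Bool := ⟨encodeBool⟩
instance : Enc ℕ := ⟨encodeIndex⟩
instance : Enc Vertex := ⟨encodeVertex⟩
instance {α : Type} [Enc α] : Enc (List α) := ⟨encodeList enc⟩
instance {α β : Type} [Enc α] [Enc β] : Enc (α × β) := ⟨fun p => .cons (enc p.1) (enc p.2)⟩

/-- The encoding length. -/
def sz {α : Type} [Enc α] (a : α) : ℕ := (enc a).size

theorem Data.size_pos (d : Data) : 1 ≤ d.size := by cases d <;> simp [Data.size]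

theorem sz_pos {α : Type} [Enc α] (a : α) : 1 ≤ sz a := Data.size_pos _

@[simp] theorem sz_prod {α β : Type} [Enc α] [Enc β] (a : α) (b : β) :
    sz (a, b) = sz a + sz b + 1 := rfl

@[simp] theorem sz_nil {α : Type} [Enc α] : sz ([] : List α) = 1 := rfl

@[simp] theorem sz_cons {α : Type} [Enc α] (a : α) (l : List α) :
    sz (a :: l) = sz a + sz l + 1 := rfl

theorem encodeList_injective {α : Type} {f : α → Data} (hf : Function.Injective f) :
    Function.Injective (encodeList f) := by
  intro l
  induction l with
  | nil => intro m h; cases m with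
    | nil => rfl
    | cons b m => cases h
  | cons a l ih => intro m h; cases m with
    | nil => cases h
    | cons b m =>
      simp only [encodeList, Data.cons.injEq] at h
      rw [hf h.1, ih h.2]

theorem encodeBool_injective : Function.Injective encodeBool := by
  intro a b h
  cases a <;> cases b <;> simp_all [encodeBool]

theorem bits_injective : Function.Injective Nat.bits := by
  intro m
  induction m using Nat.binaryRec' with
  | zero => intro n h
            induction n using Nat.binaryRec' with
            | zero => rfl
            | bit b n hn _ => rw [Nat.bits_append_bit _ _ hn] at h; simp at h
  | bit b m hm ih => intro n h
                     induction n using Nat.binaryRec' with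
                     | zero => rw [Nat.bits_append_bit _ _ hm] at h; simp at h
                     | bit c n hn _ =>
                      rw [Nat.bits_append_bit _ _ hm, Nat.bits_append_bit _ _ hn] at h
                      simp only [List.cons.injEq] at h
                      rw [h.1, ih h.2]

theorem enc_nat_injective : Function.Injective (enc : ℕ → Data) := fun _ _ h =>
  bits_injective (encodeList_injective encodeBool_injective h)

theorem enc_bits_injective : Function.Injective (enc : List Bool → Data) :=
  encodeList_injective encodeBool_injective

/-- `f` is bounded by a polynomial in the encoding length. -/
def PolyB {α : Type} [Enc α] (f : α → ℕ) : Prop := ∃ c, ∀ a, f a ≤ (sz a + 1) ^ c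

section
variable {α β γ σ : Type} [Enc α] [Enc β] [Enc γ] [Enc σ]

theorem PolyB.mono {f g : α → ℕ} (hg : PolyB g) (h : ∀ a, f a ≤ g a) : PolyB f :=
  hg.imp fun _ hc a => (h a).trans (hc a)

theorem PolyB.sz : PolyB (sz : α → ℕ) := ⟨1, fun a => by simp⟩

theorem PolyB.const (k : ℕ) : PolyB (fun _ : α => k) :=
  ⟨k, fun a => Nat.lt_two_pow_self.le.trans
    (Nat.pow_le_pow_left (by have := sz_pos a; omega) k)⟩

theorem PolyB.add {f g : α → ℕ} (hf : PolyB f) (hg : PolyB g) : PolyB (fun a => f a + g a) := by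
  obtain ⟨c, hc⟩ := hf
  obtain ⟨d, hd⟩ := hg
  refine ⟨max c d + 1, fun a => ?_⟩
  -- The base is at least 2, so one additional factor absorbs the sum of two powers.
  have h2 : 2 ≤ BSTSO.sz a + 1 := by have := sz_pos a; omega
  have h1 := (hc a).trans (Nat.pow_le_pow_right (by omega : 0 < BSTSO.sz a + 1) (le_max_left c d))
  have h3 := (hd a).trans (Nat.pow_le_pow_right (by omega : 0 < BSTSO.sz a + 1) (le_max_right c d))
  rw [pow_succ]
  nlinarith [Nat.zero_le ((BSTSO.sz a + 1) ^ max c d)]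

theorem PolyB.mul {f g : α → ℕ} (hf : PolyB f) (hg : PolyB g) : PolyB (fun a => f a * g a) := by
  obtain ⟨c, hc⟩ := hf
  obtain ⟨d, hd⟩ := hg
  exact ⟨c + d, fun a => by rw [pow_add]; exact Nat.mul_le_mul (hc a) (hd a)⟩

theorem PolyB.pow {f : α → ℕ} (hf : PolyB f) (k : ℕ) : PolyB (fun a => f a ^ k) := by
  obtain ⟨c, hc⟩ := hf
  exact ⟨c * k, fun a => by rw [pow_mul]; exact Nat.pow_le_pow_left (hc a) k⟩

theorem PolyB.comp {f : β → ℕ} {g : α → β} (hf : PolyB f) (hg : PolyB fun a => BSTSO.sz (g a)) :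
    PolyB (fun a => f (g a)) := by
  obtain ⟨c, hc⟩ := hf
  exact ((hg.add (PolyB.const 1)).pow c).mono fun a => hc (g a)

/-- `f` applied to the head of the list `l`, or `d` if `l` is empty. -/
def headElim {β γ : Type} (l : List β) (d : γ) (f : β → γ) : γ :=
  match l with
  | [] => d
  | b :: _ => f b

/-! ### Polynomial-time computable functions -/

/-- Every instruction is charged at least for what it produces. Polynomial time therefore implies
polynomial output size, which composition relies on. -/
theorem Runs.size_le {P : Prog} {d r : Data} {t : ℕ} (h : Runs P d r t) : r.size ≤ t := by
  have hd (d : Data) : 1 ≤ d.size := d.size_pos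
  induction h with
  | id => rfl
  | nil d => exact hd d
  | head d => cases d <;> simp [Data.head, Data.size]; omega
  | tail d => cases d <;> simp [Data.tail, Data.size]; omega
  | eq_true d h => have := hd d; simp [Data.size]; omega
  | eq_false d => exact hd d
  | @pair P Q d r₁ r₂ t₁ t₂ _ _ h₁ h₂ => have := hd d; simp only [Data.size]; omega
  | comp _ _ h₁ h₂ => omega
  | test_true => omega
  | test_false => omega
  | loop_done => omega
  | loop_step => omega

/-- `f` is computed by a program in polynomial time. -/
@[fun_prop] def PT (f : α → β) : Prop :=
  ∃ (P : Prog) (T : α → ℕ), PolyB T ∧ ∀ a, ∃ t, Runs P (enc a) (enc (f a)) t ∧ t ≤ T a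

theorem PT.polyB {f : α → β} (hf : PT f) : PolyB (fun a => sz (f a)) := by
  obtain ⟨P, T, hT, h⟩ := hf
  refine hT.mono fun a => ?_
  obtain ⟨t, h, ht⟩ := h a
  exact h.size_le.trans ht

@[fun_prop] theorem PT.id : PT (fun a : α => a) :=
  ⟨.id, sz, .sz, fun _ => ⟨_, .id _, le_rfl⟩⟩

@[fun_prop] theorem PT.comp {f : β → γ} {g : α → β} (hf : PT f) (hg : PT g) :
    PT (fun a => f (g a)) := by
  have hb := hg.polyB
  obtain ⟨P, T, hT, h⟩ := hf
  obtain ⟨Q, S, hS, h'⟩ := hg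
  refine ⟨.comp Q P, fun a => sz a + S a + T (g a), (PolyB.sz.add hS).add (hT.comp hb),
    fun a => ?_⟩
  obtain ⟨t, h, ht⟩ := h (g a)
  obtain ⟨t', h', ht'⟩ := h' a
  exact ⟨_, .comp h' h, by dsimp only [sz]; omega⟩

theorem exists_const_prog (c : Data) :
    ∃ P, ∀ d : Data, ∃ t, Runs P d c t ∧ t ≤ c.size * d.size := by
  induction c with
  | nil => exact ⟨.nil, fun d => ⟨_, .nil d, by simp [Data.size]⟩⟩
  | cons a b iha ihb =>
    obtain ⟨P, hP⟩ := iha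
    obtain ⟨Q, hQ⟩ := ihb
    refine ⟨.pair P Q, fun d => ?_⟩
    obtain ⟨t, h, ht⟩ := hP d
    obtain ⟨t', h', ht'⟩ := hQ d
    exact ⟨_, .pair h h', by simp only [Data.size]; nlinarith⟩

@[fun_prop] theorem PT.const (b : β) : PT (fun _ : α => b) := by
  obtain ⟨P, hP⟩ := exists_const_prog (enc b)
  exact ⟨P, fun a => (enc b).size * sz a, (PolyB.const _).mul .sz, fun a => hP (enc a)⟩

@[fun_prop] theorem PT.prodMk {f : α → β} {g : α → γ} (hf : PT f) (hg : PT g) :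
    PT (fun a => (f a, g a)) := by
  obtain ⟨P, T, hT, h⟩ := hf
  obtain ⟨Q, S, hS, h'⟩ := hg
  refine ⟨.pair P Q, fun a => sz a + T a + S a, (PolyB.sz.add hT).add hS, fun a => ?_⟩
  obtain ⟨t, h, ht⟩ := h a
  obtain ⟨t', h', ht'⟩ := h' a
  exact ⟨_, .pair h h', by dsimp only [sz]; omega⟩

/-- Different types share encodings: `(a, l)` and `a :: l` are the same data, so such changes of
type cost nothing. -/
theorem PT.of_enc_eq {f : α → β} {g : α → γ} (hf : PT f) (h : ∀ a, enc (g a) = enc (f a)) :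
    PT g := by
  obtain ⟨P, T, hT, hP⟩ := hf
  exact ⟨P, T, hT, fun a => by rw [h a]; exact hP a⟩

theorem PT.enc_head {f : α → β} {g : α → γ} (hf : PT f) (h : ∀ a, enc (g a) = (enc (f a)).head) :
    PT g := by
  have hb := hf.polyB
  obtain ⟨P, T, hT, hP⟩ := hf
  refine ⟨.comp P .head, fun a => sz a + T a + sz (f a), (PolyB.sz.add hT).add hb, fun a => ?_⟩
  obtain ⟨t, hr, ht⟩ := hP a
  exact ⟨_, .comp hr (by rw [h a]; exact .head _), by dsimp only [sz]; omega⟩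

theorem PT.enc_tail {f : α → β} {g : α → γ} (hf : PT f) (h : ∀ a, enc (g a) = (enc (f a)).tail) :
    PT g := by
  have hb := hf.polyB
  obtain ⟨P, T, hT, hP⟩ := hf
  refine ⟨.comp P .tail, fun a => sz a + T a + sz (f a), (PolyB.sz.add hT).add hb, fun a => ?_⟩
  obtain ⟨t, hr, ht⟩ := hP a
  exact ⟨_, .comp hr (by rw [h a]; exact .tail _), by dsimp only [sz]; omega⟩

@[fun_prop] theorem PT.fst {f : α → β × γ} (hf : PT f) : PT (fun a => (f a).1) :=
  hf.enc_head fun _ => rfl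

@[fun_prop] theorem PT.snd {f : α → β × γ} (hf : PT f) : PT (fun a => (f a).2) :=
  hf.enc_tail fun _ => rfl

@[fun_prop] theorem PT.cons {f : α → β} {g : α → List β} (hf : PT f) (hg : PT g) :
    PT (fun a => f a :: g a) :=
  (hf.prodMk hg).of_enc_eq fun _ => rfl

@[fun_prop] theorem PT.tail {f : α → List β} (hf : PT f) : PT (fun a => (f a).tail) :=
  hf.enc_tail fun a => by cases f a <;> simp [Enc.enc, encodeList, Data.tail]

@[fun_prop] theorem PT.headI {f : α → List ℕ} (hf : PT f) : PT (fun a => (f a).headI) :=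
  -- The default value `0` has no bits, so it is encoded as `.nil`, which is also the head of the
  -- empty list.
  hf.enc_head fun a => by
    cases f a <;> simp [Enc.enc, encodeList, Data.head, encodeIndex, default]

@[fun_prop] theorem PT.input {f : α → ℕ} (hf : PT f) : PT (fun a => Vertex.input (f a)) :=
  ((PT.const ()).prodMk hf).of_enc_eq fun _ => rfl

theorem PT.of_prog {f : α → β} {g : α → γ} (hf : PT f) (P : Prog) (c : ℕ)
    (h : ∀ a, ∃ t, Runs P (enc (f a)) (enc (g a)) t ∧ t ≤ sz (f a) + c) : PT g := by
  have hb := hf.polyB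
  obtain ⟨Q, T, hT, hQ⟩ := hf
  refine ⟨.comp Q P, fun a => sz a + T a + (sz (f a) + c),
    (PolyB.sz.add hT).add (hb.add (.const c)), fun a => ?_⟩
  obtain ⟨t, hr, ht⟩ := hQ a
  obtain ⟨t', hr', ht'⟩ := h a
  exact ⟨_, .comp hr hr', by dsimp only [sz] at *; omega⟩

/-- The instruction `eq` compares data, so the encoding has to be injective. -/
theorem PT.eq [DecidableEq β] (hinj : Function.Injective (enc : β → Data)) {f g : α → β}
    (hf : PT f) (hg : PT g) : PT (fun a => decide (f a = g a)) := by
  refine PT.of_prog (hf.prodMk hg) .eq 2 fun a => ?_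
  by_cases h : f a = g a
  · refine ⟨_, ?_, le_rfl⟩
    simp only [h, decide_true]
    exact .eq_true _ rfl
  · refine ⟨_, ?_, Nat.le_add_right _ _⟩
    simp only [h, decide_false]
    exact .eq_false _ fun he => h (hinj he)

@[fun_prop] theorem PT.eq_nat {f g : α → ℕ} (hf : PT f) (hg : PT g) :
    PT (fun a => decide (f a = g a)) := PT.eq enc_nat_injective hf hg

@[fun_prop] theorem PT.eq_bits {f g : α → List Bool} (hf : PT f) (hg : PT g) :
    PT (fun a => decide (f a = g a)) := PT.eq enc_bits_injective hf hg

@[fun_prop] theorem PT.cond {p : α → Bool} {f g : α → β} (hp : PT p) (hf : PT f) (hg : PT g) :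
    PT (fun a => bif p a then f a else g a) := by
  obtain ⟨P, T, hT, h⟩ := hp
  obtain ⟨Q, S, hS, h'⟩ := hf
  obtain ⟨R, U, hU, h''⟩ := hg
  refine ⟨.test P Q R, fun a => sz a + T a + S a + U a,
    ((PolyB.sz.add hT).add hS).add hU, fun a => ?_⟩
  obtain ⟨t, h, ht⟩ := h a
  obtain ⟨t', h', ht'⟩ := h' a
  obtain ⟨t'', h'', ht''⟩ := h'' a
  cases hpa : p a with
  | true =>
    rw [hpa] at h
    simp only [hpa, cond_true]
    exact ⟨_, .test_true h (by simp [Enc.enc, encodeBool]) h', by dsimp only [sz]; omega⟩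
  | false =>
    rw [hpa] at h
    simp only [hpa, cond_false]
    exact ⟨_, .test_false h h'', by dsimp only [sz]; omega⟩

@[fun_prop] theorem PT.and {p q : α → Bool} (hp : PT p) (hq : PT q) :
    PT (fun a => p a && q a) := by
  have := hp.cond hq (PT.const false)
  simpa [Bool.cond_false_right] using this

@[fun_prop] theorem PT.or {p q : α → Bool} (hp : PT p) (hq : PT q) :
    PT (fun a => p a || q a) := by
  have := hp.cond (PT.const true) hq
  simpa [Bool.cond_true_left] using this

@[fun_prop] theorem PT.not {p : α → Bool} (hp : PT p) : PT (fun a => !p a) := by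
  have := hp.cond (PT.const false) (PT.const true)
  refine cast ?_ this
  congr 1

theorem PT.headElim {l : α → List β} {d : α → γ} {f : α → β → γ} (hl : PT l) (hd : PT d)
    (hf : PT fun z : α × β => f z.1 z.2) :
    PT (fun a => BSTSO.headElim (l a) (d a) (f a)) := by
  have hb := hl.polyB
  obtain ⟨L, T, hT, hL⟩ := hl
  obtain ⟨D, S, hS, hD⟩ := hd
  obtain ⟨F, U, hU, hF⟩ := hf
  obtain ⟨c, hc⟩ := hU
  refine ⟨.test L (.comp (.pair .id (.comp L .head)) F) D,
    fun a => sz a + T a + S a + (sz a + (sz a + sz a + (sz a + T a + sz (l a)))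
      + (sz a + sz (l a) + 2) ^ c), ?_, fun a => ?_⟩
  · exact ((PolyB.sz.add hT).add hS).add
      ((PolyB.sz.add ((PolyB.sz.add .sz).add ((PolyB.sz.add hT).add hb))).add
        (((PolyB.sz.add hb).add (.const 2)).pow c))
  obtain ⟨t, hr, ht⟩ := hL a
  obtain ⟨t', hr', ht'⟩ := hD a
  cases h : l a with
  | nil =>
    rw [h] at hr
    simp only [h, BSTSO.headElim]
    exact ⟨_, .test_false hr hr', by dsimp only [sz]; omega⟩
  | cons b m =>
    rw [h] at hr
    simp only [h, BSTSO.headElim]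
    obtain ⟨u, hu, hu'⟩ := hF (a, b)
    have h1 : Runs (.pair .id (.comp L .head)) (enc a) (enc (a, b)) _ :=
      .pair (.id _) (.comp hr (.head _))
    refine ⟨_, .test_true hr (by simp [Enc.enc, encodeList]) (.comp h1 hu), ?_⟩
    have h2 := (hu'.trans (hc _)).trans (Nat.pow_le_pow_left (m := sz a + sz (b :: m) + 2)
      (by simp only [sz_prod, sz_cons]; omega) c)
    simp only [sz] at *
    omega

end

/-! ### Folds -/

/-- A left fold whose step function also gets the rest of the list. -/
def foldlT {β σ : Type} (f : σ → β → List β → σ) : σ → List β → σ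
  | s, [] => s
  | s, b :: r => foldlT f (f s b r) r

theorem foldlT_eq_foldl {β σ : Type} (f : σ → β → σ) (s : σ) (l : List β) :
    foldlT (fun s b _ => f s b) s l = l.foldl f s := by
  induction l generalizing s with
  | nil => rfl
  | cons b r ih => exact ih _

/-- `flatMapT f [b₁, …, bₙ] = f b₁ [b₂, …, bₙ] ++ f b₂ [b₃, …, bₙ] ++ ⋯ ++ f bₙ []`. -/
def flatMapT {β γ : Type} (f : β → List β → List γ) : List β → List γ
  | [] => []
  | b :: r => f b r ++ flatMapT f r

theorem foldlT_append_eq {β γ : Type} (f : β → List β → List γ) (s : List γ) (l : List β) :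
    foldlT (fun s b r => s ++ f b r) s l = s ++ flatMapT f l := by
  induction l generalizing s with
  | nil => simp [foldlT, flatMapT]
  | cons b r ih => simp [foldlT, flatMapT, ih]

theorem flatMapT_eq_flatMap {β γ : Type} (f : β → List γ) (l : List β) :
    flatMapT (fun b _ => f b) l = l.flatMap f := by
  induction l with
  | nil => rfl
  | cons b r ih => simp [flatMapT, ih]

section
variable {α β γ σ : Type} [Enc α] [Enc β] [Enc γ] [Enc σ]

/-- An iterated polynomial-time step can blow up exponentially. The bound on the growth of the state
by an amount independent of the state keeps every intermediate state polynomial. -/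
theorem PT.foldlT {g : α → List β} {s₀ : α → σ} {f : α → σ → β → List β → σ} (hg : PT g)
    (hs : PT s₀) (hf : PT fun z : α × σ × β × List β => f z.1 z.2.1 z.2.2.1 z.2.2.2)
    {H : α × β × List β → ℕ} (hH : PolyB H)
    (h : ∀ a s b r, sz (f a s b r) ≤ sz s + H (a, b, r)) :
    PT (fun a => BSTSO.foldlT (f a) (s₀ a) (g a)) := by
  have hgb := hg.polyB
  have hsb := hs.polyB
  obtain ⟨c, hc⟩ := hH
  obtain ⟨F, U, ⟨e, he⟩, hF⟩ := hf
  -- the initialisation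
  obtain ⟨I, TI, hTI, hI⟩ := PT.id.prodMk (hs.prodMk hg)
  -- `K` bounds the growth of the state in one round, `B` the size of the loop data, and `L` the
  -- time of a round.
  let K : α → ℕ := fun a => (sz a + sz (g a) + 3) ^ c
  let B : α → ℕ := fun a => sz a + (sz (s₀ a) + sz (g a) * K a) + sz (g a) + 3
  have hK : PolyB K := ((PolyB.sz.add hgb).add (.const 3)).pow c
  have hB : PolyB B := ((PolyB.sz.add (hsb.add (hgb.mul hK))).add hgb).add (.const 3)
  let test : Prog := .comp .tail .tail
  let body : Prog := .pair .head (.pair F (.comp .tail (.comp .tail .tail)))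
  let L : α → ℕ := fun a => 20 * B a + B a ^ e
  have hL : PolyB L := ((PolyB.const 20).mul hB).add (hB.pow e)
  -- The potential `sz s + sz l * K a` does not increase, since each round lowers `sz l` by at least
  -- one.
  have key : ∀ (a : α) (l : List β) (s : σ),
      sz l ≤ sz (g a) → sz s + sz l * K a ≤ sz (s₀ a) + sz (g a) * K a →
      ∃ t, Runs (.loop test body) (enc (a, s, l)) (enc (a, BSTSO.foldlT (f a) s l, ([] : List β))) t
        ∧ t ≤ sz l * L a := by
    intro a l
    induction l with
    | nil =>
      intro s h1 h2
      refine ⟨_, .loop_done (.comp (.tail _) (.tail _)), ?_⟩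
      have e1 : (enc (a, s, ([] : List β))).size = sz a + (sz s + 1 + 1) + 1 := rfl
      have e2 : (enc (a, s, ([] : List β))).tail.size = sz s + 1 + 1 := rfl
      rw [e1, e2]
      simp only [sz_nil, L, B] at *
      omega
    | cons b r ih =>
      intro s h1 h2
      have hsz : sz (a, s, b, r) + 1 ≤ B a := by
        simp only [sz_prod, sz_cons, B] at *
        nlinarith [Nat.zero_le (K a), Nat.zero_le (sz b * K a), Nat.zero_le (sz r * K a)]
      have hstep : sz (f a s b r) ≤ sz s + K a := by
        refine (h a s b r).trans (Nat.add_le_add_left ((hc _).trans ?_) _)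
        refine Nat.pow_le_pow_left ?_ c
        simp only [sz_prod, sz_cons] at *
        omega
      obtain ⟨t, ht, htl⟩ := ih (f a s b r) (by simp only [sz_cons] at h1; omega) (by
        simp only [sz_cons] at h2
        nlinarith [Nat.zero_le (sz b * K a)])
      obtain ⟨u, hu, hul⟩ := hF (a, s, b, r)
      have hul' : u ≤ B a ^ e := (hul.trans (he _)).trans (Nat.pow_le_pow_left hsz e)
      have hbody : Runs body (enc (a, s, b :: r)) (enc (a, f a s b r, r)) _ :=
        .pair (.head _) (.pair hu (.comp (.tail _) (.comp (.tail _) (.tail _))))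
      have htest : Runs test (enc (a, s, b :: r)) (enc (b :: r)) _ := .comp (.tail _) (.tail _)
      refine ⟨_, .loop_step htest (by simp [Enc.enc, encodeList]) hbody ht, ?_⟩
      have e1 : (enc (a, s, b :: r)).size = sz (a, s, b, r) := rfl
      have e2 : (enc (a, s, b :: r)).tail.size = sz s + (sz b + sz r + 1) + 1 := rfl
      have e5 : (enc (a, s, b :: r)).tail.tail.size = sz b + sz r + 1 := rfl
      simp only [e1, e2, e5]
      simp only [sz_prod, sz_cons] at *
      have : L a = 20 * B a + B a ^ e := rfl
      nlinarith [Nat.zero_le (sz b * L a)]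
  refine ⟨.comp I (.comp (.loop test body) (.comp .tail .head)),
    fun a => sz a + TI a + (B a + sz (g a) * L a + (TI a + sz (g a) * L a + 1) * 3), ?_,
    fun a => ?_⟩
  · exact (PolyB.sz.add hTI).add ((hB.add (hgb.mul hL)).add
      (((hTI.add (hgb.mul hL)).add (.const 1)).mul (.const 3)))
  obtain ⟨t, ht, htl⟩ := hI a
  obtain ⟨u, hu, hul⟩ := key a (g a) (s₀ a) le_rfl le_rfl
  refine ⟨_, .comp ht (.comp hu (.comp (.tail _) (.head _))), ?_⟩
  have h1 := hu.size_le
  have e1 : (enc (a, s₀ a, g a)).size = sz a + (sz (s₀ a) + sz (g a) + 1) + 1 := rfl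
  have e2 : (enc (a, BSTSO.foldlT (f a) (s₀ a) (g a), ([] : List β))).tail.size + 1 ≤
      (enc (a, BSTSO.foldlT (f a) (s₀ a) (g a), ([] : List β))).size := by
    simp only [Enc.enc, Data.tail, Data.size]; omega
  simp only [e1]
  have e3 : sz a = (enc a).size := rfl
  have : sz a + (sz (s₀ a) + sz (g a) + 1) + 1 ≤ B a := by
    simp only [B]; nlinarith [Nat.zero_le (sz (g a) * K a)]
  omega

theorem PT.foldl {g : α → List β} {s₀ : α → σ} {f : α → σ → β → σ} (hg : PT g)
    (hs : PT s₀) (hf : PT fun z : α × σ × β => f z.1 z.2.1 z.2.2)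
    {H : α × β → ℕ} (hH : PolyB H) (h : ∀ a s b, sz (f a s b) ≤ sz s + H (a, b)) :
    PT (fun a => (g a).foldl (f a) (s₀ a)) := by
  simp only [← foldlT_eq_foldl]
  refine PT.foldlT (f := fun a s b _ => f a s b) hg hs ?_
    (H := fun z => H (z.1, z.2.1)) ?_ (fun a s b _ => h a s b)
  · exact hf.comp (f := fun z : α × σ × β => f z.1 z.2.1 z.2.2)
      (g := fun z : α × σ × β × List β => (z.1, z.2.1, z.2.2.1)) (by fun_prop)
  · exact hH.comp (PT.polyB (by fun_prop))

/-! ### Polynomial-time list operations -/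

@[fun_prop] theorem PT.reverse {g : α → List β} (hg : PT g) : PT (fun a => (g a).reverse) := by
  have := PT.foldl (f := fun (_ : α) (s : List β) b => b :: s) hg (PT.const []) (by fun_prop)
    (H := fun z => sz z.2 + 1) ((PT.polyB (by fun_prop)).add (.const 1))
    (fun a s b => by simp; omega)
  simpa using this

@[fun_prop] theorem PT.append {f g : α → List β} (hf : PT f) (hg : PT g) :
    PT (fun a => f a ++ g a) := by
  have := PT.foldl (f := fun (_ : α) (s : List β) b => b :: s) hf.reverse hg (by fun_prop)
    (H := fun z => sz z.2 + 1) ((PT.polyB (by fun_prop)).add (.const 1))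
    (fun a s b => by simp; omega)
  simpa using this

theorem sz_append (l m : List β) : sz (l ++ m) + 1 = sz l + sz m := by
  induction l with
  | nil => simp; omega
  | cons a l ih => simp only [List.cons_append, sz_cons]; omega

theorem PT.flatMapT {g : α → List β} {f : α → β → List β → List γ} (hg : PT g)
    (hf : PT fun z : α × β × List β => f z.1 z.2.1 z.2.2) :
    PT (fun a => BSTSO.flatMapT (f a) (g a)) := by
  have := PT.foldlT (f := fun (a : α) (s : List γ) b r => s ++ f a b r) hg (PT.const [])
    (PT.append (by fun_prop) (hf.comp (f := fun z : α × β × List β => f z.1 z.2.1 z.2.2)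
      (g := fun z : α × List γ × β × List β => (z.1, z.2.2.1, z.2.2.2)) (by fun_prop)))
    (H := fun z => sz (f z.1 z.2.1 z.2.2)) hf.polyB
    (fun a s b r => by have := sz_append s (f a b r); dsimp only; omega)
  simpa [foldlT_append_eq] using this

@[fun_prop] theorem PT.flatMap {g : α → List β} {f : α → β → List γ} (hg : PT g)
    (hf : PT fun z : α × β => f z.1 z.2) : PT (fun a => (g a).flatMap (f a)) := by
  simp only [← flatMapT_eq_flatMap]
  exact PT.flatMapT (f := fun a b _ => f a b) hg
    (hf.comp (f := fun z : α × β => f z.1 z.2)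
      (g := fun z : α × β × List β => (z.1, z.2.1)) (by fun_prop))

@[fun_prop] theorem PT.map {g : α → List β} {f : α → β → γ} (hg : PT g)
    (hf : PT fun z : α × β => f z.1 z.2) : PT (fun a => (g a).map (f a)) := by
  simp only [List.map_eq_flatMap]
  exact PT.flatMap hg (by fun_prop)

@[fun_prop] theorem PT.filter {g : α → List β} {p : α → β → Bool} (hg : PT g)
    (hp : PT fun z : α × β => p z.1 z.2) : PT (fun a => (g a).filter (p a)) := by
  have : ∀ a, (g a).filter (p a) = (g a).flatMap fun b => bif p a b then [b] else [] := by
    intro a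
    induction g a with
    | nil => rfl
    | cons b l ih => cases h : p a b <;> simp [h, ih]
  simp only [this]
  exact PT.flatMap hg (PT.cond hp (by fun_prop) (by fun_prop))

@[fun_prop] theorem PT.isEmpty {g : α → List β} (hg : PT g) : PT (fun a => (g a).isEmpty) := by
  have := PT.headElim (d := fun _ => true) (f := fun _ _ => false) hg (by fun_prop) (by fun_prop)
  convert this using 2 with a
  cases g a <;> rfl

@[fun_prop] theorem PT.any {g : α → List β} {p : α → β → Bool} (hg : PT g)
    (hp : PT fun z : α × β => p z.1 z.2) : PT (fun a => (g a).any (p a)) := by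
  have : ∀ a, (g a).any (p a) = !((g a).filter (p a)).isEmpty := by
    intro a
    rw [Bool.eq_iff_iff]
    simp
  simp only [this]
  exact PT.not (PT.isEmpty (PT.filter hg hp))

@[fun_prop] theorem PT.all {g : α → List β} {p : α → β → Bool} (hg : PT g)
    (hp : PT fun z : α × β => p z.1 z.2) : PT (fun a => (g a).all (p a)) := by
  simp only [List.all_eq_not_any_not]
  exact PT.not (PT.any hg (PT.not hp))

-- No arithmetic is needed: remove one element of the first list for each element of the second and
-- test whether anything is left.
@[fun_prop] theorem PT.lengthLE {f : α → List β} {g : α → List γ} (hf : PT f) (hg : PT g) :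
    PT (fun a => decide ((f a).length ≤ (g a).length)) := by
  have : ∀ a, decide ((f a).length ≤ (g a).length)
      = ((g a).foldl (fun s _ => s.tail) (f a)).isEmpty := by
    intro a
    generalize f a = l
    generalize g a = m
    induction m generalizing l with
    | nil => cases l <;> simp
    | cons b m ih => cases l with
      | nil => simpa using ih []
      | cons c l => simpa using ih l
  simp only [this]
  refine PT.isEmpty (PT.foldl (f := fun _ s _ => s.tail) hg hf (by fun_prop)
    (PolyB.const 0) fun a s b => ?_)
  cases s <;> simp; omega

@[fun_prop] theorem PT.lengthGE {g : α → List γ} (n : ℕ) (hg : PT g) :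
    PT (fun a => decide (n ≤ (g a).length)) := by
  simpa using PT.lengthLE (PT.const (α := α) (List.replicate n ())) hg

@[fun_prop] theorem PT.lengthLE_const {g : α → List γ} (n : ℕ) (hg : PT g) :
    PT (fun a => decide ((g a).length ≤ n)) := by
  simpa using PT.lengthLE hg (PT.const (α := α) (List.replicate n ()))

@[fun_prop] theorem PT.lengthEq {g : α → List γ} (n : ℕ) (hg : PT g) :
    PT (fun a => decide ((g a).length = n)) := by
  have := (PT.lengthGE n hg).and (PT.lengthLE_const n hg)
  simpa [← Bool.decide_and, ← le_antisymm_iff, eq_comm] using this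

@[fun_prop] theorem PT.contains {f : α → ℕ} {g : α → List ℕ} (hg : PT g) (hf : PT f) :
    PT (fun a => (g a).contains (f a)) := by
  have : ∀ a, (g a).contains (f a) = (g a).any fun b => decide (f a = b) := by
    intro a
    rw [Bool.eq_iff_iff]
    simp
  simp only [this]
  fun_prop

@[fun_prop] theorem PT.gate {g : α → List β} (hg : PT g) :
    PT (fun a => Vertex.gate (g a).length) := by
  -- The unary gate number is the list with its entries erased; `[()]` encodes the tag that marks a
  -- gate.
  refine PT.of_enc_eq (f := fun a => ([()], (g a).map fun _ => ())) (by fun_prop) fun a => ?_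
  simp only [Enc.enc, encodeVertex, encodeList, List.map_const']

end

/-! ### The algorithms

Sets of variables are represented by lists. A *plan* is a list of such sets, the newest one first,
each of which is the disjoint union of two sets that are singletons or occur earlier. -/

def sub (A B : List ℕ) : Bool := A.all fun a => B.contains a

def disj (A B : List ℕ) : Bool := A.all fun a => !B.contains a

/-- The sets available after the plan `rest`, and the vertices computing them. -/
def entries (U : List ℕ) (rest : List (List ℕ)) : List (List ℕ × Vertex) :=
  (U.map fun i => ([i], Vertex.input i)) ++ flatMapT (fun A r => [(A, Vertex.gate r.length)]) rest

/-- The candidates for the predecessors of a gate for `U` after the plan `rest`. -/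
def gatePairs (U : List ℕ) (rest : List (List ℕ)) : List (Vertex × Vertex) :=
  (entries U rest).flatMap fun A => ((entries U rest).filter fun B =>
    (sub A.1 U && sub B.1 U) && (disj A.1 B.1 && sub U (A.1 ++ B.1))).map fun B => (A.2, B.2)

/-- Any candidate gives a correct gate. The default is not reached on plans, where every set splits.
-/
def gateOf (U : List ℕ) (rest : List (List ℕ)) : List (Vertex × Vertex) :=
  headElim (gatePairs U rest) [] fun p => [p]

/-- The circuit of a plan. -/
def toCircuit (N : List (List ℕ)) : Circuit := flatMapT gateOf N

/-- The available subsets of `U`. -/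
def avail (pl : List (List ℕ)) (U : List ℕ) : List (List ℕ) :=
  ((U.map fun i => [i]) ++ pl).filter fun A => sub A U

/-- The available subsets of `U` of maximum size. -/
def largest (pl : List (List ℕ)) (U : List ℕ) : List (List ℕ) :=
  (avail pl U).filter fun A => (avail pl U).all fun B => decide (B.length ≤ A.length)

/-- The sets needed to obtain `U` from its subset `A` by adding elements one by one. -/
def chainWords (U A : List ℕ) : List (List ℕ) :=
  flatMapT (fun b r => [(b :: r) ++ U.filter fun i => A.contains i]) (U.filter fun i => !A.contains i)

/-- The sets added to the plan `pl` in order to obtain `U`. -/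
def planNew (pl : List (List ℕ)) (U : List ℕ) : List (List ℕ) :=
  bif (avail pl U).any fun A => sub U A then []
  else bif (avail pl U).any fun A => (avail pl U).any fun B => disj A B && sub U (A ++ B) then [U]
  else headElim (largest pl U) [] (chainWords U)

def planStep (pl : List (List ℕ)) (U : List ℕ) : List (List ℕ) := planNew pl U ++ pl

def plan (ws : List (List ℕ)) : List (List ℕ) := ws.foldl planStep []

/-- Insertion into a list that is sorted by length. -/
def insertLen (s : List (List ℕ)) (a : List ℕ) : List (List ℕ) :=
  (s.filter fun b => decide (b.length ≤ a.length)) ++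
    a :: s.filter fun b => !decide (b.length ≤ a.length)

def sortLen (w : List (List ℕ)) : List (List ℕ) := w.foldl insertLen []

def inter (A B : List ℕ) : List ℕ := A.filter fun a => B.contains a

/-- A set contained in three trees is contained in their intersection. These polynomially many
candidates therefore suffice for finding clusters. -/
def tripleInters (w : List (List ℕ)) : List (List ℕ) :=
  w.flatMap fun A => w.flatMap fun B => w.map fun C => inter (inter A B) C

def clusterStep (fits : List ℕ → List ℕ → Bool) (s : List (List ℕ) × List (List ℕ))
    (R : List ℕ) : List (List ℕ) × List (List ℕ) :=
  bif decide (3 ≤ (s.2.filter (fits R)).length) then (R :: s.1, s.2.filter fun T => !fits R T)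
  else s

/-- The trees that do not fit another tree. -/
def unfit (fits : List ℕ → List ℕ → Bool) (w : List (List ℕ)) : List (List ℕ) :=
  w.filter fun T => !w.any fun S => fits S T

/-- Repeatedly choose a set that at least three of the remaining trees fit, and remove these trees.
The result consists of the chosen sets and the remaining trees. -/
def cluster (fits : List ℕ → List ℕ → Bool) (w : List (List ℕ)) :
    List (List ℕ) × List (List ℕ) :=
  (tripleInters (unfit fits w)).foldl (clusterStep fits) ([], unfit fits w)

/-- The list `R ++ R` stands for doubling the length, so that only lengths of lists are compared. -/
def fitsHalf (R T : List ℕ) : Bool :=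
  sub R T && (!decide (T.length ≤ R.length) && decide (T.length ≤ (R ++ R).length))

def fitsFour (R T : List ℕ) : Bool := sub R T && (decide (R.length = 3) && decide (T.length = 4))

/-- Between pairs, `sub r q` means equality as sets, so no pair is bought twice. -/
def buyStep (θ : ℕ) (test : List (List ℕ) → List ℕ → List ℕ → Bool) (trees : List (List ℕ))
    (Q : List (List ℕ)) (q : List ℕ) : List (List ℕ) :=
  bif (!Q.any fun r => sub r q) && decide (θ ≤ (trees.filter (test Q q)).length) then q :: Q else Q

/-- Go through the candidates `P`, adding to `Q` those that pass the test for at least `θ` trees. -/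
def buy (θ : ℕ) (test : List (List ℕ) → List ℕ → List ℕ → Bool) (trees P Q : List (List ℕ)) :
    List (List ℕ) :=
  P.foldl (buyStep θ test trees) Q

def covered (Q : List (List ℕ)) (T : List ℕ) : Bool := Q.any fun q => sub q T

/-- `q` and a pair of `Q` partition the four-element tree `T`. -/
def complemented (Q : List (List ℕ)) (q T : List ℕ) : Bool := Q.any fun r => sub r T && disj q r

/-- The tree `T` with three or four elements needs just one gate when the pairs `Q` are given. -/
def captured (Q : List (List ℕ)) (T : List ℕ) : Bool :=
  Q.any fun q => sub q T && (decide (T.length ≤ 3) || complemented Q q T)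

/-- Passed by the trees that contain `q` and still need more than one gate. -/
def test₁ (Q : List (List ℕ)) (q T : List ℕ) : Bool := sub q T && !captured Q T

/-- Passed if buying `q` saves a gate: an uncovered tree becomes covered, or a tree with a pair of
`Q₁` complementary to `q` becomes captured. -/
def test₂ (Q₁ Q : List (List ℕ)) (q T : List ℕ) : Bool :=
  sub q T && (!covered Q T || (!captured Q T && complemented Q₁ q T))

def pairsOf (trees : List (List ℕ)) : List (List ℕ) :=
  trees.flatMap fun T => T.flatMap fun a => (T.filter fun b => !decide (b = a)).map fun b => [a, b]

/-- With threshold 5 each paying tree contributes a fifth of a gate, and an unbought pair lies in at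
most four uncaptured trees. In `phase₂` the threshold 2 gives the shares one half and one tree. -/
def phase₁ (trees Q₀ : List (List ℕ)) : List (List ℕ) := buy 5 test₁ trees (pairsOf trees) Q₀

def phase₂ (trees Q₁ : List (List ℕ)) : List (List ℕ) :=
  buy 2 (test₂ Q₁) trees (pairsOf trees) Q₁

def activeTrees (w : List (List ℕ)) : List (List ℕ) :=
  (cluster fitsFour w).2.filter fun T => decide (3 ≤ T.length)

/-- The auxiliary sets for trees with at most four elements. -/
def preSmall (w : List (List ℕ)) : List (List ℕ) :=
  (cluster fitsFour w).1 ++ phase₂ (activeTrees w)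
    (phase₁ (activeTrees w) (w.filter fun T => decide (T.length = 2)))

/-- The auxiliary sets for trees of arbitrary size. -/
def preHalf (w : List (List ℕ)) : List (List ℕ) := (cluster fitsHalf w).1

/-- A circuit for a constant operator. -/
def constCircuit (w : List (List ℕ)) : Circuit :=
  headElim (w.filter fun T => decide (2 ≤ T.length)) []
    fun T => [(.input T.headI, .input T.tail.headI)]

def isConstTable (b : List Bool) : Bool :=
  decide (b = [false, false, false, false]) || decide (b = [true, true, true, true])

/-- Auxiliary sets precede all trees and shorter trees precede longer ones, so each of them is
available for the later trees that contain it. -/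
def solve (pre : List (List ℕ) → List (List ℕ)) (x : List Bool × List (List ℕ)) : Circuit :=
  bif isConstTable x.1 then constCircuit x.2 else toCircuit (plan (pre x.2 ++ sortLen x.2))

/-! ### The algorithms take polynomial time -/

section
variable {α : Type} [Enc α]

@[fun_prop] theorem PT.sub {f g : α → List ℕ} (hf : PT f) (hg : PT g) :
    PT (fun a => sub (f a) (g a)) := by
  unfold BSTSO.sub
  fun_prop

@[fun_prop] theorem PT.disj {f g : α → List ℕ} (hf : PT f) (hg : PT g) :
    PT (fun a => disj (f a) (g a)) := by
  unfold BSTSO.disj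
  fun_prop

@[fun_prop] theorem PT.entries {f : α → List ℕ} {g : α → List (List ℕ)} (hf : PT f) (hg : PT g) :
    PT (fun a => entries (f a) (g a)) := by
  unfold BSTSO.entries
  exact PT.append (by fun_prop)
    (PT.flatMapT (f := fun _ A r => [(A, Vertex.gate r.length)]) hg (by fun_prop))

@[fun_prop] theorem PT.gatePairs {f : α → List ℕ} {g : α → List (List ℕ)} (hf : PT f)
    (hg : PT g) : PT (fun a => gatePairs (f a) (g a)) := by
  unfold BSTSO.gatePairs
  fun_prop

@[fun_prop] theorem PT.gateOf {f : α → List ℕ} {g : α → List (List ℕ)} (hf : PT f)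
    (hg : PT g) : PT (fun a => gateOf (f a) (g a)) :=
  PT.headElim (d := fun _ => []) (f := fun _ p => [p]) (PT.gatePairs hf hg) (by fun_prop) (by fun_prop)

@[fun_prop] theorem PT.toCircuit {f : α → List (List ℕ)} (hf : PT f) :
    PT (fun a => toCircuit (f a)) :=
  PT.flatMapT (f := fun _ => BSTSO.gateOf) hf (by fun_prop)

@[fun_prop] theorem PT.avail {f : α → List ℕ} {g : α → List (List ℕ)} (hf : PT f)
    (hg : PT g) : PT (fun a => avail (g a) (f a)) := by
  unfold BSTSO.avail
  fun_prop

@[fun_prop] theorem PT.largest {f : α → List ℕ} {g : α → List (List ℕ)} (hf : PT f)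
    (hg : PT g) : PT (fun a => largest (g a) (f a)) := by
  unfold BSTSO.largest
  fun_prop

@[fun_prop] theorem PT.chainWords {f g : α → List ℕ} (hf : PT f) (hg : PT g) :
    PT (fun a => chainWords (f a) (g a)) :=
  PT.flatMapT (f := fun a b r => [(b :: r) ++ (f a).filter fun i => (g a).contains i])
    (by fun_prop) (by fun_prop)

@[fun_prop] theorem PT.planNew {f : α → List ℕ} {g : α → List (List ℕ)} (hf : PT f)
    (hg : PT g) : PT (fun a => planNew (g a) (f a)) :=
  PT.cond (by fun_prop) (by fun_prop) (PT.cond (by fun_prop) (by fun_prop)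
    (PT.headElim (d := fun _ => []) (f := fun a A => BSTSO.chainWords (f a) A) (by fun_prop) (by fun_prop)
      (by fun_prop)))

theorem sz_filter_add {β : Type} [Enc β] (p : β → Bool) (l : List β) :
    sz (l.filter p) + sz (l.filter fun b => !p b) = sz l + 1 := by
  induction l with
  | nil => rfl
  | cons b l ih => cases h : p b <;> simp [h] <;> omega

theorem sz_filter_le {β : Type} [Enc β] (p : β → Bool) (l : List β) : sz (l.filter p) ≤ sz l := by
  have := sz_filter_add p l
  have := sz_pos (l.filter fun b => !p b)
  omega

/-- The bound depends on `U` but not on the plan built so far, which is the additive growth that the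
fold in `PT.plan` requires. -/
theorem sz_planNew (pl : List (List ℕ)) (U : List ℕ) :
    sz (planNew pl U) ≤ 3 + sz U * (2 * sz U + 1) := by
  unfold planNew
  rcases h₁ : (avail pl U).any (fun A => sub U A) with _ | _
  · rcases h₂ : (avail pl U).any
      (fun A => (avail pl U).any fun B => disj A B && sub U (A ++ B)) with _ | _
    · simp only [cond_false]
      rcases largest pl U with _ | ⟨A, _⟩
      · simp only [headElim, sz_nil]; omega
      · simp only [headElim]
        -- A chain consists of one set per element of `l`, each of size at most `sz l + sz A'`.
        have key : ∀ (l A' : List ℕ),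
            sz (flatMapT (fun b r => [(b :: r) ++ A']) l) ≤ 1 + sz l * (sz l + sz A' + 1) := by
          intro l A'
          induction l with
          | nil => simp [flatMapT]
          | cons b r ih =>
            have h1 := sz_append (b :: r) A'
            simp only [flatMapT, List.singleton_append, sz_cons] at *
            have h2 : sz r * (sz r + sz A' + 1) ≤ sz r * (sz b + sz r + 1 + sz A' + 1) :=
              Nat.mul_le_mul_left _ (by omega)
            have h3 := sz_pos b
            nlinarith [Nat.zero_le (sz b * (sz b + sz r + 1 + sz A' + 1))]
        have h1 := key (U.filter fun i => !A.contains i) (U.filter fun i => A.contains i)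
        have h2 := sz_filter_le (fun i => A.contains i) U
        have h3 := sz_filter_le (fun i => !A.contains i) U
        unfold chainWords
        refine h1.trans ?_
        have h4 := Nat.mul_le_mul h3 (Nat.add_le_add_right (Nat.add_le_add h3 h2) 1)
        nlinarith
    · simp only [cond_false, cond_true, sz_cons, sz_nil]
      have := sz_pos U
      nlinarith
  · simp only [cond_true, sz_nil]; omega

@[fun_prop] theorem PT.plan {f : α → List (List ℕ)} (hf : PT f) : PT (fun a => plan (f a)) :=
  PT.foldl (f := fun _ => planStep) hf (by fun_prop) (by unfold planStep; fun_prop)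
    (H := fun z => 3 + sz z.2 * (2 * sz z.2 + 1))
    ((PolyB.const 3).add ((PT.polyB (by fun_prop)).mul
      (((PolyB.const 2).mul (PT.polyB (by fun_prop))).add (.const 1))))
    (fun _ s b => by
      have := sz_append (BSTSO.planNew s b) s
      have := sz_planNew s b
      dsimp only [planStep] at *
      omega)

@[fun_prop] theorem PT.sortLen {f : α → List (List ℕ)} (hf : PT f) :
    PT (fun a => sortLen (f a)) :=
  PT.foldl (f := fun _ => insertLen) hf (by fun_prop) (by unfold insertLen; fun_prop)
    (H := fun z => sz z.2 + 1) ((PT.polyB (by fun_prop)).add (.const 1))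
    (fun _ s b => by
      have h1 := sz_filter_add (fun c => decide (c.length ≤ b.length)) s
      have h2 := sz_append (s.filter fun c => decide (c.length ≤ b.length))
        (b :: s.filter fun c => !decide (c.length ≤ b.length))
      rw [sz_cons] at h2
      dsimp only [insertLen]
      omega)

@[fun_prop] theorem PT.inter {f g : α → List ℕ} (hf : PT f) (hg : PT g) :
    PT (fun a => inter (f a) (g a)) := by
  unfold BSTSO.inter
  fun_prop

@[fun_prop] theorem PT.tripleInters {f : α → List (List ℕ)} (hf : PT f) :
    PT (fun a => tripleInters (f a)) := by
  unfold BSTSO.tripleInters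
  fun_prop

theorem PT.unfit {fits : List ℕ → List ℕ → Bool}
    (h : PT fun z : List ℕ × List ℕ => fits z.1 z.2) : PT (unfit fits) := by
  have h' : PT fun z : ((List (List ℕ)) × List ℕ) × List ℕ => fits z.2 z.1.2 :=
    h.comp (g := fun z : ((List (List ℕ)) × List ℕ) × List ℕ => (z.2, z.1.2)) (by fun_prop)
  exact PT.filter (p := fun w T => !w.any fun S => fits S T) PT.id
    (PT.not (PT.any (p := fun (z : List (List ℕ) × List ℕ) S => fits S z.2) (by fun_prop) h'))

theorem PT.cluster {fits : List ℕ → List ℕ → Bool}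
    (h : PT fun z : List ℕ × List ℕ => fits z.1 z.2) : PT (cluster fits) := by
  have h0 := PT.unfit h
  have h' : PT fun z : (List (List ℕ) × (List (List ℕ) × List (List ℕ)) × List ℕ) × List ℕ =>
      fits z.1.2.2 z.2 :=
    h.comp (g := fun z : (List (List ℕ) × (List (List ℕ) × List (List ℕ)) × List ℕ) × List ℕ =>
      (z.1.2.2, z.2)) (by fun_prop)
  refine PT.foldl (f := fun _ => clusterStep fits) (PT.tripleInters h0)
    (PT.prodMk (by fun_prop) h0) ?_ (H := fun z => sz z.2 + 1)
    ((PT.polyB (by fun_prop)).add (.const 1)) (fun _ s b => ?_)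
  · refine PT.cond (PT.lengthGE 3 (PT.filter (p := fun (z : List (List ℕ) × (List (List ℕ) × List (List ℕ)) × List ℕ) T => fits z.2.2 T) (by fun_prop) h'))
      (PT.prodMk (by fun_prop) (PT.filter (p := fun (z : List (List ℕ) × (List (List ℕ) × List (List ℕ)) × List ℕ) T => !fits z.2.2 T) (by fun_prop) h'.not))
      (by fun_prop)
  · obtain ⟨p, r⟩ := s
    have := sz_filter_le (fun T => !fits b T) r
    unfold clusterStep
    cases decide (3 ≤ ((p, r).2.filter (fits b)).length) <;> simp only [cond_false, cond_true,
      sz_prod, sz_cons] <;> omega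

theorem PT.buy (θ : ℕ) {test : α → List (List ℕ) → List ℕ → List ℕ → Bool}
    {trees P Q : α → List (List ℕ)} (ht : PT trees) (hP : PT P) (hQ : PT Q)
    (h : PT fun z : α × List (List ℕ) × List ℕ × List ℕ => test z.1 z.2.1 z.2.2.1 z.2.2.2) :
    PT (fun a => buy θ (test a) (trees a) (P a) (Q a)) := by
  have h' : PT fun z : (α × List (List ℕ) × List ℕ) × List ℕ => test z.1.1 z.1.2.1 z.1.2.2 z.2 :=
    h.comp (g := fun z : (α × List (List ℕ) × List ℕ) × List ℕ => (z.1.1, z.1.2.1, z.1.2.2, z.2))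
      (by fun_prop)
  refine PT.foldl (f := fun a => buyStep θ (test a) (trees a)) hP hQ ?_ (H := fun z => sz z.2 + 1)
    ((PT.polyB (by fun_prop)).add (.const 1)) (fun a s b => ?_)
  · refine PT.cond (PT.and (by fun_prop) (PT.lengthGE θ
      (PT.filter (p := fun (z : α × List (List ℕ) × List ℕ) T => test z.1 z.2.1 z.2.2 T) (by fun_prop) h')))
      (by fun_prop) (by fun_prop)
  · unfold buyStep
    cases ((!s.any fun r => BSTSO.sub r b) &&
      decide (θ ≤ ((trees a).filter (test a s b)).length)) <;>
      simp only [cond_false, cond_true, sz_cons] <;> omega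

@[fun_prop] theorem PT.covered {f : α → List (List ℕ)} {g : α → List ℕ} (hf : PT f) (hg : PT g) :
    PT (fun a => covered (f a) (g a)) := by
  unfold BSTSO.covered
  fun_prop

@[fun_prop] theorem PT.complemented {f : α → List (List ℕ)} {g h : α → List ℕ} (hf : PT f)
    (hg : PT g) (hh : PT h) : PT (fun a => complemented (f a) (g a) (h a)) := by
  unfold BSTSO.complemented
  fun_prop

@[fun_prop] theorem PT.captured {f : α → List (List ℕ)} {g : α → List ℕ} (hf : PT f)
    (hg : PT g) : PT (fun a => captured (f a) (g a)) := by
  unfold BSTSO.captured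
  fun_prop

@[fun_prop] theorem PT.pairsOf {f : α → List (List ℕ)} (hf : PT f) :
    PT (fun a => pairsOf (f a)) := by
  unfold BSTSO.pairsOf
  fun_prop

@[fun_prop] theorem PT.phase₁ {f g : α → List (List ℕ)} (hf : PT f) (hg : PT g) :
    PT (fun a => phase₁ (f a) (g a)) :=
  PT.buy 5 (test := fun _ => test₁) hf hf.pairsOf hg (by unfold test₁; fun_prop)

@[fun_prop] theorem PT.phase₂ {f g : α → List (List ℕ)} (hf : PT f) (hg : PT g) :
    PT (fun a => phase₂ (f a) (g a)) :=
  PT.buy 2 (test := fun a => test₂ (g a)) hf hf.pairsOf hg (by unfold test₂; fun_prop)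

theorem PT.preSmall : PT preSmall := by
  have h : PT (BSTSO.cluster fitsFour) := PT.cluster (by unfold fitsFour; fun_prop)
  unfold BSTSO.preSmall activeTrees
  fun_prop

theorem PT.preHalf : PT preHalf :=
  PT.fst (PT.cluster (by unfold fitsHalf; fun_prop))

theorem PT.solve {pre : List (List ℕ) → List (List ℕ)} (h : PT pre) : PT (solve pre) := by
  unfold BSTSO.solve isConstTable
  refine PT.cond (by fun_prop) ?_ (by fun_prop)
  exact PT.headElim (α := List Bool × List (List ℕ)) (l := fun x => x.2.filter fun T => decide (2 ≤ T.length))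
    (d := fun _ => []) (f := fun _ T => [(Vertex.input T.headI, Vertex.input T.tail.headI)]) (by fun_prop) (by fun_prop)
    (by fun_prop)

/-- A function computed in polynomial time is an approximation algorithm if its values are good
solutions. -/
theorem hasEfficientApprox_of_PT {Adm : Finset (Finset ℕ) → Prop} {ρ : Finset (Finset ℕ) → ℚ}
    {f : List Bool × List (List ℕ) → Circuit} (hf : PT f)
    (h : ∀ op : Bool → Bool → Bool, (∀ a b c, op (op a b) c = op a (op b c)) →
      (∀ a b, op a b = op b a) →
      ∀ 𝒯 : Finset (Finset ℕ), (∀ T ∈ 𝒯, T.Nonempty) → Adm 𝒯 →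
      ∀ w : List (List ℕ), Lists w 𝒯 →
        IsSolution op 𝒯 (f ([op false false, op false true, op true false, op true true], w)) ∧
        ∀ C' : Circuit, IsSolution op 𝒯 C' →
          ((f ([op false false, op false true, op true false, op true true], w)).size : ℚ)
            ≤ ρ 𝒯 * (C'.size : ℚ)) :
    HasEfficientApprox Adm ρ := by
  obtain ⟨P, T, ⟨c, hc⟩, hP⟩ := hf
  refine ⟨P, (Polynomial.X + 1) ^ c, fun op ha hs 𝒯 hne hadm w hw => ?_⟩
  obtain ⟨t, hr, ht⟩ := hP ([op false false, op false true, op true false, op true true], w)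
  refine ⟨_, t, hr, ?_, h op ha hs 𝒯 hne hadm w hw⟩
  refine (ht.trans (hc _)).trans (le_of_eq ?_)
  simp only [Polynomial.eval_pow, Polynomial.eval_add, Polynomial.eval_X, Polynomial.eval_one]
  rfl

end

/-! ### Associative symmetric operators -/

section
variable {op : Bool → Bool → Bool}

theorem foldl_op_assoc (ha : ∀ a b c, op (op a b) c = op a (op b c)) (x : ℕ → Bool) (a b : Bool)
    (l : List ℕ) :
    l.foldl (fun b j => op b (x j)) (op a b) = op a (l.foldl (fun b j => op b (x j)) b) := by
  induction l generalizing b with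
  | nil => rfl
  | cons c l ih => simp only [List.foldl_cons]; rw [ha, ih]

theorem listOp_cons (ha : ∀ a b c, op (op a b) c = op a (op b c)) (x : ℕ → Bool) (i : ℕ)
    {l : List ℕ} (hl : l ≠ []) : listOp op x (i :: l) = op (x i) (listOp op x l) := by
  cases l with
  | nil => exact absurd rfl hl
  | cons j l => simp only [listOp, List.foldl_cons]; exact foldl_op_assoc ha x _ _ l

theorem listOp_append (ha : ∀ a b c, op (op a b) c = op a (op b c)) (x : ℕ → Bool)
    {l m : List ℕ} (hl : l ≠ []) (hm : m ≠ []) :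
    listOp op x (l ++ m) = op (listOp op x l) (listOp op x m) := by
  induction l with
  | nil => exact absurd rfl hl
  | cons i l ih =>
    by_cases h : l = []
    · subst h
      exact listOp_cons ha x i hm
    · rw [List.cons_append, listOp_cons ha x i (by simp [h]), ih h, listOp_cons ha x i h, ha]

theorem listOp_perm (ha : ∀ a b c, op (op a b) c = op a (op b c)) (hs : ∀ a b, op a b = op b a)
    (x : ℕ → Bool) {l m : List ℕ} (h : l.Perm m) : listOp op x l = listOp op x m := by
  induction h with
  | nil => rfl
  | @cons i l m h ih =>
    by_cases hl : l = []
    · subst hl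
      rw [h.nil_eq]
    · rw [listOp_cons ha x i hl, ih, listOp_cons ha x i fun hm => hl (by subst hm; exact h.eq_nil)]
  | swap i j l =>
    by_cases hl : l = []
    · subst hl
      exact hs _ _
    · rw [listOp_cons ha x j (by simp), listOp_cons ha x i hl, listOp_cons ha x i (by simp),
        listOp_cons ha x j hl, ← ha, ← ha, hs (x j)]
  | trans _ _ h₁ h₂ => exact h₁.trans h₂

theorem treeFun_singleton (x : ℕ → Bool) (i : ℕ) : treeFun op {i} x = x i := by
  simp [treeFun, listOp]

theorem treeFun_union (ha : ∀ a b c, op (op a b) c = op a (op b c))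
    (hs : ∀ a b, op a b = op b a) (x : ℕ → Bool) {A B : Finset ℕ} (hA : A.Nonempty)
    (hB : B.Nonempty) (h : Disjoint A B) :
    treeFun op (A ∪ B) x = op (treeFun op A x) (treeFun op B x) := by
  have ne {S : Finset ℕ} (hS : S.Nonempty) : S.sort (· ≤ ·) ≠ [] := by
    obtain ⟨i, hi⟩ := hS
    exact List.ne_nil_of_mem ((Finset.mem_sort (· ≤ ·)).2 hi)
  unfold treeFun
  rw [← listOp_append ha x (ne hA) (ne hB)]
  refine listOp_perm ha hs x ?_
  rw [List.perm_ext_iff_of_nodup (Finset.sort_nodup _ _)]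
  · simp
  · refine List.Nodup.append (Finset.sort_nodup _ _) (Finset.sort_nodup _ _) fun i hi hj => ?_
    exact Finset.disjoint_left.1 h (by simpa using hi) (by simpa using hj)

theorem treeFun_congr {S : Finset ℕ} (x y : ℕ → Bool) (h : ∀ i ∈ S, x i = y i) :
    treeFun op S x = treeFun op S y := by
  have key : ∀ (l : List ℕ) (b : Bool), (∀ i ∈ l, x i = y i) →
      l.foldl (fun b j => op b (x j)) b = l.foldl (fun b j => op b (y j)) b := by
    intro l
    induction l with
    | nil => intros; rfl
    | cons j l ih =>
      intro b hl
      simp only [List.foldl_cons, hl j (by simp)]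
      exact ih _ fun i hi => hl i (by simp [hi])
  have h' : ∀ i ∈ S.sort (· ≤ ·), x i = y i := fun i hi => h i (by simpa using hi)
  unfold treeFun
  cases hS : S.sort (· ≤ ·) with
  | nil => rfl
  | cons i l =>
    rw [hS] at h'
    simp only [listOp, h' i (by simp)]
    exact key l _ fun j hj => h' j (by simp [hj])

/-- `treeFun op S` depends on each variable in `S`. -/
theorem exists_treeFun_ne (ha : ∀ a b c, op (op a b) c = op a (op b c))
    (hs : ∀ a b, op a b = op b a) (hc : ∃ b, op true b ≠ op false b) (S : Finset ℕ) :
    ∀ i ∈ S, ∃ x, treeFun op S x ≠ treeFun op S (Function.update x i (!x i)) := by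
  induction S using Finset.strongInduction with
  | H S ih =>
    intro i hi
    have hSi : S = {i} ∪ S.erase i := by
      rw [← Finset.insert_eq, Finset.insert_erase hi]
    rcases (S.erase i).eq_empty_or_nonempty with he | he
    · rw [he, Finset.union_empty] at hSi
      refine ⟨fun _ => false, ?_⟩
      rw [hSi, treeFun_singleton, treeFun_singleton]
      simp
    · obtain ⟨b, hb⟩ := hc
      -- By induction the function of the remaining variables is not constant, so one of two
      -- assignments differing at `j` gives it the value `b`, at which `op` is sensitive to its
      -- other argument.
      obtain ⟨x, hx⟩ : ∃ x, treeFun op (S.erase i) x = b := by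
        obtain ⟨j, hj⟩ := he
        obtain ⟨x, hx⟩ := ih _ (Finset.erase_ssubset hi) j hj
        by_cases h : treeFun op (S.erase i) x = b
        · exact ⟨x, h⟩
        · refine ⟨Function.update x j !x j, ?_⟩
          revert h hx
          generalize treeFun op (S.erase i) x = u
          generalize treeFun op (S.erase i) _ = v
          clear hb
          revert u v b
          decide
      have hd : Disjoint {i} (S.erase i) := by simp
      have key : ∀ y : ℕ → Bool, (∀ j ∈ S.erase i, y j = x j) → treeFun op S y = op (y i) b := by
        intro y hy
        rw [hSi, treeFun_union ha hs y (by simp) he hd, treeFun_singleton, treeFun_congr y x hy, hx]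
      refine ⟨x, ?_⟩
      rw [key x fun _ _ => rfl, key _ fun j hj => Function.update_of_ne
        (Finset.ne_of_mem_erase hj) _ _]
      cases x i <;> simp [hb, hb.symm]

/-- Flipping a variable of `S` outside `T` changes the first function for a suitable assignment, but
never the second. -/
theorem treeFun_injOn (ha : ∀ a b c, op (op a b) c = op a (op b c))
    (hs : ∀ a b, op a b = op b a) (hc : ∃ b, op true b ≠ op false b) {S T : Finset ℕ}
    (h : ∀ x, treeFun op S x = treeFun op T x) : S = T := by
  have key : ∀ S T : Finset ℕ, (∀ x, treeFun op S x = treeFun op T x) → S ⊆ T := by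
    intro S T h i hi
    by_contra hT
    obtain ⟨x, hx⟩ := exists_treeFun_ne ha hs hc S i hi
    refine hx ?_
    rw [h, h]
    refine treeFun_congr _ _ fun j hj => ?_
    rw [Function.update_of_ne]
    rintro rfl
    exact hT hj
  exact (key S T h).antisymm (key T S fun x => (h x).symm)

end

/-! ### Subcircuits without undirected cycles -/

namespace Circuit

/-- The gate number `j` has the predecessors `a` and `b`. -/
def GateAt : Circuit → ℕ → Vertex → Vertex → Prop
  | [], _, _, _ => False
  | g :: C, j, a, b => (j = C.length ∧ a = g.1 ∧ b = g.2) ∨ GateAt C j a b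

/-- The subcircuit of `v` is a tree whose leaves are the inputs in `S`. -/
inductive IsTree (C : Circuit) : Vertex → Finset ℕ → Prop
  | input (i : ℕ) : IsTree C (.input i) {i}
  | gate {j : ℕ} {a b : Vertex} {A B : Finset ℕ} (h : C.GateAt j a b) (ha : IsTree C a A)
      (hb : IsTree C b B) (hd : Disjoint A B) : IsTree C (.gate j) (A ∪ B)

end Circuit

open Circuit

/-- A topological numbering of the vertices. -/
def Vertex.rank : Vertex → ℕ
  | .input _ => 0
  | .gate j => j + 1

section
variable {X : Finset ℕ} {C : Circuit}

theorem arc_iff {u v : Vertex} :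
    C.Arc u v ↔ ∃ j a b, C.GateAt j a b ∧ v = .gate j ∧ (u = a ∨ u = b) := by
  induction C with
  | nil => simp [Arc, GateAt]
  | cons g C ih =>
    simp only [Arc, GateAt, ih]
    constructor
    · rintro (⟨rfl, h⟩ | ⟨j, a, b, h⟩)
      · exact ⟨_, _, _, Or.inl ⟨rfl, rfl, rfl⟩, rfl, h⟩
      · exact ⟨j, a, b, Or.inr h.1, h.2⟩
    · rintro ⟨j, a, b, ⟨rfl, rfl, rfl⟩ | h, rfl, h'⟩
      · exact Or.inl ⟨rfl, h'⟩
      · exact Or.inr ⟨j, a, b, h, rfl, h'⟩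

theorem Circuit.GateAt.lt {j : ℕ} {a b : Vertex} (h : C.GateAt j a b) : j < C.length := by
  induction C with
  | nil => exact h.elim
  | cons g C ih =>
    rcases h with ⟨rfl, _⟩ | h
    · simp
    · exact (ih h).trans (by simp)

theorem Circuit.GateAt.unique {j : ℕ} {a b a' b' : Vertex} (h : C.GateAt j a b) (h' : C.GateAt j a' b') :
    a = a' ∧ b = b' := by
  induction C with
  | nil => exact h.elim
  | cons g C ih =>
    rcases h with ⟨rfl, rfl, rfl⟩ | h <;> rcases h' with ⟨h1, rfl, rfl⟩ | h'
    · exact ⟨rfl, rfl⟩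
    · exact absurd (GateAt.lt h') (lt_irrefl _)
    · exact absurd (GateAt.lt h) (by omega)
    · exact ih h h'

theorem exists_gateAt {j : ℕ} (h : j < C.length) : ∃ a b, C.GateAt j a b := by
  induction C with
  | nil => simp at h
  | cons g C ih =>
    rw [List.length_cons] at h
    rcases Nat.lt_succ_iff_lt_or_eq.1 h with h | h
    · obtain ⟨a, b, h⟩ := ih h
      exact ⟨a, b, Or.inr h⟩
    · exact ⟨_, _, Or.inl ⟨h, rfl, rfl⟩⟩

theorem Circuit.IsVertex.cons {g : Vertex × Vertex} {v : Vertex} (h : IsVertex X C v) :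
    IsVertex X (g :: C) v := by
  cases v with
  | input i => exact h
  | gate j => exact Nat.lt_succ_of_lt h

theorem Circuit.IsVertex.rank_le {v : Vertex} (h : IsVertex X C v) : v.rank ≤ C.length := by
  cases v with
  | input i => exact Nat.zero_le _
  | gate j => exact h

theorem Circuit.WellFormed.gateAt (hC : C.WellFormed X) {j : ℕ} {a b : Vertex} (h : C.GateAt j a b) :
    a ≠ b ∧ IsVertex X C a ∧ IsVertex X C b ∧ a.rank < j + 1 ∧ b.rank < j + 1 := by
  induction C with
  | nil => exact h.elim
  | cons g C ih =>
    obtain ⟨h1, h2, h3, h4⟩ := hC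
    rcases h with ⟨rfl, rfl, rfl⟩ | h
    · exact ⟨h1, IsVertex.cons h2, IsVertex.cons h3, Nat.lt_succ_of_le (IsVertex.rank_le h2),
        Nat.lt_succ_of_le (IsVertex.rank_le h3)⟩
    · obtain ⟨h5, h6, h7, h8⟩ := ih h4 h
      exact ⟨h5, IsVertex.cons h6, IsVertex.cons h7, h8⟩

theorem value_input (op : Bool → Bool → Bool) (x : ℕ → Bool) (C : Circuit) (i : ℕ) :
    C.value op x (.input i) = x i := by
  cases C <;> rfl

theorem value_cons {op : Bool → Bool → Bool} {x : ℕ → Bool} {g : Vertex × Vertex} {v : Vertex}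
    (h : IsVertex X C v) : Circuit.value op x (g :: C) v = C.value op x v := by
  cases v with
  | input i => rw [value_input, value_input]
  | gate j =>
    have : j ≠ C.length := fun he => by subst he; exact lt_irrefl _ h
    simp [Circuit.value, this]

theorem Circuit.WellFormed.value_gate (hC : C.WellFormed X) (op : Bool → Bool → Bool) (x : ℕ → Bool)
    {j : ℕ} {a b : Vertex} (h : C.GateAt j a b) :
    C.value op x (.gate j) = op (C.value op x a) (C.value op x b) := by
  induction C with
  | nil => exact h.elim
  | cons g C ih =>
    obtain ⟨h1, h2, h3, h4⟩ := hC
    rcases h with ⟨rfl, rfl, rfl⟩ | h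
    · rw [value_cons h2, value_cons h3]
      simp [Circuit.value]
    · obtain ⟨-, ha, hb, -⟩ := WellFormed.gateAt h4 h
      have hj : IsVertex X C (.gate j) := GateAt.lt h
      rw [value_cons ha, value_cons hb, value_cons hj, ih h4 h]

theorem Circuit.IsTree.nonempty {v : Vertex} {S : Finset ℕ} (h : C.IsTree v S) : S.Nonempty := by
  induction h with
  | input i => simp
  | gate _ _ _ _ h₁ _ => exact h₁.mono Finset.subset_union_left

theorem Circuit.IsTree.unique {v : Vertex} {S S' : Finset ℕ} (h : C.IsTree v S) (h' : C.IsTree v S') :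
    S = S' := by
  induction h generalizing S' with
  | input i => cases h'; rfl
  | gate hg _ _ _ h₁ h₂ =>
    cases h' with
    | gate hg' ha' hb' _ =>
      obtain ⟨rfl, rfl⟩ := GateAt.unique hg hg'
      rw [h₁ ha', h₂ hb']

theorem Circuit.IsTree.cons {v : Vertex} {S : Finset ℕ} (h : C.IsTree v S) (g : Vertex × Vertex) :
    Circuit.IsTree (g :: C) v S := by
  induction h with
  | input i => exact .input i
  | gate hg _ _ hd h₁ h₂ => exact .gate (Or.inr hg) h₁ h₂ hd

theorem Circuit.IsTree.value {op : Bool → Bool → Bool} (ha : ∀ a b c, op (op a b) c = op a (op b c))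
    (hs : ∀ a b, op a b = op b a) (hC : C.WellFormed X) {v : Vertex} {S : Finset ℕ}
    (h : C.IsTree v S) (x : ℕ → Bool) : C.value op x v = treeFun op S x := by
  induction h with
  | input i => rw [value_input, treeFun_singleton]
  | gate hg ha' hb' hd h₁ h₂ =>
    rw [WellFormed.value_gate hC op x hg, h₁, h₂, treeFun_union ha hs x ha'.nonempty hb'.nonempty hd]

/-! ### Reachability and acyclicity in subcircuits -/

theorem reach_gate {u : Vertex} {j : ℕ} {a b : Vertex} (hg : C.GateAt j a b)
    (h : Relation.ReflTransGen C.Arc u (.gate j)) :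
    u = .gate j ∨ Relation.ReflTransGen C.Arc u a ∨ Relation.ReflTransGen C.Arc u b := by
  rcases Relation.ReflTransGen.cases_tail h with h | ⟨c, hc, hcj⟩
  · exact Or.inl h.symm
  · obtain ⟨j', a', b', hg', hj, hc'⟩ := arc_iff.1 hcj
    cases hj
    obtain ⟨rfl, rfl⟩ := GateAt.unique hg hg'
    rcases hc' with rfl | rfl
    · exact Or.inr (Or.inl hc)
    · exact Or.inr (Or.inr hc)

theorem reach_input {u : Vertex} {i : ℕ} (h : Relation.ReflTransGen C.Arc u (.input i)) :
    u = .input i := by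
  rcases Relation.ReflTransGen.cases_tail h with h | ⟨c, hc, hcj⟩
  · exact h.symm
  · obtain ⟨_, _, _, _, hj, _⟩ := arc_iff.1 hcj
    cases hj

theorem Circuit.IsTree.of_reach {u v : Vertex} {S : Finset ℕ} (h : C.IsTree v S)
    (hu : Relation.ReflTransGen C.Arc u v) : ∃ S' ⊆ S, C.IsTree u S' := by
  induction h with
  | input i => exact ⟨_, le_rfl, reach_input hu ▸ .input i⟩
  | gate hg ha hb hd h₁ h₂ =>
    rcases reach_gate hg hu with rfl | hu | hu
    · exact ⟨_, le_rfl, .gate hg ha hb hd⟩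
    · obtain ⟨S', h, h'⟩ := h₁ hu
      exact ⟨S', h.trans Finset.subset_union_left, h'⟩
    · obtain ⟨S', h, h'⟩ := h₂ hu
      exact ⟨S', h.trans Finset.subset_union_right, h'⟩

theorem Circuit.IsTree.reach_of_mem {v : Vertex} {S : Finset ℕ} (h : C.IsTree v S) {i : ℕ} (hi : i ∈ S) :
    Relation.ReflTransGen C.Arc (.input i) v := by
  induction h with
  | input j => rw [Finset.mem_singleton.1 hi]
  | gate hg _ _ _ h₁ h₂ =>
    rcases Finset.mem_union.1 hi with hi | hi
    · exact (h₁ hi).tail (arc_iff.2 ⟨_, _, _, hg, rfl, Or.inl rfl⟩)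
    · exact (h₂ hi).tail (arc_iff.2 ⟨_, _, _, hg, rfl, Or.inr rfl⟩)

/-- A common ancestor has a nonempty leaf set, which would lie in both `A` and `B`. -/
theorem Circuit.IsTree.not_reach_both {a b u : Vertex} {A B : Finset ℕ} (ha : C.IsTree a A)
    (hb : C.IsTree b B) (hd : Disjoint A B) (hua : Relation.ReflTransGen C.Arc u a)
    (hub : Relation.ReflTransGen C.Arc u b) : False := by
  obtain ⟨S, hS, h⟩ := ha.of_reach hua
  obtain ⟨S', hS', h'⟩ := hb.of_reach hub
  obtain rfl := h.unique h'
  obtain ⟨i, hi⟩ := h.nonempty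
  exact Finset.disjoint_left.1 hd (hS hi) (hS' hi)

theorem Circuit.WellFormed.rank_lt (hC : C.WellFormed X) {u v : Vertex} (huv : C.Arc u v) :
    u.rank < v.rank := by
  obtain ⟨j, a, b, hg, rfl, h⟩ := arc_iff.1 huv
  obtain ⟨-, -, -, h1, h2⟩ := WellFormed.gateAt hC hg
  rcases h with rfl | rfl
  · exact h1
  · exact h2

theorem Circuit.WellFormed.rank_le (hC : C.WellFormed X) {u v : Vertex}
    (h : Relation.ReflTransGen C.Arc u v) : u.rank ≤ v.rank := by
  induction h with
  | refl => rfl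
  | tail _ h ih => exact ih.trans (WellFormed.rank_lt hC h).le

/-- A second way from `u` to the root would either join the two disjoint sides of some gate or,
starting at a predecessor of that gate, return to this predecessor against the topological order. -/
theorem Circuit.IsTree.successor_unique (hC : C.WellFormed X) {v : Vertex} {S : Finset ℕ}
    (h : C.IsTree v S) {u w w' : Vertex} (huw : C.Arc u w) (hw : Relation.ReflTransGen C.Arc w v)
    (huw' : C.Arc u w') (hw' : Relation.ReflTransGen C.Arc w' v) : w = w' := by
  induction h with
  | input i =>
    obtain rfl := reach_input hw
    obtain ⟨_, _, _, _, hj, _⟩ := arc_iff.1 huw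
    cases hj
  | @gate j a b A B hg ha hb hd h₁ h₂ =>
    have key : ∀ z, C.Arc u z → z = .gate j →
        ∀ y, C.Arc u y → y ≠ .gate j → Relation.ReflTransGen C.Arc y (.gate j) → False := by
      rintro z hz rfl y hy hyj hyr
      obtain ⟨j', a', b', hg', hj, hu⟩ := arc_iff.1 hz
      cases hj
      obtain ⟨rfl, rfl⟩ := GateAt.unique hg hg'
      have hlt := WellFormed.rank_lt hC hy
      rcases reach_gate hg hyr with h | h | h
      · exact hyj h
      · rcases hu with rfl | rfl
        · exact absurd (WellFormed.rank_le hC h) (by omega)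
        · exact ha.not_reach_both hb hd (.head hy h) .refl
      · rcases hu with rfl | rfl
        · exact ha.not_reach_both hb hd .refl (.head hy h)
        · exact absurd (WellFormed.rank_le hC h) (by omega)
    by_cases e : w = .gate j
    · by_contra hne
      exact key w huw e w' huw' (fun h => hne (e.trans h.symm)) hw'
    · by_cases e' : w' = .gate j
      · exact (key w' huw' e' w huw e hw).elim
      · rcases reach_gate hg hw with h | h | h
        · exact (e h).elim
        · rcases reach_gate hg hw' with h' | h' | h'
          · exact (e' h').elim
          · exact h₁ h h'
          · exact (ha.not_reach_both hb hd (.head huw h) (.head huw' h')).elim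
        · rcases reach_gate hg hw' with h' | h' | h'
          · exact (e' h').elim
          · exact (ha.not_reach_both hb hd (.head huw' h') (.head huw h)).elim
          · exact h₂ h h'

/-- The two neighbours on a cycle of a vertex of least rank are distinct, contrary to the
hypothesis. -/
theorem _root_.SimpleGraph.isAcyclic_of_rank {V : Type} {G : SimpleGraph V} (r : V → ℕ)
    (h : ∀ u v w, G.Adj u v → G.Adj u w → r u ≤ r v → r u ≤ r w → v = w) : G.IsAcyclic := by
  classical
  intro v c hc
  obtain ⟨u, hu, hmin⟩ := c.support.toFinset.exists_min_image r ⟨v, by simp⟩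
  rw [List.mem_toFinset] at hu
  have hc' := hc.rotate hu
  have hmem : ∀ w ∈ (c.rotate u hu).support, r u ≤ r w := fun w hw =>
    hmin w (List.mem_toFinset.2 ((SimpleGraph.Walk.mem_support_rotate_iff c u hu).1 hw))
  have hnil := hc'.not_nil
  exact hc'.snd_ne_penultimate (h u _ _ ((c.rotate u hu).adj_snd hnil)
    ((c.rotate u hu).adj_penultimate hnil).symm (hmem _ (SimpleGraph.Walk.getVert_mem_support _ _))
    (hmem _ (SimpleGraph.Walk.getVert_mem_support _ _)))

theorem subcircuitGraph_adj {v a b : Vertex} : (C.subcircuitGraph v).Adj a b ↔ a ≠ b ∧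
    ((C.Arc a b ∧ Relation.ReflTransGen C.Arc b v) ∨
      (C.Arc b a ∧ Relation.ReflTransGen C.Arc a v)) := by
  simp [subcircuitGraph, SimpleGraph.fromRel_adj]

/-- Neighbours of rank at least that of `u` are successors of `u`, and a vertex of a tree has only
one successor in it. -/
theorem Circuit.IsTree.isAcyclic (hC : C.WellFormed X) {v : Vertex} {S : Finset ℕ} (h : C.IsTree v S) :
    (C.subcircuitGraph v).IsAcyclic := by
  refine SimpleGraph.isAcyclic_of_rank Vertex.rank fun u w w' hw hw' hr hr' => ?_
  rw [subcircuitGraph_adj] at hw hw'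
  rcases hw.2 with hw | hw
  · rcases hw'.2 with hw' | hw'
    · exact h.successor_unique hC hw.1 hw.2 hw'.1 hw'.2
    · exact absurd (WellFormed.rank_lt hC hw'.1) (by omega)
  · exact absurd (WellFormed.rank_lt hC hw.1) (by omega)

theorem subcircuitGraph_mono {u v : Vertex} (h : Relation.ReflTransGen C.Arc u v) :
    C.subcircuitGraph u ≤ C.subcircuitGraph v := by
  intro a b hab
  rw [subcircuitGraph_adj] at hab ⊢
  exact ⟨hab.1, hab.2.imp (fun h' => ⟨h'.1, h'.2.trans h⟩) fun h' => ⟨h'.1, h'.2.trans h⟩⟩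

/-- An input below both predecessors `a` and `b` of a gate would close an undirected cycle through
that gate. -/
theorem exists_isTree (hC : C.WellFormed X) {v : Vertex} (hv : IsVertex X C v)
    (h : (C.subcircuitGraph v).IsAcyclic) : ∃ S, C.IsTree v S := by
  induction hn : v.rank using Nat.strong_induction_on generalizing v with
  | _ n ih =>
    cases v with
    | input i => exact ⟨_, .input i⟩
    | gate j =>
      subst hn
      obtain ⟨a, b, hg⟩ := exists_gateAt (show j < C.length from hv)
      obtain ⟨hab, hva, hvb, hra, hrb⟩ := WellFormed.gateAt hC hg
      have haj : C.Arc a (.gate j) := arc_iff.2 ⟨_, _, _, hg, rfl, Or.inl rfl⟩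
      have hbj : C.Arc b (.gate j) := arc_iff.2 ⟨_, _, _, hg, rfl, Or.inr rfl⟩
      obtain ⟨A, hA⟩ := ih _ hra hva (h.anti (subcircuitGraph_mono (.single haj))) rfl
      obtain ⟨B, hB⟩ := ih _ hrb hvb (h.anti (subcircuitGraph_mono (.single hbj))) rfl
      refine ⟨_, .gate hg hA hB (Finset.disjoint_left.2 fun i hiA hiB => ?_)⟩
      have hja : a ≠ .gate j := fun he => by rw [he] at hra; exact lt_irrefl _ hra
      have hjb : b ≠ .gate j := fun he => by rw [he] at hrb; exact lt_irrefl _ hrb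
      have hadj : (C.subcircuitGraph (.gate j)).Adj a (.gate j) :=
        subcircuitGraph_adj.2 ⟨hja, Or.inl ⟨haj, .refl⟩⟩
      -- Every edge of an acyclic graph is a bridge, so it suffices to join `a` to the gate without
      -- the edge between them, via the common input `i` and then `b`.
      have hbr := SimpleGraph.isAcyclic_iff_forall_adj_isBridge.1 h hadj
      rw [SimpleGraph.isBridge_iff] at hbr
      refine hbr ?_
      set G := (C.subcircuitGraph (.gate j)).deleteEdges {s(a, .gate j)} with hG
      -- A path that ends in a predecessor of gate `j` stays at smaller rank than the gate, so it
      -- avoids the deleted edge.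
      have key : ∀ u w, Relation.ReflTransGen C.Arc u w → C.Arc w (.gate j) →
          G.Reachable u w := by
        intro u w huw hwj
        induction huw using Relation.ReflTransGen.head_induction_on with
        | refl => rfl
        | @head x y hxy hyw ihy =>
          refine SimpleGraph.Reachable.trans (SimpleGraph.Adj.reachable ?_) ihy
          have h1 := WellFormed.rank_lt hC hxy
          have h2 := WellFormed.rank_le hC hyw
          have h3 := WellFormed.rank_lt hC hwj
          rw [hG, SimpleGraph.deleteEdges_adj]
          refine ⟨subcircuitGraph_adj.2 ⟨fun he => by rw [he] at h1; exact lt_irrefl _ h1,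
            Or.inl ⟨hxy, hyw.tail hwj⟩⟩, fun he => ?_⟩
          rw [Set.mem_singleton_iff, Sym2.eq_iff] at he
          rcases he with ⟨-, rfl⟩ | ⟨rfl, -⟩ <;> omega
      have hb : G.Adj b (.gate j) := by
        rw [hG, SimpleGraph.deleteEdges_adj]
        refine ⟨subcircuitGraph_adj.2 ⟨hjb, Or.inl ⟨hbj, .refl⟩⟩, fun he => ?_⟩
        rw [Set.mem_singleton_iff, Sym2.eq_iff] at he
        rcases he with ⟨rfl, -⟩ | ⟨rfl, -⟩
        · exact hab rfl
        · exact hjb rfl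
      exact ((key _ _ (hA.reach_of_mem hiA) haj).symm.trans
        (key _ _ (hB.reach_of_mem hiB) hbj)).trans hb.reachable

end

/-! ### Families of sets closed under decomposition -/

/-- Every set of `F` is the disjoint union of two nonempty sets that are singletons or in `F`. -/
def Decomposable (F : Finset (Finset ℕ)) : Prop :=
  ∀ S ∈ F, ∃ A B : Finset ℕ, S = A ∪ B ∧ Disjoint A B ∧ A.Nonempty ∧ B.Nonempty ∧
    (A ∈ F ∨ A.card = 1) ∧ (B ∈ F ∨ B.card = 1)

/-- The family consists of the leaf sets of those gates whose subcircuits are trees. Several gates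
may share a leaf set, hence only an inequality for the cardinality. -/
theorem IsSolution.exists_family {op : Bool → Bool → Bool}
    (ha : ∀ a b c, op (op a b) c = op a (op b c)) (hs : ∀ a b, op a b = op b a)
    (hc : ∃ b, op true b ≠ op false b) {𝒯 : Finset (Finset ℕ)} {C : Circuit}
    (h : IsSolution op 𝒯 C) :
    ∃ F : Finset (Finset ℕ), F.card ≤ C.size ∧ (∀ T ∈ 𝒯, 2 ≤ T.card → T ∈ F) ∧
      Decomposable F := by
  classical
  obtain ⟨hC, hT⟩ := h
  -- The default `∅` is no leaf set, so the filter in `F` removes it.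
  let f : ℕ → Finset ℕ := fun j =>
    if h : ∃ S, C.IsTree (.gate j) S then h.choose else ∅
  let F : Finset (Finset ℕ) :=
    ((Finset.range C.length).image f).filter fun S => ∃ j, C.IsTree (.gate j) S
  have hF : ∀ j S, C.IsTree (.gate j) S → S ∈ F := by
    intro j S hS
    refine Finset.mem_filter.2 ⟨Finset.mem_image.2 ⟨j, ?_, ?_⟩, j, hS⟩
    · cases hS with
      | gate hg => exact Finset.mem_range.2 (GateAt.lt hg)
    · have hex : ∃ S, C.IsTree (.gate j) S := ⟨S, hS⟩
      simp only [f, dif_pos hex]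
      exact hex.choose_spec.unique hS
  refine ⟨F, ?_, fun T hT' hcard => ?_, fun S hS => ?_⟩
  · refine (Finset.card_filter_le _ _).trans (Finset.card_image_le.trans ?_)
    simp [Circuit.size]
  · obtain ⟨v, hv, hac, hval⟩ := hT T hT'
    obtain ⟨S, hS⟩ := exists_isTree hC hv hac
    obtain rfl : S = T := treeFun_injOn ha hs hc fun x => by
      rw [← hval, hS.value ha hs hC]
    cases v with
    | input i => cases hS; simp at hcard
    | gate j => exact hF j S hS
  · obtain ⟨-, j, hj⟩ := Finset.mem_filter.1 hS
    have key : ∀ v A, C.IsTree v A → A ∈ F ∨ A.card = 1 := by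
      intro v A hA
      cases v with
      | input i => cases hA; simp
      | gate j => exact Or.inl (hF j A hA)
    cases hj with
    | gate hg hA hB hd =>
      exact ⟨_, _, rfl, hd, hA.nonempty, hB.nonempty, key _ _ hA, key _ _ hB⟩

/-- If neither value of the second argument makes the first one matter, then by symmetry no argument
matters. -/
theorem exists_op_ne_of_not_const {op : Bool → Bool → Bool} (hs : ∀ a b, op a b = op b a)
    (h : ¬ isConstTable [op false false, op false true, op true false, op true true]) :
    ∃ b, op true b ≠ op false b := by
  by_contra! hc
  refine h ?_
  have h1 := hc true
  have h2 := hc false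
  have h3 := hs true false
  rw [h1, ← h3, h2]
  cases op false false <;> rfl


/-! ### Plans -/

theorem sub_iff {A B : List ℕ} : sub A B = true ↔ A.toFinset ⊆ B.toFinset := by
  simp [sub, Finset.subset_iff]

theorem disj_iff {A B : List ℕ} : disj A B = true ↔ Disjoint A.toFinset B.toFinset := by
  simp [disj, Finset.disjoint_left]

/-- The set `S` is a singleton or listed in `pl`. -/
def Has (pl : List (List ℕ)) (S : Finset ℕ) : Prop := S.card = 1 ∨ ∃ A ∈ pl, A.toFinset = S

theorem Has.mono {pl pl' : List (List ℕ)} {S : Finset ℕ} (h : Has pl S) (hs : pl ⊆ pl') :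
    Has pl' S := h.imp_right fun ⟨A, hA, h⟩ => ⟨A, hs hA, h⟩

/-- `S` is the disjoint union of two sets that are singletons or listed in `pl`. -/
def Splits (pl : List (List ℕ)) (S : Finset ℕ) : Prop :=
  ∃ A B : Finset ℕ, Has pl A ∧ Has pl B ∧ Disjoint A B ∧ S = A ∪ B

/-- `N` is a plan over the variables `X`. -/
def IsPlan (X : Finset ℕ) : List (List ℕ) → Prop
  | [] => True
  | U :: N => (U.Nodup ∧ U.toFinset ⊆ X ∧ Splits N U.toFinset) ∧ IsPlan X N

theorem IsPlan.nodup {X : Finset ℕ} {N : List (List ℕ)} (h : IsPlan X N) :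
    ∀ A ∈ N, A.Nodup := by
  induction N with
  | nil => simp
  | cons U N ih =>
    intro A hA
    rcases List.mem_cons.1 hA with rfl | hA
    · exact h.1.1
    · exact ih h.2 A hA

theorem exists_mem_singletons_append {pl : List (List ℕ)} {U : List ℕ} {S : Finset ℕ}
    (h : Has pl S) (hS : S ⊆ U.toFinset) :
    ∃ A ∈ (U.map fun i => [i]) ++ pl, A.toFinset = S := by
  rcases h with h | ⟨A, hA, h⟩
  · obtain ⟨i, rfl⟩ := Finset.card_eq_one.1 h
    refine ⟨[i], List.mem_append_left _ (List.mem_map.2 ⟨i, ?_, rfl⟩), rfl⟩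
    simpa using hS
  · exact ⟨A, List.mem_append_right _ hA, h⟩

theorem has_of_mem {pl : List (List ℕ)} {U A : List ℕ}
    (h : A ∈ (U.map fun i => [i]) ++ pl) : Has pl A.toFinset := by
  rcases List.mem_append.1 h with h | h
  · obtain ⟨i, -, rfl⟩ := List.mem_map.1 h
    exact Or.inl rfl
  · exact Or.inr ⟨A, h, rfl⟩

theorem entries_cons (U V : List ℕ) (N : List (List ℕ)) (e : List ℕ × Vertex) :
    e ∈ entries U (V :: N) ↔ e = (V, Vertex.gate N.length) ∨ e ∈ entries U N := by
  simp only [entries, flatMapT, List.mem_append, List.mem_singleton]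
  tauto

theorem exists_entry {U A : List ℕ} {N : List (List ℕ)} (h : A ∈ (U.map fun i => [i]) ++ N) :
    ∃ v, (A, v) ∈ entries U N := by
  induction N with
  | nil =>
    simp only [List.append_nil, List.mem_map] at h
    obtain ⟨i, hi, rfl⟩ := h
    exact ⟨.input i, by simp [entries, hi]⟩
  | cons V N ih =>
    rw [List.mem_append, List.mem_cons] at h
    by_cases hA : A = V
    · exact ⟨_, (entries_cons U V N _).2 (Or.inl (by rw [hA]))⟩
    · obtain ⟨v, hv⟩ := ih (List.mem_append.2 (by tauto))
      exact ⟨v, (entries_cons U V N _).2 (Or.inr hv)⟩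

/-- The split of the newest set guarantees that the search for predecessors finds a candidate.
Whichever is chosen, its two leaf sets are disjoint with union `U`. -/
theorem IsPlan.toCircuit {X : Finset ℕ} {N : List (List ℕ)} (h : IsPlan X N) :
    (toCircuit N).WellFormed X ∧ (toCircuit N).length = N.length ∧
      ∀ U : List ℕ, U.toFinset ⊆ X → ∀ e ∈ entries U N,
        Circuit.IsVertex X (toCircuit N) e.2 ∧ (toCircuit N).IsTree e.2 e.1.toFinset := by
  induction N with
  | nil =>
    refine ⟨trivial, rfl, fun U hU e he => ?_⟩
    simp only [entries, flatMapT, List.append_nil, List.mem_map] at he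
    obtain ⟨i, hi, rfl⟩ := he
    exact ⟨hU (by simpa using hi), .input i⟩
  | cons U N ih =>
    obtain ⟨⟨hnd, hUX, A, B, hA, hB, hd, hAB⟩, hN⟩ := h
    obtain ⟨hwf, hlen, hent⟩ := ih hN
    obtain ⟨A', hA', rfl⟩ := exists_mem_singletons_append hA (hAB ▸ Finset.subset_union_left)
    obtain ⟨B', hB', rfl⟩ := exists_mem_singletons_append hB (hAB ▸ Finset.subset_union_right)
    obtain ⟨v, hv⟩ := exists_entry hA'
    obtain ⟨v', hv'⟩ := exists_entry hB'
    have hmem : (v, v') ∈ gatePairs U N := by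
      refine List.mem_flatMap.2 ⟨_, hv, List.mem_map.2 ⟨_, List.mem_filter.2 ⟨hv', ?_⟩, rfl⟩⟩
      simp only [Bool.and_eq_true, sub_iff, disj_iff, List.toFinset_append]
      exact ⟨⟨hAB ▸ Finset.subset_union_left, hAB ▸ Finset.subset_union_right⟩, hd, hAB.le⟩
    obtain ⟨p, hp, hg⟩ : ∃ p ∈ gatePairs U N, gateOf U N = [p] := by
      unfold gateOf
      cases hgp : gatePairs U N with
      | nil => simp [hgp] at hmem
      | cons p _ => exact ⟨p, by simp, rfl⟩
    have hC : BSTSO.toCircuit (U :: N) = p :: BSTSO.toCircuit N := by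
      simp [BSTSO.toCircuit, flatMapT, hg]
    obtain ⟨⟨A, a⟩, ha, hp⟩ := List.mem_flatMap.1 hp
    obtain ⟨⟨B, b⟩, hb, rfl⟩ := List.mem_map.1 hp
    obtain ⟨hb, hab⟩ := List.mem_filter.1 hb
    simp only [Bool.and_eq_true, sub_iff, disj_iff, List.toFinset_append] at hab
    obtain ⟨⟨hAU, hBU⟩, hdis, hUAB⟩ := hab
    obtain ⟨hva, hta⟩ := hent U hUX _ ha
    obtain ⟨hvb, htb⟩ := hent U hUX _ hb
    -- Equal predecessors would have equal leaf sets, which are nonempty and hence not disjoint.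
    have hne : a ≠ b := by
      rintro rfl
      have := hta.unique htb
      dsimp only at this
      rw [this, disjoint_self] at hdis
      exact htb.nonempty.ne_empty hdis
    rw [hC]
    refine ⟨⟨hne, hva, hvb, hwf⟩, by simp [hlen], fun V hV e he => ?_⟩
    rcases (entries_cons V U N e).1 he with rfl | he
    · refine ⟨?_, ?_⟩
      · simp [Circuit.IsVertex, hlen]
      · have : U.toFinset = A.toFinset ∪ B.toFinset :=
          hUAB.antisymm (Finset.union_subset hAU hBU)
        dsimp only
        rw [this]
        exact .gate (Or.inl ⟨hlen.symm, rfl, rfl⟩) (hta.cons _) (htb.cons _) hdis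
    · obtain ⟨h1, h2⟩ := hent V hV e he
      exact ⟨Circuit.IsVertex.cons h1, h2.cons _⟩

theorem IsPlan.isSolution {op : Bool → Bool → Bool} (ha : ∀ a b c, op (op a b) c = op a (op b c))
    (hs : ∀ a b, op a b = op b a) {𝒯 : Finset (Finset ℕ)} {N : List (List ℕ)}
    (h : IsPlan (varSet 𝒯) N) (hT : ∀ T ∈ 𝒯, Has N T) : IsSolution op 𝒯 (BSTSO.toCircuit N) := by
  obtain ⟨hwf, hlen, hent⟩ := h.toCircuit
  refine ⟨hwf, fun T hT' => ?_⟩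
  have hTX : T ⊆ varSet 𝒯 := Finset.subset_biUnion_of_mem id hT'
  obtain ⟨A, hA, hAT⟩ := exists_mem_singletons_append (U := T.toList) (hT T hT') (by simp)
  obtain ⟨v, hv⟩ := exists_entry hA
  obtain ⟨h1, h2⟩ := hent T.toList (by simpa using hTX) _ hv
  rw [hAT] at h2
  exact ⟨v, h1, h2.isAcyclic hwf, fun x => h2.value ha hs hwf x⟩

/-- Each word of the chain splits into its first element and the next older word; the oldest word
extends `A`. -/
theorem chainWords_isPlan {X : Finset ℕ} {pl : List (List ℕ)} {A : List ℕ} (hpl : IsPlan X pl)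
    (hA : A.Nodup) (hAX : A.toFinset ⊆ X) (hAp : Has pl A.toFinset) (l : List ℕ) (hl : l.Nodup)
    (hlX : l.toFinset ⊆ X) (hd : List.Disjoint l A) :
    IsPlan X (flatMapT (fun b r => [(b :: r) ++ A]) l ++ pl) ∧
      Has (flatMapT (fun b r => [(b :: r) ++ A]) l ++ pl) (l ++ A).toFinset := by
  induction l with
  | nil => exact ⟨hpl, hAp⟩
  | cons b r ih =>
    rw [List.nodup_cons] at hl
    rw [List.disjoint_cons_left] at hd
    have hbX : b ∈ X := hlX (by simp)
    have hrX : r.toFinset ⊆ X := fun i hi => hlX (by simp at hi ⊢; exact Or.inr hi)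
    obtain ⟨h1, h2⟩ := ih hl.2 hrX hd.2
    refine ⟨⟨⟨?_, ?_, {b}, (r ++ A).toFinset, Or.inl rfl, h2, ?_, ?_⟩, h1⟩, ?_⟩
    · refine List.Nodup.append (List.nodup_cons.2 hl) hA (List.disjoint_cons_left.2 hd)
    · rw [List.toFinset_append]
      exact Finset.union_subset hlX hAX
    · simp [hl.1, hd.1]
    · simp
    · exact Or.inr ⟨(b :: r) ++ A, by simp [flatMapT], rfl⟩

theorem toFinset_filter_contains {U A : List ℕ} (h : A.toFinset ⊆ U.toFinset) :
    (U.filter fun i => A.contains i).toFinset = A.toFinset := by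
  ext i
  have := @h i
  simp only [List.mem_toFinset, List.mem_filter, List.contains_iff_mem] at this ⊢
  tauto

theorem mem_avail {pl : List (List ℕ)} {U A : List ℕ} :
    A ∈ avail pl U ↔ A ∈ (U.map fun i => [i]) ++ pl ∧ A.toFinset ⊆ U.toFinset := by
  rw [avail, List.mem_filter, sub_iff]

theorem exists_mem_avail {pl : List (List ℕ)} {U : List ℕ} {S : Finset ℕ} (h : Has pl S)
    (hS : S ⊆ U.toFinset) : ∃ A ∈ avail pl U, A.toFinset = S := by
  obtain ⟨A, hA, rfl⟩ := exists_mem_singletons_append h hS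
  exact ⟨A, mem_avail.2 ⟨hA, hS⟩, rfl⟩

theorem length_flatMapT_singleton {β γ : Type} (f : β → List β → γ) (l : List β) :
    (flatMapT (fun b r => [f b r]) l).length = l.length := by
  induction l with
  | nil => rfl
  | cons b r ih => simp [flatMapT, ih]

/-- The three ways in which a set is added to a plan. -/
theorem planNew_cases (pl : List (List ℕ)) {U : List ℕ} (hU : U ≠ []) :
    (planNew pl U = [] ∧ Has pl U.toFinset) ∨
    (planNew pl U = [U] ∧ ¬ Has pl U.toFinset ∧ Splits pl U.toFinset) ∨
    (¬ Has pl U.toFinset ∧ ¬ Splits pl U.toFinset ∧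
      ∃ A ∈ avail pl U, (∀ B ∈ avail pl U, B.length ≤ A.length) ∧
        planNew pl U = chainWords U A) := by
  have e1 : ((avail pl U).any fun A => sub U A) = true ↔ Has pl U.toFinset := by
    rw [List.any_eq_true]
    constructor
    · rintro ⟨A, hA, h⟩
      obtain ⟨hA, hAU⟩ := mem_avail.1 hA
      rw [sub_iff] at h
      rw [h.antisymm hAU]
      exact has_of_mem hA
    · intro h
      obtain ⟨A, hA, hAU⟩ := exists_mem_avail h le_rfl
      exact ⟨A, hA, sub_iff.2 hAU.ge⟩
  have e2 : ((avail pl U).any fun A => (avail pl U).any fun B => disj A B && sub U (A ++ B)) = true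
      ↔ Splits pl U.toFinset := by
    simp only [List.any_eq_true, Bool.and_eq_true, sub_iff, disj_iff, List.toFinset_append]
    constructor
    · rintro ⟨A, hA, B, hB, hd, h⟩
      obtain ⟨hA, hAU⟩ := mem_avail.1 hA
      obtain ⟨hB, hBU⟩ := mem_avail.1 hB
      exact ⟨_, _, has_of_mem hA, has_of_mem hB, hd, h.antisymm (Finset.union_subset hAU hBU)⟩
    · rintro ⟨A, B, hA, hB, hd, h⟩
      obtain ⟨A, hA', rfl⟩ := exists_mem_avail (U := U) hA (h ▸ Finset.subset_union_left)
      obtain ⟨B, hB', rfl⟩ := exists_mem_avail (U := U) hB (h ▸ Finset.subset_union_right)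
      exact ⟨A, hA', B, hB', hd, h.le⟩
  unfold planNew
  by_cases h1 : Has pl U.toFinset
  · exact Or.inl ⟨by rw [e1.2 h1]; rfl, h1⟩
  · rw [Bool.eq_false_iff.2 (mt e1.1 h1)]
    by_cases h2 : Splits pl U.toFinset
    · exact Or.inr (Or.inl ⟨by rw [e2.2 h2]; rfl, h1, h2⟩)
    · rw [Bool.eq_false_iff.2 (mt e2.1 h2)]
      refine Or.inr (Or.inr ⟨h1, h2, ?_⟩)
      obtain ⟨i, l, rfl⟩ := List.exists_cons_of_ne_nil hU
      have hne : (avail pl (i :: l)).toFinset.Nonempty :=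
        ⟨[i], List.mem_toFinset.2 (mem_avail.2 ⟨by simp, by simp⟩)⟩
      obtain ⟨A, hA, hmax⟩ := Finset.exists_max_image _ List.length hne
      have hmem : ∀ B, B ∈ largest pl (i :: l) ↔
          B ∈ avail pl (i :: l) ∧ ∀ D ∈ avail pl (i :: l), D.length ≤ B.length := by
        intro B
        simp [largest]
      have hA' : A ∈ largest pl (i :: l) :=
        (hmem A).2 ⟨List.mem_toFinset.1 hA, fun B hB => hmax B (List.mem_toFinset.2 hB)⟩
      cases hl : largest pl (i :: l) with
      | nil => simp [hl] at hA'
      | cons B m =>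
        have hB : B ∈ largest pl (i :: l) := by simp [hl]
        exact ⟨B, ((hmem B).1 hB).1, ((hmem B).1 hB).2, rfl⟩

theorem IsPlan.planStep {X : Finset ℕ} {pl : List (List ℕ)} {U : List ℕ} (h : IsPlan X pl)
    (hU : U ≠ []) (hnd : U.Nodup) (hUX : U.toFinset ⊆ X) :
    IsPlan X (planStep pl U) ∧ Has (planStep pl U) U.toFinset := by
  unfold BSTSO.planStep
  rcases planNew_cases pl hU with ⟨e, h1⟩ | ⟨e, -, h1⟩ | ⟨-, -, A, hA, -, e⟩
  · rw [e]
    exact ⟨h, h1⟩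
  · rw [e]
    exact ⟨⟨⟨hnd, hUX, h1⟩, h⟩, Or.inr ⟨U, by simp, rfl⟩⟩
  · rw [e]
    obtain ⟨hA, hAU⟩ := mem_avail.1 hA
    have e1 := toFinset_filter_contains hAU
    obtain ⟨h1, h2⟩ := chainWords_isPlan h (A := U.filter fun i => A.contains i) (hnd.filter _)
      (e1 ▸ hAU.trans hUX) (e1 ▸ has_of_mem hA) (U.filter fun i => !A.contains i) (hnd.filter _)
      (fun i hi => hUX (by simp at hi ⊢; exact hi.1))
      (fun i hi hi' => by simp at hi hi'; exact hi.2 hi'.2)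
    refine ⟨h1, ?_⟩
    have e2 : ((U.filter fun i => !A.contains i) ++ U.filter fun i => A.contains i).toFinset
        = U.toFinset := by
      ext i
      simp only [List.toFinset_append, Finset.mem_union, List.mem_toFinset, List.mem_filter]
      cases A.contains i <;> simp
    rw [e2] at h2
    exact h2

/-- `n` gates suffice to obtain `S` from `pl`, by adding single elements to an available subset or
by joining two available sets. -/
def Reaches (pl : List (List ℕ)) (S : Finset ℕ) (n : ℕ) : Prop :=
  (∃ V, Has pl V ∧ V ⊆ S ∧ S.card ≤ n + V.card) ∨ (1 ≤ n ∧ Splits pl S)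

theorem Reaches.mono {pl pl' : List (List ℕ)} {S : Finset ℕ} {n : ℕ} (h : Reaches pl S n)
    (hs : ∀ V, Has pl V → Has pl' V) : Reaches pl' S n := by
  rcases h with ⟨V, h1, h2⟩ | ⟨h1, A, B, hA, hB, h⟩
  · exact Or.inl ⟨V, hs _ h1, h2⟩
  · exact Or.inr ⟨h1, A, B, hs _ hA, hs _ hB, h⟩

theorem length_filter_add_filter_not {β : Type} (p : β → Bool) (l : List β) :
    (l.filter p).length + (l.filter fun b => !p b).length = l.length := by
  induction l with
  | nil => rfl
  | cons b l ih => cases h : p b <;> simp [h] <;> omega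

/-- The greedy step is at least as good as either way of realising `n`: it uses one gate if `U`
splits, and otherwise extends an available subset of maximum size. -/
theorem length_planNew_le {X : Finset ℕ} {pl : List (List ℕ)} {U : List ℕ} (h : IsPlan X pl)
    (hU : U ≠ []) (hnd : U.Nodup) {n : ℕ} (hr : Reaches pl U.toFinset n) :
    (planNew pl U).length ≤ n := by
  rcases planNew_cases pl hU with ⟨e, h1⟩ | ⟨e, h1, -⟩ | ⟨-, h2, A, hA, hmax, e⟩
  · simp [e]
  · rw [e, List.length_singleton]
    -- As `U` itself is not available, `V` is a proper subset, which gives `1 ≤ n`.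
    rcases hr with ⟨V, hV, hVU, hc⟩ | hr
    · have hne : V ≠ U.toFinset := fun he => h1 (he ▸ hV)
      have := Finset.card_lt_card (hVU.ssubset_of_ne hne)
      omega
    · exact hr.1
  · rw [e]
    rcases hr with ⟨V, hV, hVU, hc⟩ | hr
    · obtain ⟨B, hB, rfl⟩ := exists_mem_avail hV hVU
      have h3 := hmax B hB
      obtain ⟨hA, hAU⟩ := mem_avail.1 hA
      have hAnd : A.Nodup := by
        rcases List.mem_append.1 hA with hA | hA
        · obtain ⟨i, -, rfl⟩ := List.mem_map.1 hA
          exact List.nodup_singleton i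
        · exact h.nodup A hA
      have h4 := length_filter_add_filter_not (fun i => A.contains i) U
      have h5 : (U.filter fun i => A.contains i).length = A.length := by
        rw [← List.toFinset_card_of_nodup (hnd.filter _), toFinset_filter_contains hAU,
          List.toFinset_card_of_nodup hAnd]
      have h6 := List.toFinset_card_le B
      rw [List.toFinset_card_of_nodup hnd] at hc
      unfold chainWords
      rw [length_flatMapT_singleton (fun b r => (b :: r) ++ U.filter fun i => A.contains i)]
      omega
    · exact (h2 hr.2).elim

theorem plan_concat (ws : List (List ℕ)) (U : List ℕ) :
    plan (ws ++ [U]) = planNew (plan ws) U ++ plan ws := by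
  simp [plan, planStep]

theorem plan_spec {X : Finset ℕ} {ws : List (List ℕ)}
    (h : ∀ U ∈ ws, U ≠ [] ∧ U.Nodup ∧ U.toFinset ⊆ X) :
    IsPlan X (plan ws) ∧ ∀ U ∈ ws, Has (plan ws) U.toFinset := by
  induction ws using List.reverseRecOn with
  | nil => exact ⟨trivial, by simp⟩
  | append_singleton ws U ih =>
    obtain ⟨h1, h2⟩ := ih fun V hV => h V (by simp [hV])
    obtain ⟨h3, h4, h5⟩ := h U (by simp)
    obtain ⟨h6, h7⟩ := h1.planStep h3 h4 h5
    rw [plan_concat]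
    refine ⟨h6, fun V hV => ?_⟩
    rcases List.mem_append.1 hV with hV | hV
    · exact (h2 V hV).mono (List.subset_append_right _ _)
    · rw [List.mem_singleton.1 hV]
      exact h7

theorem has_plan {X : Finset ℕ} {ws : List (List ℕ)}
    (h : ∀ U ∈ ws, U ≠ [] ∧ U.Nodup ∧ U.toFinset ⊆ X) {V : Finset ℕ} (hV : Has ws V) :
    Has (plan ws) V := by
  rcases hV with hV | ⟨A, hA, rfl⟩
  · exact Or.inl hV
  · exact (plan_spec h).2 A hA

/-- A cost that is realisable from the listed sets before `U` is realisable from their plan, because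
the plan makes all of them available. -/
theorem length_plan_append_le {X : Finset ℕ} {pre ws : List (List ℕ)}
    (h : ∀ U ∈ pre ++ ws, U ≠ [] ∧ U.Nodup ∧ U.toFinset ⊆ X) (c : List ℕ → ℕ)
    (hc : ∀ l₁ U l₂, ws = l₁ ++ U :: l₂ → Reaches (pre ++ l₁) U.toFinset (c U)) :
    (plan (pre ++ ws)).length ≤ (plan pre).length + (ws.map c).sum := by
  induction ws using List.reverseRecOn with
  | nil => simp
  | append_singleton ws U ih =>
    rw [← List.append_assoc] at h ⊢
    have h' : ∀ U ∈ pre ++ ws, U ≠ [] ∧ U.Nodup ∧ U.toFinset ⊆ X :=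
      fun V hV => h V (List.mem_append_left _ hV)
    have h1 := ih h' fun l₁ V l₂ e => hc l₁ V (l₂ ++ [U]) (by simp [e])
    have h2 := hc ws U [] rfl
    obtain ⟨h3, h4, h5⟩ := h U (by simp)
    have h6 := length_planNew_le (plan_spec h').1 h3 h4 (h2.mono fun V hV => has_plan h' hV)
    rw [plan_concat]
    simp only [List.length_append, List.map_append, List.sum_append, List.map_cons, List.map_nil,
      List.sum_cons, List.sum_nil]
    omega

theorem length_plan_le {X : Finset ℕ} {ws : List (List ℕ)}
    (h : ∀ U ∈ ws, U ≠ [] ∧ U.Nodup ∧ U.toFinset ⊆ X) :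
    (plan ws).length ≤ (ws.map fun U => U.length - 1).sum := by
  have := length_plan_append_le (pre := []) (ws := ws) h (fun U => U.length - 1)
    fun l₁ U l₂ e => by
      obtain ⟨h1, h2, -⟩ := h U (by simp [e])
      obtain ⟨i, l, rfl⟩ := List.exists_cons_of_ne_nil h1
      exact Or.inl ⟨{i}, Or.inl rfl, by simp, by
        rw [List.toFinset_card_of_nodup h2]; simp⟩
  simpa [plan] using this

/-! ### Treating the trees by increasing size -/

theorem insertLen_perm (s : List (List ℕ)) (a : List ℕ) : (insertLen s a).Perm (a :: s) := by
  unfold insertLen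
  refine List.perm_middle.trans (.cons a ?_)
  exact List.filter_append_perm _ _

theorem sortLen_perm (w : List (List ℕ)) : (sortLen w).Perm w := by
  induction w using List.reverseRecOn with
  | nil => rfl
  | append_singleton w a ih =>
    have : sortLen (w ++ [a]) = insertLen (sortLen w) a := by simp [sortLen]
    rw [this]
    refine (insertLen_perm _ _).trans ((List.Perm.cons a ih).trans ?_)
    exact (List.perm_append_singleton a w).symm

theorem sortLen_pairwise (w : List (List ℕ)) :
    (sortLen w).Pairwise fun A B => A.length ≤ B.length := by
  induction w using List.reverseRecOn with
  | nil => exact .nil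
  | append_singleton w a ih =>
    have : sortLen (w ++ [a]) = insertLen (sortLen w) a := by simp [sortLen]
    rw [this, insertLen, List.pairwise_append, List.pairwise_cons]
    refine ⟨ih.filter _, ⟨fun b hb => ?_, ih.filter _⟩, fun b hb d hd => ?_⟩
    · simp at hb
      omega
    · simp only [List.mem_cons, List.mem_filter, decide_eq_true_eq, Bool.not_eq_true',
        decide_eq_false_iff_not] at hb hd
      rcases hd with rfl | hd
      · exact hb.2
      · omega

/-- The number of gates needed by the plan for the trees `w` with the auxiliary sets `pre`. -/
theorem length_plan_sortLen_le {X : Finset ℕ} {pre w : List (List ℕ)}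
    (hp : ∀ U ∈ pre, U ≠ [] ∧ U.Nodup ∧ U.toFinset ⊆ X)
    (hw : ∀ U ∈ w, U ≠ [] ∧ U.Nodup ∧ U.toFinset ⊆ X) (c : List ℕ → ℕ)
    (hc : ∀ T ∈ w, Reaches (pre ++ w.filter fun S => decide (S.length < T.length)) T.toFinset (c T)) :
    (plan (pre ++ sortLen w)).length ≤
      (pre.map fun U => U.length - 1).sum + (w.map c).sum := by
  have hs : ∀ U ∈ pre ++ sortLen w, U ≠ [] ∧ U.Nodup ∧ U.toFinset ⊆ X := by
    intro U hU
    rcases List.mem_append.1 hU with hU | hU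
    · exact hp U hU
    · exact hw U ((sortLen_perm w).mem_iff.1 hU)
  have h1 := length_plan_append_le hs c fun l₁ U l₂ e => by
    have hU : U ∈ w := (sortLen_perm w).mem_iff.1 (by simp [e])
    -- A tree shorter than `U` cannot stand after it in the sorted list, so it belongs to `l₁`.
    refine (hc U hU).mono fun V hV => hV.mono fun S hS => ?_
    rcases List.mem_append.1 hS with hS | hS
    · exact List.mem_append_left _ hS
    · obtain ⟨hS, hlt⟩ := List.mem_filter.1 hS
      have hS' := (sortLen_perm w).mem_iff.2 hS
      have hpw := sortLen_pairwise w
      rw [e] at hS' hpw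
      rcases List.mem_append.1 hS' with h | h
      · exact List.mem_append_right _ h
      · simp only [decide_eq_true_eq] at hlt
        rcases List.mem_cons.1 h with rfl | h
        · omega
        · have := (List.pairwise_cons.1 (List.pairwise_append.1 hpw).2.1).1 S h
          omega
  have h2 := length_plan_le hp
  rw [((sortLen_perm w).map c).sum_eq] at h1
  omega


/-! ### Clusters of trees -/

theorem mem_unfit {fits : List ℕ → List ℕ → Bool} {w : List (List ℕ)} {T : List ℕ} :
    T ∈ unfit fits w ↔ T ∈ w ∧ ∀ S ∈ w, ¬ fits S T := by
  simp [unfit]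

theorem length_filter_eq_card {β : Type} [DecidableEq β] {l : List β} (hl : l.Nodup)
    (p : β → Bool) : (l.filter p).length = (l.toFinset.filter fun b => p b = true).card := by
  rw [← List.toFinset_card_of_nodup (hl.filter _), List.toFinset_filter]

theorem mem_tripleInters {w : List (List ℕ)} {R : List ℕ} :
    R ∈ tripleInters w ↔ ∃ A ∈ w, ∃ B ∈ w, ∃ D ∈ w, inter (inter A B) D = R := by
  simp [tripleInters]

theorem toFinset_inter (A B : List ℕ) : (inter A B).toFinset = A.toFinset ∩ B.toFinset := by
  ext i
  simp [inter]

/-- Choosing `R` settles all remaining trees that fit it, and `hB` limits the cost of `R` and of its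
extensions to `B / 3` per settled tree. Once `R` has been considered, at most two remaining trees
fit it, and this persists because trees are only removed. -/
theorem clusterStep_foldl_spec {fits : List ℕ → List ℕ → Bool} {rem₀ : List (List ℕ)}
    (hnd : rem₀.Nodup) {B : ℕ}
    (hB : ∀ (R : List ℕ) (S : Finset (List ℕ)), 3 ≤ S.card →
      (∀ T ∈ S, T ∈ rem₀ ∧ fits R T = true) →
      3 * ((R.length - 1) + ∑ T ∈ S, (T.length - R.length)) ≤ B * S.card)
    (l : List (List ℕ)) {pre rem : List (List ℕ)}
    (h : l.foldl (clusterStep fits) ([], rem₀) = (pre, rem)) :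
    rem.Sublist rem₀ ∧ (∀ R ∈ pre, R ∈ l ∧ ∃ T ∈ rem₀, fits R T = true) ∧
      (∀ R ∈ l, (rem.filter (fits R)).length ≤ 2) ∧
      ∃ c : List ℕ → ℕ,
        (∀ T ∈ rem₀.toFinset \ rem.toFinset,
          ∃ R ∈ pre, fits R T = true ∧ c T = T.length - R.length) ∧
        3 * ((pre.map fun R => R.length - 1).sum + ∑ T ∈ rem₀.toFinset \ rem.toFinset, c T) ≤
          B * (rem₀.toFinset \ rem.toFinset).card := by
  induction l using List.reverseRecOn generalizing pre rem with
  | nil =>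
    simp only [List.foldl_nil, Prod.mk.injEq] at h
    obtain ⟨rfl, rfl⟩ := h
    exact ⟨.refl _, by simp, by simp, fun _ => 0, by simp, by simp⟩
  | append_singleton l R ih =>
    rw [List.foldl_append] at h
    obtain ⟨⟨pre', rem'⟩, he⟩ : ∃ s, l.foldl (clusterStep fits) ([], rem₀) = s := ⟨_, rfl⟩
    rw [he] at h
    obtain ⟨h1, h2, h3, c, h4, h5⟩ := ih he
    simp only [List.foldl_cons, List.foldl_nil, clusterStep] at h
    by_cases hR : 3 ≤ (rem'.filter (fits R)).length
    · simp only [hR, decide_true, cond_true, Prod.mk.injEq] at h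
      obtain ⟨rfl, rfl⟩ := h
      have hnd' := h1.nodup hnd
      set S := rem'.toFinset.filter fun T => fits R T = true with hS
      rw [length_filter_eq_card hnd', ← hS] at hR
      have hSmem : ∀ T ∈ S, T ∈ rem₀ ∧ fits R T = true := by
        intro T hT
        simp only [hS, Finset.mem_filter, List.mem_toFinset] at hT
        exact ⟨h1.subset hT.1, hT.2⟩
      have hset : rem₀.toFinset \ (rem'.filter fun T => !fits R T).toFinset =
          (rem₀.toFinset \ rem'.toFinset) ∪ S := by
        ext T
        have : T ∈ rem' → T ∈ rem₀ := fun h => h1.subset h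
        simp only [hS, Finset.mem_sdiff, Finset.mem_union, Finset.mem_filter, List.mem_toFinset,
          List.mem_filter]
        by_cases hf : fits R T = true <;> simp only [hf] <;> grind
      have hdis : Disjoint (rem₀.toFinset \ rem'.toFinset) S := by
        rw [Finset.disjoint_left]
        intro T hT hT'
        exact (Finset.mem_sdiff.1 hT).2 (Finset.mem_filter.1 hT').1
      obtain ⟨T₀, hT₀⟩ := Finset.card_pos.1 (show 0 < S.card by omega)
      refine ⟨List.filter_sublist.trans h1, ?_, ?_,
        fun T => if T ∈ S then T.length - R.length else c T, ?_, ?_⟩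
      · intro R' hR'
        rcases List.mem_cons.1 hR' with rfl | hR'
        · exact ⟨by simp, T₀, hSmem T₀ hT₀⟩
        · exact ⟨List.mem_append_left _ (h2 R' hR').1, (h2 R' hR').2⟩
      · intro R' hR'
        rcases List.mem_append.1 hR' with hR' | hR'
        · exact (List.Sublist.length_le (List.filter_sublist.filter _)).trans (h3 R' hR')
        · rw [List.mem_singleton.1 hR', List.filter_filter]
          simp
      · intro T hT
        rw [hset, Finset.mem_union] at hT
        by_cases hTS : T ∈ S
        · exact ⟨R, by simp, (hSmem T hTS).2, by simp [hTS]⟩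
        · obtain ⟨R', hR', h6, h7⟩ := h4 T (hT.resolve_right hTS)
          exact ⟨R', List.mem_cons_of_mem _ hR', h6, by simp [hTS, h7]⟩
      · have h6 := hB R S hR hSmem
        rw [hset, Finset.sum_union hdis, Finset.card_union_of_disjoint hdis]
        have h7 : ∑ T ∈ S, (if T ∈ S then T.length - R.length else c T) =
            ∑ T ∈ S, (T.length - R.length) := Finset.sum_congr rfl fun T hT => by simp [hT]
        have h8 : ∑ T ∈ rem₀.toFinset \ rem'.toFinset, (if T ∈ S then T.length - R.length else c T)
            = ∑ T ∈ rem₀.toFinset \ rem'.toFinset, c T := Finset.sum_congr rfl fun T hT => by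
          simp [Finset.disjoint_left.1 hdis hT]
        rw [h7, h8, List.map_cons, List.sum_cons]
        nlinarith
    · simp only [hR, decide_false, cond_false, Prod.mk.injEq] at h
      obtain ⟨rfl, rfl⟩ := h
      refine ⟨h1, fun R' hR' => ⟨List.mem_append_left _ (h2 R' hR').1, (h2 R' hR').2⟩, ?_,
        c, h4, h5⟩
      intro R' hR'
      rcases List.mem_append.1 hR' with hR' | hR'
      · exact h3 R' hR'
      · rw [List.mem_singleton.1 hR']
        omega

/-- The properties of the result of `cluster`. -/
structure ClusterSpec (fits : List ℕ → List ℕ → Bool) (w : List (List ℕ)) (B : ℕ)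
    (pre rem : List (List ℕ)) (c : List ℕ → ℕ) : Prop where
  sublist : rem.Sublist (unfit fits w)
  mem_pre : ∀ R ∈ pre, R ∈ tripleInters (unfit fits w) ∧ ∃ T ∈ w, fits R T = true
  card_le : ∀ R ∈ tripleInters (unfit fits w), (rem.toFinset.filter fun T => fits R T).card ≤ 2
  cost : ∀ T ∈ (unfit fits w).toFinset \ rem.toFinset,
    ∃ R ∈ pre, fits R T = true ∧ c T = T.length - R.length
  sum_le : 3 * ((pre.map fun R => R.length - 1).sum +
    ∑ T ∈ (unfit fits w).toFinset \ rem.toFinset, c T) ≤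
      B * ((unfit fits w).toFinset \ rem.toFinset).card

theorem cluster_spec {fits : List ℕ → List ℕ → Bool} {w : List (List ℕ)} (hnd : w.Nodup) {B : ℕ}
    (hB : ∀ (R : List ℕ) (S : Finset (List ℕ)), 3 ≤ S.card → (∀ T ∈ S, T ∈ w ∧ fits R T = true) →
      3 * ((R.length - 1) + ∑ T ∈ S, (T.length - R.length)) ≤ B * S.card) :
    ∃ c, ClusterSpec fits w B (cluster fits w).1 (cluster fits w).2 c := by
  have hnd' : (unfit fits w).Nodup := hnd.filter _
  obtain ⟨h1, h2, h3, c, h4, h5⟩ := clusterStep_foldl_spec hnd' (B := B)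
    (fun R S hS h => hB R S hS fun T hT => ⟨(mem_unfit.1 (h T hT).1).1, (h T hT).2⟩)
    (tripleInters (unfit fits w)) (pre := (cluster fits w).1) (rem := (cluster fits w).2) rfl
  refine ⟨c, h1, fun R hR => ⟨(h2 R hR).1, ?_⟩, fun R hR => ?_, h4, h5⟩
  · obtain ⟨T, hT, h⟩ := (h2 R hR).2
    exact ⟨T, (mem_unfit.1 hT).1, h⟩
  · rw [← length_filter_eq_card (h1.nodup hnd')]
    exact h3 R hR

/-- At most two of the remaining trees of a cluster computation have a common subset that they
fit. -/
theorem ClusterSpec.card_le_two {fits : List ℕ → List ℕ → Bool} {w : List (List ℕ)} {B : ℕ}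
    {pre rem : List (List ℕ)} {c : List ℕ → ℕ} (h : ClusterSpec fits w B pre rem c)
    {G : Finset (List ℕ)} (hG : ∀ T ∈ G, T ∈ rem)
    (hfit : ∀ T₁ ∈ G, ∀ T₂ ∈ G, ∀ T₃ ∈ G, T₁ ≠ T₂ → T₁ ≠ T₃ → T₂ ≠ T₃ →
      ∀ T ∈ ({T₁, T₂, T₃} : Finset (List ℕ)), fits (inter (inter T₁ T₂) T₃) T = true) :
    G.card ≤ 2 := by
  by_contra! hc
  obtain ⟨T₁, T₂, T₃, h1, h2, h3, h12, h13, h23⟩ := Finset.two_lt_card_iff.1 hc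
  have hmem := fun T (hT : T ∈ G) => h.sublist.subset (hG T hT)
  have h4 := h.card_le _ (mem_tripleInters.2 ⟨T₁, hmem _ h1, T₂, hmem _ h2, T₃, hmem _ h3, rfl⟩)
  have h5 : ({T₁, T₂, T₃} : Finset (List ℕ)) ⊆
      rem.toFinset.filter fun T => fits (inter (inter T₁ T₂) T₃) T := by
    intro T hT
    refine Finset.mem_filter.2 ⟨List.mem_toFinset.2 (hG T ?_),
      hfit T₁ h1 T₂ h2 T₃ h3 h12 h13 h23 T hT⟩
    simp only [Finset.mem_insert, Finset.mem_singleton] at hT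
    rcases hT with rfl | rfl | rfl <;> assumption
  have h6 := Finset.card_le_card h5
  rw [Finset.card_eq_three.2 ⟨T₁, T₂, T₃, h12, h13, h23, rfl⟩] at h6
  omega

/-! ### Buying pairs -/

theorem buy_concat (θ : ℕ) (test : List (List ℕ) → List ℕ → List ℕ → Bool)
    (trees P Q : List (List ℕ)) (q : List ℕ) :
    buy θ test trees (P ++ [q]) Q = buyStep θ test trees (buy θ test trees P Q) q := by
  simp [buy]

theorem buyStep_cases (θ : ℕ) (test : List (List ℕ) → List ℕ → List ℕ → Bool)
    {trees : List (List ℕ)} (hnd : trees.Nodup) (Q : List (List ℕ)) (q : List ℕ) :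
    (buyStep θ test trees Q q = q :: Q ∧ (∀ r ∈ Q, ¬ sub r q) ∧
      θ ≤ (trees.toFinset.filter fun T => test Q q T).card) ∨
    (buyStep θ test trees Q q = Q ∧ ((∃ r ∈ Q, sub r q) ∨
      (trees.toFinset.filter fun T => test Q q T).card < θ)) := by
  unfold buyStep
  rw [length_filter_eq_card hnd]
  by_cases h1 : ∃ r ∈ Q, sub r q
  · refine Or.inr ⟨?_, Or.inl h1⟩
    have : (Q.any fun r => sub r q) = true := List.any_eq_true.2 h1
    simp [this]
  · have : (Q.any fun r => sub r q) = false := Bool.eq_false_iff.2 (mt List.any_eq_true.1 h1)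
    rw [this]
    push Not at h1
    by_cases h2 : θ ≤ (trees.toFinset.filter fun T => test Q q T).card
    · exact Or.inl ⟨by simp [h2], h1, h2⟩
    · exact Or.inr ⟨by simp [h2], Or.inr (by omega)⟩

theorem subset_buy {θ : ℕ} {test : List (List ℕ) → List ℕ → List ℕ → Bool}
    {trees P Q : List (List ℕ)} (hnd : trees.Nodup) : Q ⊆ buy θ test trees P Q := by
  induction P using List.reverseRecOn with
  | nil => exact fun _ h => h
  | append_singleton P q ih =>
    rw [buy_concat]
    rcases buyStep_cases θ test hnd (buy θ test trees P Q) q with ⟨h, -⟩ | ⟨h, -⟩ <;> rw [h]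
    · exact fun _ h => List.mem_cons_of_mem _ (ih h)
    · exact ih

/-- Every candidate that is not bought passes the test for fewer than `θ` trees. -/
theorem card_test_buy_lt {θ : ℕ} {test : List (List ℕ) → List ℕ → List ℕ → Bool}
    {trees P Q : List (List ℕ)} (hnd : trees.Nodup)
    (hanti : ∀ Q Q' q T, Q ⊆ Q' → test Q' q T = true → test Q q T = true) :
    ∀ q ∈ P, (∀ r ∈ buy θ test trees P Q, ¬ sub r q) →
      (trees.toFinset.filter fun T => test (buy θ test trees P Q) q T).card < θ := by
  induction P using List.reverseRecOn with
  | nil => simp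
  | append_singleton P p ih =>
    intro q hq hr
    rw [buy_concat] at hr ⊢
    have hsub : buy θ test trees P Q ⊆ buyStep θ test trees (buy θ test trees P Q) p := by
      rcases buyStep_cases θ test hnd (buy θ test trees P Q) p with ⟨h, -⟩ | ⟨h, -⟩ <;> rw [h]
      · exact List.subset_cons_self _ _
      · exact fun _ h => h
    refine lt_of_le_of_lt (Finset.card_le_card (Finset.monotone_filter_right _
      fun T _ h => hanti _ _ q T hsub h)) ?_
    rcases List.mem_append.1 hq with hq | hq
    · exact ih q hq fun r h => hr r (hsub h)
    · obtain rfl := List.mem_singleton.1 hq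
      rcases buyStep_cases θ test hnd (buy θ test trees P Q) q with ⟨h, -⟩ | ⟨h, h'⟩
      · rw [h] at hr
        exact absurd (sub_iff.2 le_rfl) (hr q (by simp))
      · rw [h] at hr
        exact h'.resolve_left fun ⟨r, h1, h2⟩ => hr r h1 h2

/-- The cost of the pairs that are bought is paid by the trees that pass the tests. -/
theorem buy_induction {θ : ℕ} {test : List (List ℕ) → List ℕ → List ℕ → Bool}
    {trees P Q₀ : List (List ℕ)} (hnd : trees.Nodup) (I : List (List ℕ) → (List ℕ → ℕ) → Prop)
    (h₀ : I Q₀ fun _ => 0)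
    (hI : ∀ Q pay, ∀ q ∈ P, I Q pay → (∀ r ∈ Q, ¬ sub r q) →
      I (q :: Q) fun T => pay T + if test Q q T then 1 else 0) :
    ∃ pay, I (buy θ test trees P Q₀) pay ∧
      θ * (buy θ test trees P Q₀).length ≤ θ * Q₀.length + ∑ T ∈ trees.toFinset, pay T := by
  induction P using List.reverseRecOn with
  | nil => exact ⟨_, h₀, by simp [buy]⟩
  | append_singleton P q ih =>
    obtain ⟨pay, h1, h2⟩ := ih fun Q pay p hp => hI Q pay p (List.mem_append_left _ hp)
    rw [buy_concat]
    rcases buyStep_cases θ test hnd (buy θ test trees P Q₀) q with ⟨h, h3, h4⟩ | ⟨h, -⟩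
    · rw [h]
      refine ⟨_, hI _ pay q (by simp) h1 h3, ?_⟩
      rw [Finset.sum_add_distrib, List.length_cons, ← Finset.card_filter]
      nlinarith
    · rw [h]
      exact ⟨pay, h1, h2⟩

/-! ### Covered, complemented and captured trees -/

theorem covered_iff {Q : List (List ℕ)} {T : List ℕ} :
    covered Q T = true ↔ ∃ q ∈ Q, q.toFinset ⊆ T.toFinset := by
  simp only [covered, List.any_eq_true, sub_iff]

theorem complemented_iff {Q : List (List ℕ)} {q T : List ℕ} :
    complemented Q q T = true ↔
      ∃ r ∈ Q, r.toFinset ⊆ T.toFinset ∧ Disjoint q.toFinset r.toFinset := by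
  simp only [complemented, List.any_eq_true, Bool.and_eq_true, sub_iff, disj_iff]

theorem captured_iff {Q : List (List ℕ)} {T : List ℕ} :
    captured Q T = true ↔
      ∃ q ∈ Q, q.toFinset ⊆ T.toFinset ∧ (T.length ≤ 3 ∨ complemented Q q T = true) := by
  simp only [captured, List.any_eq_true, Bool.and_eq_true, sub_iff, Bool.or_eq_true,
    decide_eq_true_eq]

theorem covered_mono {Q Q' : List (List ℕ)} {T : List ℕ} (h : Q ⊆ Q') (hT : covered Q T = true) :
    covered Q' T = true := by
  rw [covered_iff] at *
  obtain ⟨q, hq, h'⟩ := hT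
  exact ⟨q, h hq, h'⟩

theorem complemented_mono {Q Q' : List (List ℕ)} {q T : List ℕ} (h : Q ⊆ Q')
    (hT : complemented Q q T = true) : complemented Q' q T = true := by
  rw [complemented_iff] at *
  obtain ⟨r, hr, h'⟩ := hT
  exact ⟨r, h hr, h'⟩

theorem captured_mono {Q Q' : List (List ℕ)} {T : List ℕ} (h : Q ⊆ Q')
    (hT : captured Q T = true) : captured Q' T = true := by
  rw [captured_iff] at *
  obtain ⟨q, hq, h1, h2⟩ := hT
  exact ⟨q, h hq, h1, h2.imp_right (complemented_mono h)⟩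

theorem covered_of_captured {Q : List (List ℕ)} {T : List ℕ} (h : captured Q T = true) :
    covered Q T = true := by
  obtain ⟨q, hq, h1, -⟩ := captured_iff.1 h
  exact covered_iff.2 ⟨q, hq, h1⟩

theorem covered_of_complemented {Q : List (List ℕ)} {q T : List ℕ}
    (h : complemented Q q T = true) : covered Q T = true := by
  obtain ⟨r, hr, h1, -⟩ := complemented_iff.1 h
  exact covered_iff.2 ⟨r, hr, h1⟩

theorem test₁_iff {Q : List (List ℕ)} {q T : List ℕ} :
    test₁ Q q T = true ↔ q.toFinset ⊆ T.toFinset ∧ ¬ captured Q T = true := by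
  simp [test₁, sub_iff]

theorem test₂_iff {Q₁ Q : List (List ℕ)} {q T : List ℕ} :
    test₂ Q₁ Q q T = true ↔ q.toFinset ⊆ T.toFinset ∧ (¬ covered Q T = true ∨
      (¬ captured Q T = true ∧ complemented Q₁ q T = true)) := by
  simp [test₂, sub_iff]

/-- A list of pairs that are different as sets. -/
def PairList (Q : List (List ℕ)) : Prop :=
  (∀ q ∈ Q, q.Nodup ∧ q.length = 2) ∧ (Q.map List.toFinset).Nodup

theorem PairList.card {Q : List (List ℕ)} (h : PairList Q) {q : List ℕ} (hq : q ∈ Q) :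
    q.toFinset.card = 2 := by
  rw [List.toFinset_card_of_nodup (h.1 q hq).1, (h.1 q hq).2]

/-- At most three of the pairs in a tree with four elements are in `Q` unless two of them are
disjoint. -/
theorem PairList.length_filter_le {Q : List (List ℕ)} (h : PairList Q) {T : List ℕ}
    (hT : T.Nodup) (hT' : T.length = 3 ∨ T.length = 4) (hc : ¬ captured Q T = true) :
    (Q.filter fun q => sub q T).length ≤ if T.length = 3 then 0 else 3 := by
  rcases hT' with h3 | h4
  · rw [if_pos h3]
    by_contra! hlt
    obtain ⟨q, hq⟩ := List.exists_mem_of_length_pos hlt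
    obtain ⟨hq, hqT⟩ := List.mem_filter.1 hq
    exact hc (captured_iff.2 ⟨q, hq, sub_iff.1 hqT, Or.inl h3.le⟩)
  · rw [if_neg (by omega)]
    have hcard : T.toFinset.card = 4 := by rw [List.toFinset_card_of_nodup hT, h4]
    set 𝒬 := ((Q.filter fun q => sub q T).map List.toFinset).toFinset with h𝒬
    have hlen : 𝒬.card = (Q.filter fun q => sub q T).length := by
      rw [h𝒬, List.toFinset_card_of_nodup, List.length_map]
      exact h.2.sublist (List.filter_sublist.map _)
    have hmem : ∀ S ∈ 𝒬, ∃ q ∈ Q, q.toFinset ⊆ T.toFinset ∧ q.toFinset = S := by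
      intro S hS
      simp only [h𝒬, List.mem_toFinset, List.mem_map, List.mem_filter, sub_iff] at hS
      obtain ⟨q, ⟨h1, h2⟩, h3⟩ := hS
      exact ⟨q, h1, h2, h3⟩
    have hsub : ∀ S ∈ 𝒬, S ⊆ T.toFinset ∧ S.card = 2 := by
      intro S hS
      obtain ⟨q, h1, h2, rfl⟩ := hmem S hS
      exact ⟨h2, h.card h1⟩
    -- The tree has six pairs. The members of `𝒬` and their complements are distinct pairs, because
    -- a complementary couple in `Q` would capture `T`; so `2 * 𝒬.card ≤ 6`.
    have hinj : Set.InjOn (fun S => T.toFinset \ S) (𝒬 : Set (Finset ℕ)) := by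
      intro S hS S' hS' he
      dsimp only at he
      rw [← Finset.sdiff_sdiff_eq_self (hsub S hS).1, he,
        Finset.sdiff_sdiff_eq_self (hsub S' hS').1]
    have hdis : Disjoint 𝒬 (𝒬.image fun S => T.toFinset \ S) := by
      rw [Finset.disjoint_left]
      intro S hS hS'
      obtain ⟨S', hS'', he⟩ := Finset.mem_image.1 hS'
      obtain ⟨q, h1, h2, h3⟩ := hmem S hS
      obtain ⟨r, h1', h2', h3'⟩ := hmem S' hS''
      refine hc (captured_iff.2 ⟨q, h1, h2, Or.inr (complemented_iff.2 ⟨r, h1', h2', ?_⟩)⟩)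
      rw [h3, h3', ← he]
      exact Finset.sdiff_disjoint
    have hle : 𝒬 ∪ (𝒬.image fun S => T.toFinset \ S) ⊆ T.toFinset.powersetCard 2 := by
      intro S hS
      rw [Finset.mem_powersetCard]
      rcases Finset.mem_union.1 hS with hS | hS
      · exact hsub S hS
      · obtain ⟨S', hS', rfl⟩ := Finset.mem_image.1 hS
        refine ⟨Finset.sdiff_subset, ?_⟩
        rw [Finset.card_sdiff_of_subset (hsub S' hS').1, (hsub S' hS').2, hcard]
    have := Finset.card_le_card hle
    rw [Finset.card_union_of_disjoint hdis, Finset.card_image_of_injOn hinj,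
      Finset.card_powersetCard, hcard, show Nat.choose 4 2 = 6 from rfl] at this
    omega

theorem mem_pairsOf {trees : List (List ℕ)} {q : List ℕ} :
    q ∈ pairsOf trees ↔ ∃ T ∈ trees, ∃ a ∈ T, ∃ b ∈ T, b ≠ a ∧ [a, b] = q := by
  simp only [pairsOf, List.mem_flatMap, List.mem_map, List.mem_filter, Bool.not_eq_true',
    decide_eq_false_iff_not, ne_eq]
  simp only [and_assoc]

theorem exists_mem_pairsOf {trees : List (List ℕ)} {T : List ℕ} (hT : T ∈ trees) {p : Finset ℕ}
    (hp : p.card = 2) (hpT : p ⊆ T.toFinset) : ∃ q ∈ pairsOf trees, q.toFinset = p := by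
  obtain ⟨a, b, hab, rfl⟩ := Finset.card_eq_two.1 hp
  refine ⟨[a, b], mem_pairsOf.2 ⟨T, hT, a, ?_, b, ?_, hab.symm, rfl⟩, by simp⟩
  · exact List.mem_toFinset.1 (hpT (by simp))
  · exact List.mem_toFinset.1 (hpT (by simp))

theorem PairList.cons {Q : List (List ℕ)} (h : PairList Q) {trees : List (List ℕ)} {q : List ℕ}
    (hq : q ∈ pairsOf trees) (hr : ∀ r ∈ Q, ¬ sub r q) : PairList (q :: Q) := by
  obtain ⟨T, -, a, -, b, -, hab, rfl⟩ := mem_pairsOf.1 hq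
  refine ⟨fun p hp => ?_, ?_⟩
  · rcases List.mem_cons.1 hp with rfl | hp
    · exact ⟨by simp [hab.symm], rfl⟩
    · exact h.1 p hp
  · rw [List.map_cons, List.nodup_cons]
    refine ⟨fun hmem => ?_, h.2⟩
    obtain ⟨r, hr', he⟩ := List.mem_map.1 hmem
    exact hr r hr' (sub_iff.2 he.le)

/-- The first phase: the pairs bought, and the payments of the trees. -/
theorem phase₁_spec {trees Q₀ : List (List ℕ)} (hnd : trees.Nodup)
    (ht : ∀ T ∈ trees, T.Nodup ∧ (T.length = 3 ∨ T.length = 4)) (hQ : PairList Q₀) :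
    PairList (phase₁ trees Q₀) ∧ Q₀ ⊆ phase₁ trees Q₀ ∧
    (∀ q ∈ pairsOf trees, (∀ r ∈ phase₁ trees Q₀, ¬ sub r q) →
      (trees.toFinset.filter fun T => test₁ (phase₁ trees Q₀) q T).card ≤ 4) ∧
    ∃ pay : List ℕ → ℕ,
      5 * (phase₁ trees Q₀).length ≤ 5 * Q₀.length + ∑ T ∈ trees.toFinset, pay T ∧
      ∀ T ∈ trees,
        (captured (phase₁ trees Q₀) T = true → pay T ≤ if T.length = 3 then 1 else 4) ∧
        (¬ captured (phase₁ trees Q₀) T = true → pay T ≤ if T.length = 3 then 0 else 3) ∧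
        (¬ covered (phase₁ trees Q₀) T = true → pay T = 0) := by
  have hanti : ∀ Q Q' q T, Q ⊆ Q' → test₁ Q' q T = true → test₁ Q q T = true := by
    intro Q Q' q T h hT
    rw [test₁_iff] at *
    exact ⟨hT.1, fun h' => hT.2 (captured_mono h h')⟩
  -- Invariant: an uncaptured tree has paid at most once per pair of `Q` inside it, hence at most
  -- three times, or never if it has three elements. The purchase that captures it adds one last
  -- payment.
  obtain ⟨pay, ⟨h1, h2⟩, h3⟩ := buy_induction (θ := 5) (test := test₁) (P := pairsOf trees)
    (Q₀ := Q₀) hnd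
    (fun Q pay => PairList Q ∧ ∀ T ∈ trees,
      (captured Q T = true → pay T ≤ if T.length = 3 then 1 else 4) ∧
      (¬ captured Q T = true → pay T ≤ (Q.filter fun q => sub q T).length))
    ⟨hQ, fun T _ => ⟨fun _ => Nat.zero_le _, fun _ => Nat.zero_le _⟩⟩
    (by
      intro Q pay q hq ⟨hQ, hpay⟩ hr
      refine ⟨hQ.cons hq hr, fun T hT => ?_⟩
      obtain ⟨h1, h2⟩ := hpay T hT
      have h3 := hQ.length_filter_le (ht T hT).1 (ht T hT).2
      have h4 : (test₁ Q q T = true) ↔ _ := test₁_iff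
      have h5 : captured Q T = true → captured (q :: Q) T = true :=
        captured_mono (List.subset_cons_self _ _)
      dsimp only
      by_cases hc : captured Q T = true
      · rw [if_neg fun h => (h4.1 h).2 hc]
        exact ⟨fun _ => h1 hc, fun h => absurd (h5 hc) h⟩
      · have h6 := h2 hc
        have h7 := h3 hc
        refine ⟨fun _ => ?_, fun _ => ?_⟩
        · split_ifs at h7 ⊢ <;> omega
        · by_cases hs : sub q T = true
          · rw [List.filter_cons_of_pos (p := fun q => sub q T) hs, List.length_cons]
            split_ifs <;> omega
          · rw [List.filter_cons_of_neg (p := fun q => sub q T) hs, if_neg fun h => hs (sub_iff.2 (h4.1 h).1)]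
            exact h6)
  refine ⟨h1, subset_buy hnd, fun q hq hr => ?_, pay, h3, fun T hT => ⟨(h2 T hT).1, fun hc => ?_,
    fun hc => ?_⟩⟩
  · exact Nat.le_of_lt_succ (card_test_buy_lt hnd hanti q hq hr)
  · exact ((h2 T hT).2 hc).trans (h1.length_filter_le (ht T hT).1 (ht T hT).2 hc)
  · have h4 := (h2 T hT).2 fun h => hc (covered_of_captured h)
    have h5 : (buy 5 test₁ trees (pairsOf trees) Q₀).filter (fun q => sub q T) = [] := by
      rw [List.filter_eq_nil_iff]
      intro q hq hs
      exact hc (covered_iff.2 ⟨q, hq, sub_iff.1 hs⟩)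
    rw [h5] at h4
    exact Nat.le_zero.1 h4

/-- The second phase: the pairs bought, and the payments of the trees. -/
theorem phase₂_spec {trees Q₁ : List (List ℕ)} (hnd : trees.Nodup) (hQ : PairList Q₁) :
    PairList (phase₂ trees Q₁) ∧ Q₁ ⊆ phase₂ trees Q₁ ∧
    (∀ q ∈ pairsOf trees, (∀ r ∈ phase₂ trees Q₁, ¬ sub r q) →
      (trees.toFinset.filter fun T => test₂ Q₁ (phase₂ trees Q₁) q T).card ≤ 1) ∧
    ∃ pay : List ℕ → ℕ,
      2 * (phase₂ trees Q₁).length ≤ 2 * Q₁.length + ∑ T ∈ trees.toFinset, pay T ∧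
      ∀ T, pay T ≤ 1 ∧ (pay T ≠ 0 →
        (¬ covered Q₁ T = true ∧ covered (phase₂ trees Q₁) T = true) ∨
        (covered Q₁ T = true ∧ ¬ captured Q₁ T = true ∧
          captured (phase₂ trees Q₁) T = true)) := by
  have hanti : ∀ Q Q' q T, Q ⊆ Q' → test₂ Q₁ Q' q T = true → test₂ Q₁ Q q T = true := by
    intro Q Q' q T h hT
    rw [test₂_iff] at *
    exact ⟨hT.1, hT.2.imp (mt (covered_mono h)) fun h' => ⟨mt (captured_mono h) h'.1, h'.2⟩⟩
  -- Invariant: a payment turns a tree from uncovered into covered or, if `Q₁` already covers it,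
  -- from uncaptured into captured. Either change prevents a second payment.
  obtain ⟨pay, ⟨h1, -, h2⟩, h3⟩ := buy_induction (θ := 2) (test := test₂ Q₁) (P := pairsOf trees)
    (Q₀ := Q₁) hnd
    (fun Q pay => PairList Q ∧ Q₁ ⊆ Q ∧ ∀ T, pay T ≤ 1 ∧ (pay T ≠ 0 →
      (¬ covered Q₁ T = true ∧ covered Q T = true) ∨
      (covered Q₁ T = true ∧ ¬ captured Q₁ T = true ∧ captured Q T = true)))
    ⟨hQ, fun _ h => h, fun T => ⟨Nat.zero_le _, fun h => absurd rfl h⟩⟩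
    (by
      intro Q pay q hq ⟨hQ, hsub, hpay⟩ hr
      have hsub' : Q ⊆ q :: Q := List.subset_cons_self _ _
      refine ⟨hQ.cons hq hr, List.Subset.trans hsub hsub', fun T => ?_⟩
      obtain ⟨h1, h2⟩ := hpay T
      have h3 : (test₂ Q₁ Q q T = true) ↔ _ := test₂_iff
      dsimp only
      by_cases ht : test₂ Q₁ Q q T = true
      · obtain ⟨hqT, h4⟩ := h3.1 ht
        have h0 : pay T = 0 := by
          by_contra hne
          rcases h2 hne with ⟨h5, h6⟩ | ⟨h5, h6, h7⟩
          · rcases h4 with h4 | h4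
            · exact h4 h6
            · exact h5 (covered_of_complemented h4.2)
          · rcases h4 with h4 | h4
            · exact h4 (covered_of_captured h7)
            · exact h4.1 h7
        rw [if_pos ht, h0]
        refine ⟨le_rfl, fun _ => ?_⟩
        have hcov : covered (q :: Q) T = true := covered_iff.2 ⟨q, by simp, hqT⟩
        rcases h4 with h4 | ⟨h4, h5⟩
        · exact Or.inl ⟨fun h => h4 (covered_mono hsub h), hcov⟩
        · refine Or.inr ⟨covered_of_complemented h5, fun h => h4 (captured_mono hsub h), ?_⟩
          exact captured_iff.2 ⟨q, by simp, hqT, Or.inr (complemented_mono (List.Subset.trans hsub hsub') h5)⟩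
      · rw [if_neg ht]
        refine ⟨h1, fun h => (h2 h).imp (fun h => ⟨h.1, covered_mono hsub' h.2⟩)
          fun h => ⟨h.1, h.2.1, captured_mono hsub' h.2.2⟩⟩)
  exact ⟨h1, subset_buy hnd, fun q hq hr => Nat.le_of_lt_succ
    (card_test_buy_lt hnd hanti q hq hr), pay, h3, h2⟩


/-! ### Lists of trees -/

section
variable {𝒯 : Finset (Finset ℕ)} {w : List (List ℕ)}

theorem Lists.nodup (hw : Lists w 𝒯) : w.Nodup := hw.2.1.of_map

theorem Lists.toFinset_mem (hw : Lists w 𝒯) {T : List ℕ} (hT : T ∈ w) : T.toFinset ∈ 𝒯 := by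
  rw [← hw.2.2, List.mem_toFinset]
  exact List.mem_map_of_mem hT

theorem Lists.exists_mem (hw : Lists w 𝒯) {S : Finset ℕ} (hS : S ∈ 𝒯) :
    ∃ T ∈ w, T.toFinset = S := by
  rw [← hw.2.2, List.mem_toFinset, List.mem_map] at hS
  exact hS

theorem Lists.eq_of_toFinset_eq (hw : Lists w 𝒯) {S T : List ℕ} (hS : S ∈ w) (hT : T ∈ w)
    (h : S.toFinset = T.toFinset) : S = T :=
  List.inj_on_of_nodup_map hw.2.1 hS hT h

theorem Lists.card (hw : Lists w 𝒯) {T : List ℕ} (hT : T ∈ w) : T.toFinset.card = T.length :=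
  List.toFinset_card_of_nodup (hw.1 T hT)

theorem Lists.length_le (hw : Lists w 𝒯) {T : List ℕ} (hT : T ∈ w) :
    T.length ≤ maxTreeSize 𝒯 := by
  rw [← hw.card hT]
  exact Finset.le_sup (f := Finset.card) (hw.toFinset_mem hT)

theorem Lists.valid (hw : Lists w 𝒯) (hne : ∀ T ∈ 𝒯, T.Nonempty) {T : List ℕ} (hT : T ∈ w) :
    T ≠ [] ∧ T.Nodup ∧ T.toFinset ⊆ varSet 𝒯 := by
  refine ⟨?_, hw.1 T hT, Finset.subset_biUnion_of_mem id (hw.toFinset_mem hT)⟩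
  rintro rfl
  exact Finset.not_nonempty_empty (hne _ (hw.toFinset_mem hT))

/-- This is the lower bound for the optimum: `F` contains all trees with at least two elements,
besides its auxiliary sets. -/
theorem Lists.card_add_card_le (hw : Lists w 𝒯) {F : Finset (Finset ℕ)}
    (hF : ∀ T ∈ 𝒯, 2 ≤ T.card → T ∈ F) :
    (w.toFinset.filter fun T => 2 ≤ T.length).card + (F.filter fun S => S ∉ 𝒯).card ≤ F.card := by
  rw [← Finset.card_filter_add_card_filter_not (s := F) (fun S => S ∈ 𝒯)]
  refine Nat.add_le_add_right (Finset.card_le_card_of_injOn List.toFinset (fun T hT => ?_)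
    fun S hS T hT h => ?_) _
  · rw [Finset.mem_coe, Finset.mem_filter, List.mem_toFinset] at hT
    have h := hw.toFinset_mem hT.1
    rw [← hw.card hT.1] at hT
    simp only [Finset.coe_filter, Set.mem_ofPred_eq]
    exact ⟨hF _ h hT.2, h⟩
  · rw [Finset.mem_coe, Finset.mem_filter, List.mem_toFinset] at hS hT
    exact hw.eq_of_toFinset_eq hS.1 hT.1 h

theorem isSolution_plan {op : Bool → Bool → Bool} (ha : ∀ a b c, op (op a b) c = op a (op b c))
    (hs : ∀ a b, op a b = op b a) (hw : Lists w 𝒯) (hne : ∀ T ∈ 𝒯, T.Nonempty)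
    {pre : List (List ℕ)} (hp : ∀ U ∈ pre, U ≠ [] ∧ U.Nodup ∧ U.toFinset ⊆ varSet 𝒯) :
    IsSolution op 𝒯 (toCircuit (plan (pre ++ sortLen w))) ∧
      (toCircuit (plan (pre ++ sortLen w))).size = (plan (pre ++ sortLen w)).length := by
  obtain ⟨h1, h2⟩ := plan_spec (X := varSet 𝒯) (ws := pre ++ sortLen w) fun U hU => by
    rcases List.mem_append.1 hU with hU | hU
    · exact hp U hU
    · exact hw.valid hne ((sortLen_perm w).mem_iff.1 hU)
  refine ⟨h1.isSolution ha hs fun T hT => ?_, h1.toCircuit.2.1⟩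
  obtain ⟨U, hU, rfl⟩ := hw.exists_mem hT
  exact h2 U (List.mem_append_right _ ((sortLen_perm w).mem_iff.2 hU))

/-! ### Constant operators -/

theorem treeFun_const {op : Bool → Bool → Bool} {c : Bool} (hc : ∀ a b, op a b = c)
    {T : Finset ℕ} (hT : 2 ≤ T.card) (x : ℕ → Bool) : treeFun op T x = c := by
  have key : ∀ (l : List ℕ) (b : Bool), l ≠ [] → l.foldl (fun b j => op b (x j)) b = c := by
    intro l b hl
    induction l using List.reverseRecOn with
    | nil => exact absurd rfl hl
    | append_singleton l j _ => simp [hc]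
  rw [← Finset.length_sort (· ≤ ·)] at hT
  unfold treeFun
  match T.sort (· ≤ ·), hT with
  | i :: j :: l, _ => exact key (j :: l) (x i) (by simp)

theorem constCircuit_cases (hw : Lists w 𝒯) :
    (constCircuit w = [] ∧ ∀ T ∈ 𝒯, T.card ≤ 1) ∨
    ∃ i j, i ≠ j ∧ i ∈ varSet 𝒯 ∧ j ∈ varSet 𝒯 ∧ constCircuit w = [(.input i, .input j)] ∧
      ∃ T ∈ 𝒯, 2 ≤ T.card := by
  unfold constCircuit
  cases h : w.filter fun T => decide (2 ≤ T.length) with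
  | nil =>
    refine Or.inl ⟨rfl, fun T hT => ?_⟩
    obtain ⟨U, hU, rfl⟩ := hw.exists_mem hT
    rw [List.filter_eq_nil_iff] at h
    have := h U hU
    simp only [decide_eq_true_eq] at this
    rw [hw.card hU]
    omega
  | cons T l =>
    have hT : T ∈ w.filter fun T => decide (2 ≤ T.length) := by simp [h]
    obtain ⟨hT, hlen⟩ := List.mem_filter.1 hT
    rcases T with _ | ⟨i, _ | ⟨j, m⟩⟩
    · simp at hlen
    · simp at hlen
    have hnd := hw.1 _ hT
    have hmem := hw.toFinset_mem hT
    refine Or.inr ⟨i, j, ?_, ?_, ?_, rfl, _, hmem, ?_⟩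
    · simp only [List.nodup_cons, List.mem_cons, not_or] at hnd
      exact hnd.1.1
    · exact Finset.subset_biUnion_of_mem id hmem (by simp)
    · exact Finset.subset_biUnion_of_mem id hmem (by simp)
    · rw [hw.card hT]
      simp

/-- All trees with at least two elements have the same constant function, so one gate joining two
inputs serves them all. -/
theorem isSolution_constCircuit {op : Bool → Bool → Bool} {c : Bool} (hc : ∀ a b, op a b = c)
    (hw : Lists w 𝒯) (hne : ∀ T ∈ 𝒯, T.Nonempty) : IsSolution op 𝒯 (constCircuit w) := by
  have single : ∀ (C : Circuit), C.WellFormed (varSet 𝒯) → ∀ T ∈ 𝒯, T.card ≤ 1 →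
      ∃ v, Circuit.IsVertex (varSet 𝒯) C v ∧ (C.subcircuitGraph v).IsAcyclic ∧
        ∀ x, C.value op x v = treeFun op T x := by
    intro C hC T hT hcard
    have := (hne T hT).card_pos
    obtain ⟨i, rfl⟩ := Finset.card_eq_one.1 (show T.card = 1 by omega)
    refine ⟨.input i, Finset.subset_biUnion_of_mem id hT (by simp),
      (Circuit.IsTree.input i).isAcyclic hC, fun x => ?_⟩
    rw [value_input, treeFun_singleton]
  rcases constCircuit_cases hw with ⟨h, h'⟩ | ⟨i, j, hij, hi, hj, h, -⟩
  · rw [h]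
    exact ⟨trivial, fun T hT => single [] trivial T hT (h' T hT)⟩
  · rw [h]
    have hC : Circuit.WellFormed (varSet 𝒯) [(.input i, .input j)] :=
      ⟨by simpa using hij, hi, hj, trivial⟩
    refine ⟨hC, fun T hT => ?_⟩
    by_cases hcard : T.card ≤ 1
    · exact single _ hC T hT hcard
    · have hg : Circuit.GateAt [(.input i, .input j)] 0 (.input i) (.input j) :=
        Or.inl ⟨rfl, rfl, rfl⟩
      refine ⟨.gate 0, by simp [Circuit.IsVertex], ?_, fun x => ?_⟩
      · exact (Circuit.IsTree.gate hg (.input i) (.input j)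
          (by simpa using hij)).isAcyclic hC
      · rw [treeFun_const hc (by omega)]
        simp [Circuit.value, hc]

/-- An input vertex takes both values and cannot compute a constant. -/
theorem IsSolution.size_pos {op : Bool → Bool → Bool} {c : Bool} (hc : ∀ a b, op a b = c)
    {C : Circuit} (h : IsSolution op 𝒯 C) (hT : ∃ T ∈ 𝒯, 2 ≤ T.card) : 1 ≤ C.size := by
  obtain ⟨T, hT, hcard⟩ := hT
  obtain ⟨v, hv, -, hval⟩ := h.2 T hT
  cases v with
  | input i =>
    have := hval fun _ => !c
    rw [value_input, treeFun_const hc hcard] at this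
    cases c <;> simp at this
  | gate j => exact Nat.one_le_of_lt hv

/-- Reduction of the approximation problem to a statement about families of sets. -/
theorem hasEfficientApprox_of_plan {Adm : Finset (Finset ℕ) → Prop} {ρ : Finset (Finset ℕ) → ℚ}
    {pre : List (List ℕ) → List (List ℕ)} (hpre : PT pre) (hρ : ∀ 𝒯, 0 ≤ ρ 𝒯)
    (hρ' : ∀ 𝒯, (∃ T ∈ 𝒯, 2 ≤ T.card) → 1 ≤ ρ 𝒯)
    (h : ∀ 𝒯 w, Adm 𝒯 → (∀ T ∈ 𝒯, T.Nonempty) → Lists w 𝒯 →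
      (∀ U ∈ pre w, U ≠ [] ∧ U.Nodup ∧ U.toFinset ⊆ varSet 𝒯) ∧
      ∀ F : Finset (Finset ℕ), (∀ T ∈ 𝒯, 2 ≤ T.card → T ∈ F) → Decomposable F →
        ((plan (pre w ++ sortLen w)).length : ℚ) ≤ ρ 𝒯 * F.card) :
    HasEfficientApprox Adm ρ := by
  refine hasEfficientApprox_of_PT (PT.solve hpre) fun op ha hs 𝒯 hne hadm w hw => ?_
  obtain ⟨h1, h2⟩ := h 𝒯 w hadm hne hw
  by_cases hc : isConstTable [op false false, op false true, op true false, op true true] = true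
  · obtain ⟨c, hc'⟩ : ∃ c, ∀ a b, op a b = c := by
      simp only [isConstTable, Bool.or_eq_true, decide_eq_true_eq, List.cons.injEq] at hc
      rcases hc with hc | hc
      · exact ⟨false, by simp [hc]⟩
      · exact ⟨true, by simp [hc]⟩
    simp only [solve, hc, cond_true]
    refine ⟨isSolution_constCircuit hc' hw hne, fun C' hC' => ?_⟩
    rcases constCircuit_cases hw with ⟨h, -⟩ | ⟨i, j, -, -, -, h, hT⟩
    · rw [h]
      simpa [Circuit.size] using mul_nonneg (hρ 𝒯) (Nat.cast_nonneg _)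
    · rw [h]
      have h3 : (1 : ℚ) ≤ C'.size := by exact_mod_cast hC'.size_pos hc' hT
      have h4 := hρ' 𝒯 hT
      simp only [Circuit.size, List.length_singleton, Nat.cast_one] at h3 ⊢
      nlinarith
  · simp only [solve, hc, cond_false]
    obtain ⟨h3, h4⟩ := isSolution_plan ha hs hw hne h1
    refine ⟨h3, fun C' hC' => ?_⟩
    obtain ⟨F, hF, h5, h6⟩ := hC'.exists_family ha hs (exists_op_ne_of_not_const hs hc)
    rw [h4]
    refine (h2 F h5 h6).trans (mul_le_mul_of_nonneg_left ?_ (hρ 𝒯))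
    exact_mod_cast hF

/-! ### Trees of arbitrary size -/

theorem fitsHalf_iff {R T : List ℕ} : fitsHalf R T = true ↔
    R.toFinset ⊆ T.toFinset ∧ R.length < T.length ∧ T.length ≤ 2 * R.length := by
  simp [fitsHalf, sub_iff, two_mul]

theorem fitsFour_iff {R T : List ℕ} : fitsFour R T = true ↔
    R.toFinset ⊆ T.toFinset ∧ R.length = 3 ∧ T.length = 4 := by
  simp [fitsFour, sub_iff]

theorem Lists.valid_of_mem_tripleInters (hw : Lists w 𝒯) {w' : List (List ℕ)} (hw' : w' ⊆ w)
    {R : List ℕ} (hR : R ∈ tripleInters w') : R.Nodup ∧ R.toFinset ⊆ varSet 𝒯 := by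
  obtain ⟨A, hA, B, -, D, -, rfl⟩ := mem_tripleInters.1 hR
  refine ⟨((hw.1 A (hw' hA)).filter _).filter _, ?_⟩
  rw [toFinset_inter, toFinset_inter]
  exact (Finset.inter_subset_left.trans Finset.inter_subset_left).trans
    (Finset.subset_biUnion_of_mem id (hw.toFinset_mem (hw' hA)))

theorem unfit_subset (fits : List ℕ → List ℕ → Bool) (w : List (List ℕ)) : unfit fits w ⊆ w :=
  List.filter_subset_self _

/-- In units of a third of a gate, every tree with at least two elements and every auxiliary set of
`F` has the budget `2k`; an auxiliary set spends it as `k` for each of at most two expensive trees.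
-/
theorem preHalf_spec (hne : ∀ T ∈ 𝒯, T.Nonempty) (hw : Lists w 𝒯) :
    (∀ U ∈ preHalf w, U ≠ [] ∧ U.Nodup ∧ U.toFinset ⊆ varSet 𝒯) ∧
    ∀ F : Finset (Finset ℕ), (∀ T ∈ 𝒯, 2 ≤ T.card → T ∈ F) → Decomposable F →
      3 * (plan (preHalf w ++ sortLen w)).length ≤ 2 * maxTreeSize 𝒯 * F.card := by
  classical
  set k := maxTreeSize 𝒯 with hk
  obtain ⟨cl, hcl⟩ := cluster_spec (fits := fitsHalf) hw.nodup (B := 2 * k) fun R S hS h => by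
    -- This is `3|T| - 2|R| ≤ 2|T|`, from `|T| ≤ 2|R|`. The surplus `|R|` of each of at least three
    -- trees pays three times the cost of `R`.
    have h1 : ∀ T ∈ S, R.length + 3 * (T.length - R.length) ≤ 2 * k := by
      intro T hT
      obtain ⟨hT, hf⟩ := h T hT
      have := hw.length_le hT
      have := fitsHalf_iff.1 hf
      omega
    have h2 := Finset.sum_le_card_nsmul S _ _ h1
    rw [Finset.sum_add_distrib, ← Finset.mul_sum, Finset.sum_const, smul_eq_mul, smul_eq_mul] at h2
    have h3 : 3 * (R.length - 1) ≤ S.card * R.length := by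
      have : 3 * R.length ≤ S.card * R.length := Nat.mul_le_mul_right _ hS
      omega
    nlinarith
  have hpre : ∀ U ∈ preHalf w, U ≠ [] ∧ U.Nodup ∧ U.toFinset ⊆ varSet 𝒯 := by
    intro U hU
    obtain ⟨h1, T, hT, hf⟩ := hcl.mem_pre U hU
    refine ⟨?_, hw.valid_of_mem_tripleInters (unfit_subset _ _) h1⟩
    rintro rfl
    obtain ⟨-, h2, h3⟩ := fitsHalf_iff.1 hf
    simp only [List.length_nil] at h2 h3
    omega
  refine ⟨hpre, fun F hF hdec => ?_⟩
  set rem := (cluster fitsHalf w).2 with hrem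
  have hremU : ∀ {T}, T ∈ rem → T ∈ unfit fitsHalf w := fun hT => hcl.sublist.subset hT
  -- Left-over trees start from one variable and clustered trees from their chosen set. A tree that
  -- fits a tree `S` starts from `S`, where `|T| - |S| ≤ |T| / 2`.
  let c : List ℕ → ℕ := fun T =>
    if T ∈ unfit fitsHalf w then (if T ∈ rem then T.length - 1 else cl T) else T.length / 2
  have hlen := length_plan_sortLen_le hpre (fun U hU => hw.valid hne hU) c fun T hT => by
    have hcard := hw.card hT
    by_cases h1 : T ∈ unfit fitsHalf w
    · by_cases h2 : T ∈ rem
      · obtain ⟨i, l, rfl⟩ := List.exists_cons_of_ne_nil (hw.valid hne hT).1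
        refine Or.inl ⟨{i}, Or.inl rfl, by simp, ?_⟩
        rw [hcard]
        simp only [c, h1, h2, if_true, Finset.card_singleton, List.length_cons]
        omega
      · obtain ⟨R, hR, hf, he⟩ := hcl.cost T (by simp [h1, h2])
        refine Or.inl ⟨R.toFinset, Or.inr ⟨R, List.mem_append_left _ hR, rfl⟩,
          (fitsHalf_iff.1 hf).1, ?_⟩
        rw [List.toFinset_card_of_nodup (hpre R hR).2.1, hcard]
        simp only [c, h1, h2, if_true, if_false, he]
        omega
    · simp only [mem_unfit, not_and, not_forall, not_not] at h1
      obtain ⟨S, hS, hf⟩ := h1 hT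
      have h1' : T ∉ unfit fitsHalf w := fun h => (mem_unfit.1 h).2 S hS hf
      obtain ⟨h2, h3, h4⟩ := fitsHalf_iff.1 hf
      refine Or.inl ⟨S.toFinset, Or.inr ⟨S, List.mem_append_right _ ?_, rfl⟩, h2, ?_⟩
      · simpa using ⟨hS, h3⟩
      · rw [hw.card hS, hcard]
        simp only [c, h1', if_false]
        omega
  -- the trees that are obtained from scratch at a high cost
  let E := rem.toFinset.filter fun T => 2 * k < 3 * (T.length - 1)
  let aux := F.filter fun S => S ∉ 𝒯
  -- The larger part of the decomposition of `T` has at least half its size. It is not a tree of the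
  -- instance, because `T` would fit it.
  have hE : ∀ T ∈ E, ∃ A ∈ aux, A ⊆ T.toFinset ∧ A.card < T.length ∧ T.length ≤ 2 * A.card := by
    intro T hT
    obtain ⟨hT, hlt⟩ := Finset.mem_filter.1 hT
    rw [List.mem_toFinset] at hT
    have hTU := mem_unfit.1 (hremU hT)
    have hTk := hw.length_le hTU.1
    have hcard := hw.card hTU.1
    obtain ⟨A, B, hAB, hd, hA, hB, hA', hB'⟩ := hdec _ (hF _ (hw.toFinset_mem hTU.1) (by omega))
    rw [hAB, Finset.card_union_of_disjoint hd] at hcard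
    have hA0 := hA.card_pos
    have hB0 := hB.card_pos
    have key : ∀ D : Finset ℕ, D ⊆ T.toFinset → D ∈ F ∨ D.card = 1 → D.card < T.length →
        T.length ≤ 2 * D.card →
        ∃ A ∈ aux, A ⊆ T.toFinset ∧ A.card < T.length ∧ T.length ≤ 2 * A.card := by
      intro D hDT hD h1 h2
      rcases hD with hD | hD
      · refine ⟨D, Finset.mem_filter.2 ⟨hD, fun hD𝒯 => ?_⟩, hDT, h1, h2⟩
        obtain ⟨S, hS, rfl⟩ := hw.exists_mem hD𝒯
        rw [hw.card hS] at h1 h2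
        exact hTU.2 S hS (fitsHalf_iff.2 ⟨hDT, h1, h2⟩)
      -- A one-element part would force `|T| = 2`, and then `T` is too cheap to belong to `E`.
      · omega
    rcases le_total A.card B.card with h | h
    · exact key B (hAB ▸ Finset.subset_union_right) hB' (by omega) (by omega)
    · exact key A (hAB ▸ Finset.subset_union_left) hA' (by omega) (by omega)
  choose! f hf using hE
  -- Three trees charging the same `A` would all fit their common intersection, which contains `A`;
  -- the clustering leaves no such three trees.
  have hEcard : E.card ≤ 2 * aux.card := by
    refine Finset.card_le_mul_card_image_of_maps_to (f := f) (fun T hT => (hf T hT).1) 2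
      fun A hA => ?_
    refine hcl.card_le_two (fun T hT => List.mem_toFinset.1
      (Finset.mem_filter.1 (show T ∈ E from (Finset.mem_filter.1 hT).1)).1) ?_
    have hG : ∀ T ∈ E.filter (fun T => f T = A), T ∈ w ∧ (∀ S ∈ w, ¬ fitsHalf S T = true) ∧
        A ⊆ T.toFinset ∧ A.card < T.length ∧ T.length ≤ 2 * A.card := by
      intro T hT
      obtain ⟨hTE, hfT⟩ := Finset.mem_filter.1 hT
      have h1 := mem_unfit.1 (hremU (List.mem_toFinset.1 (Finset.mem_filter.1 hTE).1))
      exact ⟨h1.1, h1.2, hfT ▸ (hf T hTE).2⟩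
    intro T₁ h₁ T₂ h₂ T₃ h₃ h12 h13 h23 T hT
    have hAI : A ⊆ (inter (inter T₁ T₂) T₃).toFinset := by
      rw [toFinset_inter, toFinset_inter]
      exact Finset.subset_inter (Finset.subset_inter (hG T₁ h₁).2.2.1 (hG T₂ h₂).2.2.1)
        (hG T₃ h₃).2.2.1
    have hInd : (inter (inter T₁ T₂) T₃).Nodup := ((hw.1 T₁ (hG T₁ h₁).1).filter _).filter _
    have hIcard := Finset.card_le_card hAI
    rw [List.toFinset_card_of_nodup hInd] at hIcard
    have hIT : ∀ T ∈ ({T₁, T₂, T₃} : Finset (List ℕ)),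
        (inter (inter T₁ T₂) T₃).toFinset ⊆ T.toFinset := by
      intro T hT
      rw [toFinset_inter, toFinset_inter]
      simp only [Finset.mem_insert, Finset.mem_singleton] at hT
      rcases hT with rfl | rfl | rfl
      · exact Finset.inter_subset_left.trans Finset.inter_subset_left
      · exact Finset.inter_subset_left.trans Finset.inter_subset_right
      · exact Finset.inter_subset_right
    have hTG : T ∈ E.filter fun T => f T = A := by
      simp only [Finset.mem_insert, Finset.mem_singleton] at hT
      rcases hT with rfl | rfl | rfl <;> assumption
    obtain ⟨hTw, hTu, -, -, hTA⟩ := hG T hTG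
    refine fitsHalf_iff.2 ⟨hIT T hT, ?_, by omega⟩
    -- If the intersection were all of `T`, another of the three trees would contain `T` and fit it,
    -- since its size is at most `2|A| ≤ 2|T|`.
    by_contra! hle
    rw [← hw.card hTw, ← List.toFinset_card_of_nodup hInd] at hle
    have heq := Finset.eq_of_subset_of_card_le (hIT T hT) hle
    obtain ⟨T', hT', hne'⟩ : ∃ T' ∈ ({T₁, T₂, T₃} : Finset (List ℕ)), T' ≠ T := by
      by_cases h : T₁ = T
      · exact ⟨T₂, by simp, fun h' => h12 (h.trans h'.symm)⟩
      · exact ⟨T₁, by simp, h⟩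
    have hTG' : T' ∈ E.filter fun T => f T = A := by
      simp only [Finset.mem_insert, Finset.mem_singleton] at hT'
      rcases hT' with rfl | rfl | rfl <;> assumption
    obtain ⟨hTw', hTu', hA', -, hTA'⟩ := hG T' hTG'
    have hsub : T.toFinset ⊆ T'.toFinset := heq ▸ hIT T' hT'
    have hlt := Finset.card_lt_card (hsub.ssubset_of_ne fun h =>
      hne' (hw.eq_of_toFinset_eq hTw' hTw h.symm))
    rw [hw.card hTw, hw.card hTw'] at hlt
    have h5 := Finset.card_le_card ((hG T hTG).2.2.1)
    rw [hw.card hTw] at h5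
    exact hTu' T hTw (fitsHalf_iff.2 ⟨hsub, hlt, by omega⟩)
  -- summation
  have hsum : (w.map c).sum = ∑ T ∈ w.toFinset, c T := (List.sum_toFinset c hw.nodup).symm
  have hW2 := hw.card_add_card_le hF
  set W := w.toFinset with hW
  set U := (unfit fitsHalf w).toFinset with hU
  have hUW : U ⊆ W := fun T hT => List.mem_toFinset.2 (unfit_subset _ _ (List.mem_toFinset.1 hT))
  have hRU : rem.toFinset ⊆ U := fun T hT => List.mem_toFinset.2 (hremU (List.mem_toFinset.1 hT))
  have s1 : ∑ T ∈ W, c T = ∑ T ∈ W \ U, c T + (∑ T ∈ U \ rem.toFinset, c T +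
      ∑ T ∈ rem.toFinset, c T) := by
    rw [Finset.sum_sdiff hRU, Finset.sum_sdiff hUW]
  have s2 : ∑ T ∈ U \ rem.toFinset, c T = ∑ T ∈ U \ rem.toFinset, cl T := by
    refine Finset.sum_congr rfl fun T hT => ?_
    simp only [hU, Finset.mem_sdiff, List.mem_toFinset] at hT
    simp [c, hT.1, hT.2]
  have s3 : ∑ T ∈ W \ U, 3 * c T ≤ (W \ U).card * (2 * k) := by
    refine (Finset.sum_le_card_nsmul _ _ (2 * k) fun T hT => ?_).trans (by rw [smul_eq_mul])
    simp only [hU, hW, Finset.mem_sdiff, List.mem_toFinset] at hT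
    have := hw.length_le hT.1
    simp only [c, hT.2, if_false]
    omega
  let R2 := rem.toFinset.filter fun T => 2 ≤ T.length
  -- Starting from scratch costs fewer than `k` gates, so `k` units beyond the budget `2k` always
  -- suffice.
  have s4 : ∑ T ∈ rem.toFinset, 3 * c T ≤ R2.card * (2 * k) + E.card * k := by
    have : ∀ T ∈ rem.toFinset, 3 * c T ≤
        (if 2 ≤ T.length then 2 * k else 0) + if 2 * k < 3 * (T.length - 1) then k else 0 := by
      intro T hT
      rw [List.mem_toFinset] at hT
      have h1 := hremU hT
      have := hw.length_le (mem_unfit.1 h1).1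
      simp only [c, h1, hT, if_true]
      split_ifs <;> omega
    refine (Finset.sum_le_sum this).trans ?_
    rw [Finset.sum_add_distrib, ← Finset.sum_filter, ← Finset.sum_filter, Finset.sum_const,
      Finset.sum_const, smul_eq_mul, smul_eq_mul]
  have s5 : (W \ U).card + (U \ rem.toFinset).card + R2.card ≤
      (W.filter fun T => 2 ≤ T.length).card := by
    rw [← Finset.card_union_of_disjoint, ← Finset.card_union_of_disjoint]
    · refine Finset.card_le_card fun T hT => ?_
      rw [Finset.mem_filter]
      rcases Finset.mem_union.1 hT with hT | hT
      · rcases Finset.mem_union.1 hT with hT | hT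
        · simp only [hU, hW, Finset.mem_sdiff, List.mem_toFinset, mem_unfit, not_and, not_forall,
            not_not] at hT
          obtain ⟨S, hS, hf⟩ := hT.2 hT.1
          have := fitsHalf_iff.1 hf
          exact ⟨List.mem_toFinset.2 hT.1, by omega⟩
        · obtain ⟨R, hR, hf, -⟩ := hcl.cost T hT
          have := fitsHalf_iff.1 hf
          exact ⟨hUW (Finset.mem_sdiff.1 hT).1, by omega⟩
      · obtain ⟨hT, h2⟩ := Finset.mem_filter.1 hT
        exact ⟨hUW (hRU hT), h2⟩
    · rw [Finset.disjoint_left]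
      intro T hT hT'
      have hT' := (Finset.mem_filter.1 hT').1
      rcases Finset.mem_union.1 hT with hT | hT
      · exact (Finset.mem_sdiff.1 hT).2 (hRU hT')
      · exact (Finset.mem_sdiff.1 hT).2 hT'
    · rw [Finset.disjoint_left]
      intro T hT hT'
      exact (Finset.mem_sdiff.1 hT).2 (Finset.mem_sdiff.1 hT').1
  have s6 := hcl.sum_le
  rw [← Finset.mul_sum] at s3 s4
  rw [hsum, s1, s2] at hlen
  have hpe : preHalf w = (cluster fitsHalf w).1 := rfl
  rw [hpe] at hlen ⊢
  have s7 : E.card * k ≤ 2 * aux.card * k := Nat.mul_le_mul_right _ hEcard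
  have s8 : ((W \ U).card + (U \ rem.toFinset).card + R2.card + aux.card) * (2 * k) ≤
      F.card * (2 * k) := Nat.mul_le_mul_right _ (by
        have : aux.card = (F.filter fun S => S ∉ 𝒯).card := rfl
        omega)
  nlinarith

end

/-! ### Trees with at most four elements -/

section
variable {𝒯 : Finset (Finset ℕ)} {w : List (List ℕ)}

theorem mem_buy {θ : ℕ} {test : List (List ℕ) → List ℕ → List ℕ → Bool}
    {trees P Q : List (List ℕ)} (hnd : trees.Nodup) {q : List ℕ} (hq : q ∈ buy θ test trees P Q) :
    q ∈ Q ∨ q ∈ P := by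
  obtain ⟨_, h, -⟩ := buy_induction (θ := θ) (test := test) (P := P) (Q₀ := Q) hnd
    (fun Q' _ => ∀ q ∈ Q', q ∈ Q ∨ q ∈ P) (fun q hq => Or.inl hq) fun Q' _ p hp h _ q hq => by
      rcases List.mem_cons.1 hq with rfl | hq
      · exact Or.inr hp
      · exact h q hq
  exact h q hq

/-- The pair `p` contains no member of `Q`. -/
def Free (Q : List (List ℕ)) (p : Finset ℕ) : Prop := ∀ r ∈ Q, ¬ r.toFinset ⊆ p

open Classical in
/-- The pairs of `P` in `T` that were not bought in the first phase. -/
noncomputable def paying₁ (P : Finset (Finset ℕ)) (Q₁ : List (List ℕ)) (T : List ℕ) :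
    Finset (Finset ℕ) :=
  P.filter fun p => Free Q₁ p ∧ p ⊆ T.toFinset ∧ ¬ captured Q₁ T = true

open Classical in
/-- The pairs of `P` in `T` that were not bought in the second phase. -/
noncomputable def paying₂ (P : Finset (Finset ℕ)) (Q₁ Q₂ : List (List ℕ)) (T : List ℕ) :
    Finset (Finset ℕ) :=
  P.filter fun p => Free Q₂ p ∧ p ⊆ T.toFinset ∧ (¬ covered Q₂ T = true ∨
    (¬ captured Q₂ T = true ∧ ∃ r ∈ Q₁, r.toFinset ⊆ T.toFinset ∧ Disjoint p r.toFinset))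

theorem mem_paying₁ {P : Finset (Finset ℕ)} {Q₁ : List (List ℕ)} {T : List ℕ} {p : Finset ℕ} :
    p ∈ paying₁ P Q₁ T ↔ p ∈ P ∧ Free Q₁ p ∧ p ⊆ T.toFinset ∧ ¬ captured Q₁ T = true := by
  classical
  simp only [paying₁, Finset.mem_filter]

theorem mem_paying₂ {P : Finset (Finset ℕ)} {Q₁ Q₂ : List (List ℕ)} {T : List ℕ} {p : Finset ℕ} :
    p ∈ paying₂ P Q₁ Q₂ T ↔ p ∈ P ∧ Free Q₂ p ∧ p ⊆ T.toFinset ∧ (¬ covered Q₂ T = true ∨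
      (¬ captured Q₂ T = true ∧ ∃ r ∈ Q₁, r.toFinset ⊆ T.toFinset ∧ Disjoint p r.toFinset)) := by
  classical
  simp only [paying₂, Finset.mem_filter]

/-- The number of gates that are used for a tree of `activeTrees`. -/
def activeCost (Q : List (List ℕ)) (T : List ℕ) : ℕ :=
  if captured Q T then 1 else if covered Q T then 2 else T.length - 1

theorem reaches_activeCost {pl Q : List (List ℕ)} (hQ : PairList Q) (hs : Q ⊆ pl) {T : List ℕ}
    (hT : T.Nodup) (hlen : T.length = 3 ∨ T.length = 4) :
    Reaches pl T.toFinset (activeCost Q T) := by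
  have hcard := List.toFinset_card_of_nodup hT
  unfold activeCost
  split_ifs with h1 h2
  · obtain ⟨q, hq, hqT, h | h⟩ := captured_iff.1 h1
    · refine Or.inl ⟨q.toFinset, Or.inr ⟨q, hs hq, rfl⟩, hqT, ?_⟩
      rw [hcard, hQ.card hq]
      omega
    · obtain ⟨r, hr, hrT, hd⟩ := complemented_iff.1 h
      rcases hlen with hlen | hlen
      · refine Or.inl ⟨q.toFinset, Or.inr ⟨q, hs hq, rfl⟩, hqT, ?_⟩
        rw [hcard, hQ.card hq]
        omega
      · refine Or.inr ⟨le_rfl, q.toFinset, r.toFinset, Or.inr ⟨q, hs hq, rfl⟩,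
          Or.inr ⟨r, hs hr, rfl⟩, hd, (Finset.eq_of_subset_of_card_le
            (Finset.union_subset hqT hrT) ?_).symm⟩
        rw [Finset.card_union_of_disjoint hd, hQ.card hq, hQ.card hr, hcard]
        omega
  · obtain ⟨q, hq, hqT⟩ := covered_iff.1 h2
    refine Or.inl ⟨q.toFinset, Or.inr ⟨q, hs hq, rfl⟩, hqT, ?_⟩
    rw [hcard, hQ.card hq]
    omega
  · obtain ⟨i, l, rfl⟩ := List.exists_cons_of_length_pos (show 0 < T.length by omega)
    refine Or.inl ⟨{i}, Or.inl rfl, by simp, ?_⟩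
    rw [hcard]
    simp only [Finset.card_singleton, List.length_cons]
    omega

/-- A tree with three elements is obtained from a pair. -/
theorem exists_pair {F : Finset (Finset ℕ)} (hdec : Decomposable F) {S : Finset ℕ} (hS : S ∈ F)
    (hcard : S.card = 3) : ∃ p ∈ F, p.card = 2 ∧ p ⊆ S := by
  obtain ⟨A, B, hAB, hd, hA, hB, hA', hB'⟩ := hdec S hS
  have h := hcard
  rw [hAB, Finset.card_union_of_disjoint hd] at h
  have hA0 := hA.card_pos
  have hB0 := hB.card_pos
  rcases Nat.lt_or_ge A.card 2 with h2 | h2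
  · exact ⟨B, hB'.resolve_right (by omega), by omega, hAB ▸ Finset.subset_union_right⟩
  · exact ⟨A, hA'.resolve_right (by omega), by omega, hAB ▸ Finset.subset_union_left⟩

/-! ### Auxiliary sets that contribute to a tree -/

section
variable {F P R : Finset (Finset ℕ)} {Q₁ Q₂ : List (List ℕ)} {T : List ℕ}

theorem free_of_not_bought {Q : List (List ℕ)} (hQ : PairList Q) {p : Finset ℕ} (hp : p.card = 2)
    (h : ¬ ∃ r ∈ Q, r.toFinset = p) : Free Q p := fun r hr hrp =>
  h ⟨r, hr, Finset.eq_of_subset_of_card_le hrp (by rw [hp, hQ.card hr])⟩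

theorem mem_paying₁_of_not_bought (hQ : PairList Q₁) (hc : ¬ captured Q₁ T = true) {p : Finset ℕ}
    (hp : p.card = 2) (hpP : p ∈ P) (hpT : p ⊆ T.toFinset) (h : ¬ ∃ r ∈ Q₁, r.toFinset = p) :
    p ∈ paying₁ P Q₁ T :=
  mem_paying₁.2 ⟨hpP, free_of_not_bought hQ hp h, hpT, hc⟩

theorem mem_paying₂_of_not_covered (hQ : PairList Q₂) (hc : ¬ covered Q₂ T = true) {p : Finset ℕ}
    (hp : p.card = 2) (hpP : p ∈ P) (hpT : p ⊆ T.toFinset) : p ∈ paying₂ P Q₁ Q₂ T :=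
  mem_paying₂.2 ⟨hpP, free_of_not_bought hQ hp fun ⟨r, hr, he⟩ =>
    hc (covered_iff.2 ⟨r, hr, he ▸ hpT⟩), hpT, Or.inl hc⟩

/-- The pair of `F` inside `T` was not bought in the first round, since it would capture `T`; so it
contributes. -/
theorem paying_of_length_three (hdec : Decomposable F) (hQ₁ : PairList Q₁) (hQ₂ : PairList Q₂)
    (hP : ∀ p ∈ F, p.card = 2 → (∃ r ∈ Q₁, r.toFinset = p) ∨ p ∈ P)
    (hT : T.toFinset ∈ F) (hcard : T.toFinset.card = 3) (hlen : T.length = 3)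
    (hc : ¬ captured Q₁ T = true) :
    1 ≤ (paying₁ P Q₁ T).card ∧ (¬ covered Q₂ T = true → 1 ≤ (paying₂ P Q₁ Q₂ T).card) := by
  obtain ⟨p, hp, hp2, hpT⟩ := exists_pair hdec hT hcard
  have h1 : ¬ ∃ r ∈ Q₁, r.toFinset = p := fun ⟨r, hr, he⟩ =>
    hc (captured_iff.2 ⟨r, hr, he ▸ hpT, Or.inl hlen.le⟩)
  have hpP := (hP p hp hp2).resolve_left h1
  exact ⟨Finset.card_pos.2 ⟨p, mem_paying₁_of_not_bought hQ₁ hc hp2 hpP hpT h1⟩, fun hc₂ =>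
    Finset.card_pos.2 ⟨p, mem_paying₂_of_not_covered hQ₂ hc₂ hp2 hpP hpT⟩⟩

/-- The three alternatives are a split into two pairs neither of which is in `Q₁`, a split into two
pairs exactly one of which is in `Q₁`, and a split into a triple and a single element. -/
theorem paying_of_length_four (hdec : Decomposable F) (hQ₁ : PairList Q₁) (hQ₂ : PairList Q₂)
    (hP : ∀ p ∈ F, p.card = 2 → (∃ r ∈ Q₁, r.toFinset = p) ∨ p ∈ P) (hsub : Q₁ ⊆ Q₂)
    (hR : ∀ S ∈ F, S.card = 3 → S ⊆ T.toFinset → S ∈ R)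
    (hT : T.toFinset ∈ F) (hcard : T.toFinset.card = 4) (hc : ¬ captured Q₁ T = true) :
    (2 ≤ (paying₁ P Q₁ T).card ∧ (¬ covered Q₂ T = true → 2 ≤ (paying₂ P Q₁ Q₂ T).card)) ∨
    (covered Q₁ T = true ∧ 1 ≤ (paying₁ P Q₁ T).card ∧
      (¬ captured Q₂ T = true → 1 ≤ (paying₂ P Q₁ Q₂ T).card)) ∨
    (1 ≤ (R.filter fun S => S ⊆ T.toFinset).card ∧
      (¬ covered Q₂ T = true → 1 ≤ (paying₂ P Q₁ Q₂ T).card)) := by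
  obtain ⟨A, B, hAB, hd, hA, hB, hA', hB'⟩ := hdec _ hT
  have hAT : A ⊆ T.toFinset := hAB ▸ Finset.subset_union_left
  have hBT : B ⊆ T.toFinset := hAB ▸ Finset.subset_union_right
  have hcard' := hcard
  rw [hAB, Finset.card_union_of_disjoint hd] at hcard'
  have hA0 := hA.card_pos
  have hB0 := hB.card_pos
  have triple : ∀ S ∈ F, S.card = 3 → S ⊆ T.toFinset →
      1 ≤ (R.filter fun S => S ⊆ T.toFinset).card ∧
        (¬ covered Q₂ T = true → 1 ≤ (paying₂ P Q₁ Q₂ T).card) := by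
    intro S hS h3 hST
    refine ⟨Finset.card_pos.2 ⟨S, Finset.mem_filter.2 ⟨hR S hS h3 hST, hST⟩⟩, fun hc₂ => ?_⟩
    obtain ⟨p, hp, hp2, hpS⟩ := exists_pair hdec hS h3
    have hpP := (hP p hp hp2).resolve_left fun ⟨r, hr, he⟩ =>
      hc₂ (covered_iff.2 ⟨r, hsub hr, he ▸ hpS.trans hST⟩)
    exact Finset.card_pos.2 ⟨p, mem_paying₂_of_not_covered hQ₂ hc₂ hp2 hpP (hpS.trans hST)⟩
  -- With `A` in `Q₁`, the complementary pair `B` is not in `Q₁`, nor in `Q₂` while `T` is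
  -- uncaptured. In the second round it qualifies because it is complementary to a pair of `Q₁`.
  have half : ∀ A B : Finset ℕ, Disjoint A B → A ⊆ T.toFinset → B ⊆ T.toFinset → B ∈ F →
      B.card = 2 → (∃ r ∈ Q₁, r.toFinset = A) →
      covered Q₁ T = true ∧ 1 ≤ (paying₁ P Q₁ T).card ∧
        (¬ captured Q₂ T = true → 1 ≤ (paying₂ P Q₁ Q₂ T).card) := by
    intro A B hd hAT hBT hBF hB2 ⟨r, hr, hrA⟩
    subst hrA
    have h1 : ∀ Q, Q₁ ⊆ Q → ¬ captured Q T = true → ¬ ∃ s ∈ Q, s.toFinset = B :=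
      fun Q h hc ⟨s, hs, he⟩ => hc (captured_iff.2 ⟨r, h hr, hAT,
        Or.inr (complemented_iff.2 ⟨s, hs, he ▸ hBT, he ▸ hd⟩)⟩)
    have h2 := h1 Q₁ (fun _ h => h) hc
    have hBP := (hP B hBF hB2).resolve_left h2
    exact ⟨covered_iff.2 ⟨r, hr, hAT⟩,
      Finset.card_pos.2 ⟨B, mem_paying₁_of_not_bought hQ₁ hc hB2 hBP hBT h2⟩, fun hc₂ =>
      Finset.card_pos.2 ⟨B, mem_paying₂.2 ⟨hBP, free_of_not_bought hQ₂ hB2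
        (h1 Q₂ hsub hc₂), hBT, Or.inr ⟨hc₂, r, hr, hAT, hd.symm⟩⟩⟩⟩
  rcases (by omega : A.card = 3 ∨ B.card = 3 ∨ (A.card = 2 ∧ B.card = 2)) with h | h | ⟨h2, h2'⟩
  · exact Or.inr (Or.inr (triple A (hA'.resolve_right (by omega)) h hAT))
  · exact Or.inr (Or.inr (triple B (hB'.resolve_right (by omega)) h hBT))
  · have hAF := hA'.resolve_right (by omega)
    have hBF := hB'.resolve_right (by omega)
    by_cases hA₁ : ∃ r ∈ Q₁, r.toFinset = A
    · exact Or.inr (Or.inl (half A B hd hAT hBT hBF h2' hA₁))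
    by_cases hB₁ : ∃ r ∈ Q₁, r.toFinset = B
    · exact Or.inr (Or.inl (half B A hd.symm hBT hAT hAF h2 hB₁))
    have hne : A ≠ B := fun h => hA.ne_empty (Finset.disjoint_self_iff_empty A |>.1 (by rwa [← h] at hd))
    have hAP := (hP A hAF h2).resolve_left hA₁
    have hBP := (hP B hBF h2').resolve_left hB₁
    refine Or.inl ⟨?_, fun hc₂ => ?_⟩
    · exact Finset.one_lt_card.2 ⟨A, mem_paying₁_of_not_bought hQ₁ hc h2 hAP hAT hA₁, B,
        mem_paying₁_of_not_bought hQ₁ hc h2' hBP hBT hB₁, hne⟩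
    · exact Finset.one_lt_card.2 ⟨A, mem_paying₂_of_not_covered hQ₂ hc₂ h2 hAP hAT, B,
        mem_paying₂_of_not_covered hQ₂ hc₂ h2' hBP hBT, hne⟩

end

/-- Double counting of the incidences between `s` and `t`. -/
theorem sum_card_filter_le {α β : Type} {s : Finset α} {t : Finset β} (r : α → β → Prop)
    [∀ a b, Decidable (r a b)] {n : ℕ} (h : ∀ b ∈ t, (s.filter fun a => r a b).card ≤ n) :
    ∑ a ∈ s, (t.filter fun b => r a b).card ≤ n * t.card := by
  have := Finset.sum_card_bipartiteAbove_eq_sum_card_bipartiteBelow (s := s) (t := t) r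
  simp only [Finset.bipartiteAbove, Finset.bipartiteBelow] at this
  rw [this, mul_comm, ← smul_eq_mul]
  exact Finset.sum_le_card_nsmul _ _ _ h

/-- A pair that contributes to some tree was a candidate of the first round and was not bought, so
fewer than five uncaptured trees contain it. -/
theorem sum_card_paying₁_le {P : Finset (Finset ℕ)} {trees Q₁ : List (List ℕ)}
    (hP : ∀ p ∈ P, p.card = 2)
    (h : ∀ q ∈ pairsOf trees, (∀ r ∈ Q₁, ¬ sub r q) →
      (trees.toFinset.filter fun T => test₁ Q₁ q T).card ≤ 4) :
    ∑ T ∈ trees.toFinset, (paying₁ P Q₁ T).card ≤ 4 * P.card := by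
  classical
  refine sum_card_filter_le _ fun p hp => ?_
  by_contra! hlt
  obtain ⟨T, hT⟩ := Finset.card_pos.1 (show 0 < _ from (Nat.zero_le 4).trans_lt hlt)
  obtain ⟨hT, hfree, hpT, -⟩ := Finset.mem_filter.1 hT
  obtain ⟨q, hq, rfl⟩ := exists_mem_pairsOf (List.mem_toFinset.1 hT) (hP p hp) hpT
  refine hlt.not_ge ((Finset.card_le_card fun T hT => ?_).trans
    (h q hq fun r hr hs => hfree r hr (sub_iff.1 hs)))
  obtain ⟨hT, -, h⟩ := Finset.mem_filter.1 hT
  exact Finset.mem_filter.2 ⟨hT, test₁_iff.2 h⟩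

theorem sum_card_paying₂_le {P : Finset (Finset ℕ)} {trees Q₁ Q₂ : List (List ℕ)}
    (hP : ∀ p ∈ P, p.card = 2)
    (h : ∀ q ∈ pairsOf trees, (∀ r ∈ Q₂, ¬ sub r q) →
      (trees.toFinset.filter fun T => test₂ Q₁ Q₂ q T).card ≤ 1) :
    ∑ T ∈ trees.toFinset, (paying₂ P Q₁ Q₂ T).card ≤ P.card := by
  classical
  rw [← one_mul P.card]
  refine sum_card_filter_le _ fun p hp => ?_
  by_contra! hlt
  obtain ⟨T, hT⟩ := Finset.card_pos.1 (show 0 < _ from (Nat.zero_le 1).trans_lt hlt)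
  obtain ⟨hT, hfree, hpT, -⟩ := Finset.mem_filter.1 hT
  obtain ⟨q, hq, rfl⟩ := exists_mem_pairsOf (List.mem_toFinset.1 hT) (hP p hp) hpT
  refine hlt.not_ge ((Finset.card_le_card fun T hT => ?_).trans
    (h q hq fun r hr hs => hfree r hr (sub_iff.1 hs)))
  obtain ⟨hT, -, h⟩ := Finset.mem_filter.1 hT
  exact Finset.mem_filter.2 ⟨hT, test₂_iff.2 (by rwa [complemented_iff])⟩

theorem mem_activeTrees {T : List ℕ} :
    T ∈ activeTrees w ↔ T ∈ (cluster fitsFour w).2 ∧ 3 ≤ T.length := by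
  simp [activeTrees]

/-- The balance of a tree with three elements; here `m₁` and `m₂` bound the numbers of pairs that
pay for the tree. -/
theorem balance_of_length_three {Q₁ Q₂ : List (List ℕ)} {T : List ℕ} {pay₁ pay₂ m₁ m₂ : ℕ}
    (h3 : T.length = 3) (hsub : Q₁ ⊆ Q₂)
    (a1 : captured Q₁ T = true → pay₁ ≤ 1) (a2 : ¬ captured Q₁ T = true → pay₁ ≤ 0)
    (b1 : pay₂ ≤ 1) (b2 : captured Q₁ T = true → pay₂ = 0) (b3 : ¬ covered Q₂ T = true → pay₂ = 0)
    (h : ¬ captured Q₁ T = true → 1 ≤ m₁ ∧ (¬ covered Q₂ T = true → 1 ≤ m₂)) :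
    30 * activeCost Q₂ T + 6 * pay₁ + 15 * pay₂ ≤ 40 + 5 * m₁ + 15 * m₂ ∧
      20 * activeCost Q₂ T + 4 * pay₁ + 10 * pay₂ ≤ 38 + 7 * m₁ + 7 * m₂ := by
  have hcov : covered Q₂ T = true → captured Q₂ T = true := fun h => by
    obtain ⟨q, hq, hqT⟩ := covered_iff.1 h
    exact captured_iff.2 ⟨q, hq, hqT, Or.inl h3.le⟩
  unfold activeCost
  by_cases c1 : captured Q₁ T = true
  · have := a1 c1
    have := b2 c1
    rw [if_pos (captured_mono hsub c1)]
    omega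
  · obtain ⟨p1, p2⟩ := h c1
    have := a2 c1
    -- Both cases can be tight in the first bound: `30 + 15 = 40 + 5` if `T` is captured, and `60 =
    -- 40 + 5 + 15` if it is not.
    by_cases c2 : captured Q₂ T = true
    · rw [if_pos c2]
      omega
    · have c3 := mt hcov c2
      have := p2 c3
      have := b3 c3
      rw [if_neg c2, if_neg c3]
      omega

/-- The balance of a tree with four elements; here `m₁`, `m₂` and `m₃` bound the numbers of
auxiliary sets that pay for the tree. -/
theorem balance_of_length_four {Q₁ Q₂ : List (List ℕ)} {T : List ℕ} {pay₁ pay₂ m₁ m₂ m₃ : ℕ}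
    (h4 : T.length = 4) (hsub : Q₁ ⊆ Q₂)
    (a1 : captured Q₁ T = true → pay₁ ≤ 4) (a2 : ¬ captured Q₁ T = true → pay₁ ≤ 3)
    (a3 : ¬ covered Q₁ T = true → pay₁ = 0)
    (b1 : pay₂ ≤ 1) (b2 : captured Q₁ T = true → pay₂ = 0)
    (b3 : covered Q₁ T = true → ¬ captured Q₂ T = true → pay₂ = 0)
    (b4 : ¬ covered Q₂ T = true → pay₂ = 0)
    (h : ¬ captured Q₁ T = true → (2 ≤ m₁ ∧ (¬ covered Q₂ T = true → 2 ≤ m₂)) ∨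
      (covered Q₁ T = true ∧ 1 ≤ m₁ ∧ (¬ captured Q₂ T = true → 1 ≤ m₂)) ∨
      (1 ≤ m₃ ∧ (¬ covered Q₂ T = true → 1 ≤ m₂))) :
    20 * activeCost Q₂ T + 4 * pay₁ + 10 * pay₂ ≤ 38 + 7 * m₁ + 7 * m₂ + 19 * m₃ := by
  unfold activeCost
  by_cases c1 : captured Q₁ T = true
  · have := a1 c1
    have := b2 c1
    rw [if_pos (captured_mono hsub c1)]
    omega
  have hp3 := a2 c1
  have hpy := h c1
  by_cases c2 : captured Q₂ T = true
  · rw [if_pos c2]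
    rcases hpy with h | h | h <;> omega
  rw [if_neg c2]
  -- If `Q₁` covers `T`, the two alternatives with pairs are tight: `40 + 4·3 = 38 + 7·2`.
  by_cases d1 : covered Q₁ T = true
  · have := b3 d1 c2
    rw [if_pos (covered_mono hsub d1)]
    rcases hpy with h | ⟨-, h, h'⟩ | h
    · omega
    · have := h' c2
      omega
    · omega
  · have ha := a3 d1
    have hpy' := hpy.imp_right fun h => h.resolve_left fun h => d1 h.1
    by_cases d2 : covered Q₂ T = true
    · rw [if_pos d2]
      rcases hpy' with h | h <;> omega
    -- All three gates are needed here and nothing was paid: `60 ≤ 38 + 4·7` for two pairs and `60 ≤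
    -- 38 + 7 + 19` for a triple.
    · have := b4 d2
      rw [if_neg d2]
      rcases hpy' with ⟨h, h'⟩ | ⟨h, h'⟩ <;> have := h' d2 <;> omega

/-- A set with three elements is contained in at most two trees that remain after clustering. -/
theorem card_filter_le_two (hw : Lists w 𝒯) {B : ℕ} {pre rem : List (List ℕ)} {cl : List ℕ → ℕ}
    (hcl : ClusterSpec fitsFour w B pre rem cl) {G : Finset (List ℕ)} {S : Finset ℕ}
    (hS : S.card = 3) (hG : ∀ T ∈ G, T ∈ rem ∧ T.length = 4 ∧ S ⊆ T.toFinset) : G.card ≤ 2 := by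
  have hremw : ∀ {T}, T ∈ rem → T ∈ w := fun hT => unfit_subset _ _ (hcl.sublist.subset hT)
  refine hcl.card_le_two (fun T hT => (hG T hT).1) ?_
  intro T₁ h₁ T₂ h₂ T₃ h₃ h12 h13 h23 T hT
  obtain ⟨r1, l1, s1⟩ := hG T₁ h₁
  obtain ⟨r2, l2, s2⟩ := hG T₂ h₂
  obtain ⟨r3, l3, s3⟩ := hG T₃ h₃
  have hInd : (inter (inter T₁ T₂) T₃).Nodup := ((hw.1 T₁ (hremw r1)).filter _).filter _
  have hIle : S.card ≤ (inter (inter T₁ T₂) T₃).toFinset.card := by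
    rw [toFinset_inter, toFinset_inter]
    exact Finset.card_le_card (Finset.subset_inter (Finset.subset_inter s1 s2) s3)
  -- An intersection with four elements would equal both `T₁` and `T₂`.
  have hIlt : (inter (inter T₁ T₂) T₃).toFinset.card < 4 := by
    by_contra! h4
    rw [toFinset_inter, toFinset_inter] at h4
    have e1 := Finset.eq_of_subset_of_card_le
      (Finset.inter_subset_left.trans Finset.inter_subset_left)
      (by rw [hw.card (hremw r1), l1]; exact h4)
    have e2 := Finset.eq_of_subset_of_card_le
      (Finset.inter_subset_left.trans Finset.inter_subset_right)
      (by rw [hw.card (hremw r2), l2]; exact h4)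
    exact h12 (hw.eq_of_toFinset_eq (hremw r1) (hremw r2) (e1.symm.trans e2))
  rw [List.toFinset_card_of_nodup hInd] at hIle hIlt
  simp only [Finset.mem_insert, Finset.mem_singleton] at hT
  refine fitsFour_iff.2 ⟨?_, by omega, by rcases hT with rfl | rfl | rfl <;> assumption⟩
  rw [toFinset_inter, toFinset_inter]
  rcases hT with rfl | rfl | rfl
  · exact Finset.inter_subset_left.trans Finset.inter_subset_left
  · exact Finset.inter_subset_left.trans Finset.inter_subset_right
  · exact Finset.inter_subset_right

-- The same plan serves both ratios. Costs are counted in twentieths of a gate for the first and in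
-- thirtieths for the second, to make all shares integral.
set_option maxHeartbeats 1000000 in
theorem preSmall_spec (hk : maxTreeSize 𝒯 ≤ 4) (hne : ∀ T ∈ 𝒯, T.Nonempty) (hw : Lists w 𝒯) :
    (∀ U ∈ preSmall w, U ≠ [] ∧ U.Nodup ∧ U.toFinset ⊆ varSet 𝒯) ∧
    ∀ F : Finset (Finset ℕ), (∀ T ∈ 𝒯, 2 ≤ T.card → T ∈ F) → Decomposable F →
      20 * (plan (preSmall w ++ sortLen w)).length ≤ 38 * F.card ∧
      (maxTreeSize 𝒯 ≤ 3 → 30 * (plan (preSmall w ++ sortLen w)).length ≤ 40 * F.card) := by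
  classical
  -- A triple takes two gates and each of its `s ≥ 3` trees one more, and `3(2 + s) ≤ 5s`.
  obtain ⟨cl, hcl⟩ := cluster_spec (fits := fitsFour) hw.nodup (B := 5) fun R S hS h => by
    obtain ⟨T₀, hT₀⟩ := Finset.card_pos.1 (show 0 < S.card by omega)
    have hR := (fitsFour_iff.1 (h T₀ hT₀).2).2.1
    have h1 : ∀ T ∈ S, T.length - R.length = 1 := fun T hT => by
      have := (fitsFour_iff.1 (h T hT).2).2.2
      omega
    rw [Finset.sum_congr rfl h1, Finset.sum_const, smul_eq_mul, hR]
    omega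
  set rem := (cluster fitsFour w).2 with hrem
  set trees := activeTrees w with htrees
  set Q₀ := w.filter fun T => decide (T.length = 2) with hQ₀
  have hremU : ∀ {T}, T ∈ rem → T ∈ unfit fitsFour w := fun hT => hcl.sublist.subset hT
  have hremw : ∀ {T}, T ∈ rem → T ∈ w := fun hT => unfit_subset _ _ (hremU hT)
  have hact : ∀ {T}, T ∈ trees ↔ T ∈ rem ∧ 3 ≤ T.length := mem_activeTrees
  have hlen4 : ∀ {T}, T ∈ w → T.length ≤ 4 := fun hT => (hw.length_le hT).trans hk
  have hnd : trees.Nodup := (hcl.sublist.nodup (hw.nodup.filter _)).filter _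
  have ht : ∀ T ∈ trees, T.Nodup ∧ (T.length = 3 ∨ T.length = 4) := by
    intro T hT
    obtain ⟨h1, h2⟩ := hact.1 hT
    have := hlen4 (hremw h1)
    exact ⟨hw.1 T (hremw h1), by omega⟩
  have hQ₀' : PairList Q₀ := by
    refine ⟨fun q hq => ?_, (List.filter_sublist.map _).nodup hw.2.1⟩
    obtain ⟨h1, h2⟩ := List.mem_filter.1 hq
    exact ⟨hw.1 q h1, of_decide_eq_true h2⟩
  obtain ⟨hQ₁, hQ₀₁, hcount₁, pay₁, hpay₁, hp₁⟩ := phase₁_spec hnd ht hQ₀'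
  set Q₁ := phase₁ trees Q₀ with hQ₁e
  obtain ⟨hQ₂, hQ₁₂, hcount₂, pay₂, hpay₂, hp₂⟩ := phase₂_spec hnd hQ₁
  set Q₂ := phase₂ trees Q₁ with hQ₂e
  have hpe : preSmall w = (cluster fitsFour w).1 ++ Q₂ := rfl
  have hvalid : ∀ U ∈ preSmall w, U ≠ [] ∧ U.Nodup ∧ U.toFinset ⊆ varSet 𝒯 := by
    intro U hU
    rw [hpe] at hU
    rcases List.mem_append.1 hU with hU | hU
    · obtain ⟨h1, T, hT, hf⟩ := hcl.mem_pre U hU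
      refine ⟨?_, hw.valid_of_mem_tripleInters (unfit_subset _ _) h1⟩
      rintro rfl
      exact absurd (fitsFour_iff.1 hf).2.1 (by simp)
    · refine ⟨?_, (hQ₂.1 U hU).1, ?_⟩
      · rintro rfl
        exact absurd (hQ₂.1 _ hU).2 (by simp)
      · have hpairs : ∀ q ∈ pairsOf trees, q.toFinset ⊆ varSet 𝒯 := by
          intro q hq
          obtain ⟨T, hT, a, ha, b, hb, -, rfl⟩ := mem_pairsOf.1 hq
          refine Finset.Subset.trans ?_ (hw.valid hne (hremw (hact.1 hT).1)).2.2
          intro i hi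
          simp only [List.toFinset_cons, List.toFinset_nil, insert_empty_eq, Finset.mem_insert,
            Finset.mem_singleton] at hi
          rcases hi with rfl | rfl <;> simpa
        rcases mem_buy hnd hU with hU | hU
        · rcases mem_buy hnd hU with hU | hU
          · exact (hw.valid hne (List.mem_filter.1 hU).1).2.2
          · exact hpairs U hU
        · exact hpairs U hU
  refine ⟨hvalid, fun F hF hdec => ?_⟩
  -- the plan
  let c : List ℕ → ℕ := fun T =>
    if T ∈ trees then activeCost Q₂ T else if T ∈ rem then 0 else
      if T ∈ unfit fitsFour w then cl T else 1
  have hlen := length_plan_sortLen_le hvalid (fun U hU => hw.valid hne hU) c fun T hT => by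
    have hcard := hw.card hT
    by_cases h1 : T ∈ trees
    · simp only [c, h1, if_true]
      refine reaches_activeCost hQ₂ (fun q hq => ?_) (ht T h1).1 (ht T h1).2
      exact List.mem_append_left _ (hpe ▸ List.mem_append_right _ hq)
    by_cases h2 : T ∈ rem
    · simp only [c, h1, h2, if_true, if_false]
      have h3 : T.length < 3 := by
        by_contra! h3
        exact h1 (hact.2 ⟨h2, h3⟩)
      have h4 := (Finset.card_pos.2 (hne _ (hw.toFinset_mem hT)))
      refine Or.inl ⟨T.toFinset, ?_, le_rfl, by omega⟩
      rcases Nat.lt_or_ge T.length 2 with h5 | h5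
      · exact Or.inl (by omega)
      · refine Or.inr ⟨T, List.mem_append_left _ (hpe ▸ List.mem_append_right _ (hQ₁₂ (hQ₀₁ ?_))),
          rfl⟩
        exact List.mem_filter.2 ⟨hT, decide_eq_true (by omega)⟩
    by_cases h3 : T ∈ unfit fitsFour w
    · obtain ⟨R, hR, hf, he⟩ := hcl.cost T (by simp [h2, h3])
      refine Or.inl ⟨R.toFinset, Or.inr ⟨R, List.mem_append_left _
        (hpe ▸ List.mem_append_left _ hR), rfl⟩, (fitsFour_iff.1 hf).1, ?_⟩
      rw [List.toFinset_card_of_nodup (hvalid R (hpe ▸ List.mem_append_left _ hR)).2.1, hcard]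
      simp only [c, h1, h2, h3, if_true, if_false, he]
      omega
    · have h3' := h3
      simp only [mem_unfit, not_and, not_forall, not_not] at h3
      obtain ⟨S, hS, hf⟩ := h3 hT
      obtain ⟨h4, h5, h6⟩ := fitsFour_iff.1 hf
      refine Or.inl ⟨S.toFinset, Or.inr ⟨S, List.mem_append_right _ ?_, rfl⟩, h4, ?_⟩
      · exact List.mem_filter.2 ⟨hS, decide_eq_true (by omega)⟩
      · rw [hw.card hS, hcard]
        simp only [c, h1, h2, h3', if_false]
        omega
  -- the auxiliary sets of the solution
  let aux := F.filter fun S => S ∉ 𝒯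
  let P := aux.filter fun S => S.card = 2
  let R := aux.filter fun S => S.card = 3
  have hPR : P.card + R.card ≤ aux.card := by
    rw [← Finset.card_union_of_disjoint]
    · exact Finset.card_le_card (Finset.union_subset (Finset.filter_subset _ _)
        (Finset.filter_subset _ _))
    · rw [Finset.disjoint_left]
      intro S h h'
      have h1 := (Finset.mem_filter.1 h).2
      have h2 := (Finset.mem_filter.1 h').2
      omega
  -- A pair of `F` that is a tree belongs to `Q₀` and hence to `Q₁`.
  have hP : ∀ p ∈ F, p.card = 2 → (∃ r ∈ Q₁, r.toFinset = p) ∨ p ∈ P := by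
    intro p hp h2
    by_cases h : p ∈ 𝒯
    · obtain ⟨S, hS, rfl⟩ := hw.exists_mem h
      exact Or.inl ⟨S, hQ₀₁ (List.mem_filter.2 ⟨hS, decide_eq_true (by rw [← hw.card hS, h2])⟩),
        rfl⟩
    · exact Or.inr (Finset.mem_filter.2 ⟨Finset.mem_filter.2 ⟨hp, h⟩, h2⟩)
  have hP2 : ∀ p ∈ P, p.card = 2 := fun p hp => (Finset.mem_filter.1 hp).2
  have hRT : ∀ T ∈ trees, T.length = 4 → ∀ S ∈ F, S.card = 3 → S ⊆ T.toFinset → S ∈ R := by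
    intro T hT h4 S hS h3 hST
    refine Finset.mem_filter.2 ⟨Finset.mem_filter.2 ⟨hS, fun hS𝒯 => ?_⟩, h3⟩
    obtain ⟨U, hU, rfl⟩ := hw.exists_mem hS𝒯
    exact (mem_unfit.1 (hremU (hact.1 hT).1)).2 U hU
      (fitsFour_iff.2 ⟨hST, by rw [← hw.card hU, h3], h4⟩)
  have hTF : ∀ T ∈ trees, T.toFinset ∈ F ∧ T.toFinset.card = T.length := by
    intro T hT
    have h1 := hw.card (hremw (hact.1 hT).1)
    have h2 := (hact.1 hT).2
    exact ⟨hF _ (hw.toFinset_mem (hremw (hact.1 hT).1)) (by omega), h1⟩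
  -- the balance of a single tree
  have hbal : ∀ T ∈ trees, 20 * activeCost Q₂ T + 4 * pay₁ T + 10 * pay₂ T ≤
      38 + 7 * (paying₁ P Q₁ T).card + 7 * (paying₂ P Q₁ Q₂ T).card +
        19 * (R.filter fun S => S ⊆ T.toFinset).card ∧
      (T.length = 3 → 30 * activeCost Q₂ T + 6 * pay₁ T + 15 * pay₂ T ≤
        40 + 5 * (paying₁ P Q₁ T).card + 15 * (paying₂ P Q₁ Q₂ T).card) := by
    intro T hT
    obtain ⟨hT1, hT2⟩ := hTF T hT
    obtain ⟨a1, a2, a3⟩ := hp₁ T hT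
    obtain ⟨b1, b2⟩ := hp₂ T
    have b3 : captured Q₁ T = true → pay₂ T = 0 := fun h => by
      by_contra h'
      rcases b2 h' with h' | h'
      · exact h'.1 (covered_of_captured h)
      · exact h'.2.1 h
    have b4 : covered Q₁ T = true → ¬ captured Q₂ T = true → pay₂ T = 0 := fun h h₂ => by
      by_contra h'
      rcases b2 h' with h' | h'
      · exact h'.1 h
      · exact h₂ h'.2.2
    have b5 : ¬ covered Q₂ T = true → pay₂ T = 0 := fun h => by
      by_contra h'
      rcases b2 h' with h' | h'
      · exact h h'.2
      · exact h (covered_of_captured h'.2.2)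
    rcases (ht T hT).2 with h3 | h4
    · simp only [h3, if_true] at a1 a2
      have := balance_of_length_three h3 hQ₁₂ a1 a2 b1 b3 b5
        (paying_of_length_three hdec hQ₁ hQ₂ hP hT1 (hT2.trans h3) h3)
      exact ⟨this.2.trans (Nat.le_add_right _ _), fun _ => this.1⟩
    · rw [if_neg (by omega)] at a1 a2
      exact ⟨balance_of_length_four h4 hQ₁₂ a1 a2 a3 b1 b3 b4 b5
        (paying_of_length_four hdec hQ₁ hQ₂ hP hQ₁₂ (hRT T hT h4) hT1 (hT2.trans h4)),
        fun h3 => by omega⟩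
  -- double counting
  have hS₁ := sum_card_paying₁_le hP2 hcount₁
  have hS₂ := sum_card_paying₂_le hP2 hcount₂
  have hS₃ : ∑ T ∈ trees.toFinset, (R.filter fun S => S ⊆ T.toFinset).card ≤ 2 * R.card := by
    refine sum_card_filter_le (s := trees.toFinset) (t := R) (fun T S => S ⊆ T.toFinset) fun S hS => ?_
    obtain ⟨hS, hS3⟩ := Finset.mem_filter.1 hS
    have hG : ∀ T ∈ trees.toFinset.filter fun T => S ⊆ T.toFinset,
        T ∈ rem ∧ T.length = 4 ∧ S ⊆ T.toFinset := by
      intro T hT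
      obtain ⟨hT, hST⟩ := Finset.mem_filter.1 hT
      rw [List.mem_toFinset] at hT
      refine ⟨(hact.1 hT).1, (ht T hT).2.resolve_left fun h3 => ?_, hST⟩
      have heq := Finset.eq_of_subset_of_card_le hST (by rw [(hTF T hT).2]; omega)
      exact (Finset.mem_filter.1 hS).2 (heq ▸ hw.toFinset_mem (hremw (hact.1 hT).1))
    exact card_filter_le_two hw hcl hS3 hG
  -- summation
  have hsum : (w.map c).sum = ∑ T ∈ w.toFinset, c T := (List.sum_toFinset c hw.nodup).symm
  have hW2 := hw.card_add_card_le hF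
  set W := w.toFinset with hW
  set A := trees.toFinset with hA
  set Y := (unfit fitsFour w).toFinset \ rem.toFinset with hY
  set D := W \ (unfit fitsFour w).toFinset with hD
  set M := W.filter fun T => T.length = 2 with hM
  have hAW : A ⊆ W := fun T hT =>
    List.mem_toFinset.2 (hremw (hact.1 (List.mem_toFinset.1 hT)).1)
  have hYW : Y ⊆ W := fun T hT =>
    List.mem_toFinset.2 (unfit_subset _ _ (List.mem_toFinset.1 (Finset.mem_sdiff.1 hT).1))
  have hDW : D ⊆ W := Finset.sdiff_subset
  have hMW : M ⊆ W := Finset.filter_subset _ _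
  have hY4 : ∀ T ∈ Y, T.length = 4 := fun T hT => by
    obtain ⟨R, -, hf, -⟩ := hcl.cost T hT
    exact (fitsFour_iff.1 hf).2.2
  have hD4 : ∀ T ∈ D, T.length = 4 := fun T hT => by
    simp only [hD, hW, Finset.mem_sdiff, List.mem_toFinset, mem_unfit, not_and, not_forall,
      not_not] at hT
    obtain ⟨S, -, hf⟩ := hT.2 hT.1
    exact (fitsFour_iff.1 hf).2.2
  have s1 : ∑ T ∈ W, c T ≤ ∑ T ∈ A, activeCost Q₂ T + ∑ T ∈ Y, cl T + D.card := by
    rw [← Finset.inter_eq_right.2 hAW, ← Finset.inter_eq_right.2 hYW, Finset.card_eq_sum_ones,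
      ← Finset.inter_eq_right.2 hDW, ← Finset.sum_ite_mem, ← Finset.sum_ite_mem,
      ← Finset.sum_ite_mem, ← Finset.sum_add_distrib, ← Finset.sum_add_distrib]
    refine Finset.sum_le_sum fun T hT => ?_
    by_cases h1 : T ∈ trees
    · simp [c, h1, hA]
      omega
    by_cases h2 : T ∈ rem
    · simp [c, h1, h2]
    by_cases h3 : T ∈ unfit fitsFour w
    · simp [c, h1, h2, h3, hY]
      omega
    · have : T ∈ D := Finset.mem_sdiff.2 ⟨hT, by simpa using h3⟩
      simp [c, h1, h2, h3, this]
  have s2 : A.card + Y.card + D.card + M.card ≤ (W.filter fun T => 2 ≤ T.length).card := by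
    rw [← Finset.inter_eq_right.2 hAW, ← Finset.inter_eq_right.2 hYW,
      ← Finset.inter_eq_right.2 hDW, ← Finset.inter_eq_right.2 hMW, Finset.card_eq_sum_ones,
      Finset.card_eq_sum_ones, Finset.card_eq_sum_ones, Finset.card_eq_sum_ones,
      Finset.card_eq_sum_ones, ← Finset.sum_ite_mem, ← Finset.sum_ite_mem, ← Finset.sum_ite_mem,
      ← Finset.sum_ite_mem, Finset.sum_filter, ← Finset.sum_add_distrib, ← Finset.sum_add_distrib,
      ← Finset.sum_add_distrib]
    refine Finset.sum_le_sum fun T hT => ?_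
    by_cases h1 : T ∈ trees
    · have h2 := hact.1 h1
      have hTA : T ∈ A := List.mem_toFinset.2 h1
      have hTY : T ∉ Y := fun h => (Finset.mem_sdiff.1 h).2 (List.mem_toFinset.2 h2.1)
      have hTD : T ∉ D := fun h => (Finset.mem_sdiff.1 h).2 (List.mem_toFinset.2 (hremU h2.1))
      have hTM : T ∉ M := fun h => by have := (Finset.mem_filter.1 h).2; omega
      rw [if_pos hTA, if_neg hTY, if_neg hTD, if_neg hTM, if_pos (by omega)]
      omega
    have hTA : T ∉ A := fun h => h1 (List.mem_toFinset.1 h)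
    rw [if_neg hTA]
    by_cases h2 : T ∈ Y
    · have h4 := hY4 T h2
      have hTD : T ∉ D := fun h => (Finset.mem_sdiff.1 h).2 (Finset.mem_sdiff.1 h2).1
      have hTM : T ∉ M := fun h => by have := (Finset.mem_filter.1 h).2; omega
      rw [if_pos h2, if_neg hTD, if_neg hTM, if_pos (by omega)]
      omega
    rw [if_neg h2]
    by_cases h3 : T ∈ D
    · have h4 := hD4 T h3
      have hTM : T ∉ M := fun h => by have := (Finset.mem_filter.1 h).2; omega
      rw [if_pos h3, if_neg hTM, if_pos (by omega)]
      omega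
    rw [if_neg h3]
    by_cases h4 : T ∈ M
    · have := (Finset.mem_filter.1 h4).2
      rw [if_pos h4, if_pos (by omega)]
      omega
    · rw [if_neg h4]
      exact Nat.zero_le _
  have s3 : Q₀.length = M.card := by
    rw [hQ₀, length_filter_eq_card hw.nodup]
    simp [hM, hW]
  have s4 : ((preSmall w).map fun U => U.length - 1).sum =
      ((cluster fitsFour w).1.map fun U => U.length - 1).sum + Q₂.length := by
    have h : Q₂.map (fun U => U.length - 1) = Q₂.map fun _ => 1 :=
      List.map_congr_left fun q hq => by rw [(hQ₂.1 q hq).2]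
    rw [hpe, List.map_append, List.sum_append, h, List.map_const', List.sum_replicate, smul_eq_mul,
      mul_one]
  have s5 := hcl.sum_le
  rw [← hY] at s5
  rw [hsum, s4] at hlen
  refine ⟨?_, fun hk3 => ?_⟩
  -- In twentieths, a pair of `P` spends at most `4·7 + 7 = 35`, a triple of `R` at most `2·19 =
  -- 38`, and each tree of `D` or `M` costs 20. Trees of `Y`, with their clusters, cost `100/3` on
  -- average.
  · have s6 := Finset.sum_le_sum (s := A) fun T hT => (hbal T (List.mem_toFinset.1 hT)).1
    simp only [Finset.sum_add_distrib, ← Finset.mul_sum, Finset.sum_const, smul_eq_mul] at s6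
    have : aux.card = (F.filter fun S => S ∉ 𝒯).card := rfl
    omega
  · have no4 : ∀ T ∈ W, T.length ≠ 4 := fun T hT h => by
      have := hw.length_le (List.mem_toFinset.1 hT)
      omega
    have hY0 : Y.card = 0 := Finset.card_eq_zero.2 (Finset.eq_empty_of_forall_notMem fun T hT =>
      no4 T (hYW hT) (hY4 T hT))
    have hD0 : D.card = 0 := Finset.card_eq_zero.2 (Finset.eq_empty_of_forall_notMem fun T hT =>
      no4 T (hDW hT) (hD4 T hT))
    -- In thirtieths, a pair of `P` spends at most `4·5 + 15 = 35`, within its budget of 40; triples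
    -- are not charged.
    have s6 := Finset.sum_le_sum (s := A) fun T hT => (hbal T (List.mem_toFinset.1 hT)).2
      ((ht T (List.mem_toFinset.1 hT)).2.resolve_right (no4 T (hAW hT)))
    simp only [Finset.sum_add_distrib, ← Finset.mul_sum, Finset.sum_const, smul_eq_mul] at s6
    have : aux.card = (F.filter fun S => S ∉ 𝒯).card := rfl
    omega

end
end BSTSO

/-! ### The three approximation guarantees -/

theorem theorem1p2 :
    BSTSO.HasEfficientApprox (fun 𝒯 => BSTSO.maxTreeSize 𝒯 ≤ 3) (fun _ => 4 / 3) ∧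
    BSTSO.HasEfficientApprox (fun 𝒯 => BSTSO.maxTreeSize 𝒯 ≤ 4) (fun _ => 19 / 10) ∧
    BSTSO.HasEfficientApprox (fun _ => True) (fun 𝒯 => 2 / 3 * (BSTSO.maxTreeSize 𝒯 : ℚ)) := by
  refine ⟨?_, ?_, ?_⟩
  · refine BSTSO.hasEfficientApprox_of_plan BSTSO.PT.preSmall (fun _ => by norm_num)
      (fun _ _ => by norm_num) fun 𝒯 w hk hne hw => ?_
    obtain ⟨h1, h2⟩ := BSTSO.preSmall_spec (hk.trans (by norm_num)) hne hw
    refine ⟨h1, fun F hF hdec => ?_⟩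
    have h3 : (30 * (BSTSO.plan (BSTSO.preSmall w ++ BSTSO.sortLen w)).length : ℚ) ≤
        40 * F.card := by exact_mod_cast (h2 F hF hdec).2 hk
    linarith
  · refine BSTSO.hasEfficientApprox_of_plan BSTSO.PT.preSmall (fun _ => by norm_num)
      (fun _ _ => by norm_num) fun 𝒯 w hk hne hw => ?_
    obtain ⟨h1, h2⟩ := BSTSO.preSmall_spec hk hne hw
    refine ⟨h1, fun F hF hdec => ?_⟩
    have h3 : (20 * (BSTSO.plan (BSTSO.preSmall w ++ BSTSO.sortLen w)).length : ℚ) ≤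
        38 * F.card := by exact_mod_cast (h2 F hF hdec).1
    linarith
  · refine BSTSO.hasEfficientApprox_of_plan BSTSO.PT.preHalf (fun _ => by positivity)
      (fun 𝒯 ⟨T, hT, h2⟩ => ?_) fun 𝒯 w _ hne hw => ?_
    -- A tree with two elements makes `2k/3` at least `4/3`, so the single gate used for a constant
    -- operator is within the ratio.
    · have h3 : (2 : ℚ) ≤ BSTSO.maxTreeSize 𝒯 := by
        exact_mod_cast h2.trans (Finset.le_sup (f := Finset.card) hT)
      linarith
    · obtain ⟨h1, h2⟩ := BSTSO.preHalf_spec hne hw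
      refine ⟨h1, fun F hF hdec => ?_⟩
      have h3 : (3 * (BSTSO.plan (BSTSO.preHalf w ++ BSTSO.sortLen w)).length : ℚ) ≤
          2 * BSTSO.maxTreeSize 𝒯 * F.card := by exact_mod_cast h2 F hF hdec
      linarith
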